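/- Let $b,d,\xi>0$ and $$\Omega=\{(x,y,z)\in\mathbb R^3:\ |x|<b,\ |y|<b,\ -\xi<z<d\},\qquad \Gamma=\{(x,y,z):\ |x|<b,\ |y|<b,\ z=-\xi\}\subset\partial\Omega .$$ All functions are complex valued, $H^m(\Omega)$ is the Sobolev space with norm $\|u\|_{H^m(\Omega)}^2=\sum_{|\beta|\le m}\|D^\beta u\|_{L^2(\Omega)}^2$, and $\|f\|_{C^1(\overline\Omega)}=\sup_\Omega|f|+\sum_{i=1}^{3}\sup_\Omega|\partial_i f|$. Functions in $H^3(\Omega)\subset C^1(\overline\Omega)$ and their first derivatives are evaluated on $\partial\Omega$ through their continuous representatives. Put $$H^3_0(\Omega)=\{u\in H^3(\Omega):\ u=0\ \text{on}\ \partial\Omega,\ u_z=0\ \text{on}\ \Gamma\}.$$ We say that $u\in H^3(\Omega)$ satisfies the boundary conditions $(\psi_0,\psi_1)$ if $u=\psi_0$ and $u_z=\psi_1$ on $\Gamma$, and $u=0$ on $\partial\Omega\setminus\Gamma$. For $s>\xi$ and $\mu,\nu,\alpha>0$ define, for $V\in H^3(\Omega)$, $$I_{\mu,\nu,\alpha}(V)=e^{-2\mu(s+d)^{-\nu}}\int_\Omega|\Delta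 V|^2\,e^{2\mu(z+s)^{-\nu}}\,d\mathbf x+\alpha\|V\|_{H^3(\Omega)}^2 ,\qquad t_\nu=(s-\xi)^{-\nu}-(s+d)^{-\nu}>0 .$$ **Theorem.** (i) Let $s>\xi$ and let $Q\in H^3(\Omega)$ satisfy the boundary conditions $(\psi_0,\psi_1)$. For all $\mu,\nu,\alpha>0$ the functional $W\mapsto I_{\mu,\nu,\alpha}(W+Q)$ has a unique minimizer $W_{\mu,\nu,\alpha}$ on $H^3_0(\Omega)$. Put $V_{\mu,\nu,\alpha}=W_{\mu,\nu,\alpha}+Q$. (ii) There are constants $c,C>0$ depending only on $\Omega$ such that the following holds. Let $s>\xi$, let $\nu_0\ge1$ and $\lambda_0\ge1$ be any numbers (in particular, any thresholds $\nu_0,\lambda_0\geq 1$, depending on $\Omega$, $s$, for a Carleman estimate for $\Delta$ on $\Omega$ with the weight $e^{2\lambda(z+s)^{-\nu}}$, $\nu\ge\nu_0$, $\lambda\ge\lambda_0$), and let $\nu\ge\nu_0$, $0<\delta_0<e^{-2\lambda_0t_\nu}$ and $0<\delta<\delta_0$. Let $V_*\in H^3(\Omega)$ satisfy $\Delta V_*=0$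 in $\Omega$ and the boundary conditions $(\psi_{0*},\psi_{1*})$ (the exact tail). Let $Q_*\in H^3(\Omega)$ satisfy the boundary conditions $(\psi_{0*},\psi_{1*})$ and $\|Q_*\|_{H^3(\Omega)}\le K\|V_*\|_{H^3(\Omega)}$ for some $K>0$, and let $Q\in H^3(\Omega)$ satisfy the boundary conditions $(\psi_0,\psi_1)$ and $\|Q-Q_*\|_{H^3(\Omega)}<\delta$. Choose $$\alpha(\delta)=\delta,\qquad \mu(\delta)=\ln\bigl(\delta^{-1/(2t_\nu)}\bigr),\qquad V=V_{\mu(\delta),\nu,\alpha(\delta)} .$$ Then $$\|V-V_*\|_{H^2(\Omega)}\le C\bigl(1+\|V_*\|_{H^3(\Omega)}\bigr)\sqrt\delta\,\sqrt{\ln\bigl(\delta^{-1/(2t_\nu)}\bigr)} ,$$ and $V\in C^1(\overline\Omega)$ with $$c\,\|V\|_{C^1(\overline\Omega)}\le\|V\|_{H^3(\Omega)}\le C\bigl(1+\|V_*\|_{H^3(\Omega)}\bigr).$$ -/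

import Mathlib

open MeasureTheory Set Filter Topology

noncomputable section

namespace QuasiReversibility

/-- Euclidean space `ℝ³`; the coordinates `(x, y, z)` are `(p 0, p 1, p 2)`. -/
abbrev E3 : Type := EuclideanSpace ℝ (Fin 3)

/-- The domain `Ω = {|x| < b, |y| < b, -ξ < z < d}`. -/
def domain (b d ξ : ℝ) : Set E3 :=
  {p | |p 0| < b ∧ |p 1| < b ∧ -ξ < p 2 ∧ p 2 < d}

/-- The backscattering part `Γ = {|x| < b, |y| < b, z = -ξ}` of the boundary of `Ω`. -/
def backSide (b ξ : ℝ) : Set E3 :=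
  {p | |p 0| < b ∧ |p 1| < b ∧ p 2 = -ξ}

/-- The classical partial derivative `∂f / ∂xᵢ`. -/
def partialD {F : Type*} [NormedAddCommGroup F] [NormedSpace ℝ F] (i : Fin 3) (f : E3 → F) :
    E3 → F :=
  fun p => fderiv ℝ f p (EuclideanSpace.single i 1)

/-- The classical derivative `∂^β f = ∂₀^{β₀} ∂₁^{β₁} ∂₂^{β₂} f` for a multi-index `β`. -/
def multiD (β : Fin 3 → ℕ) (f : E3 → ℝ) : E3 → ℝ :=
  (partialD 0)^[β 0] ((partialD 1)^[β 1] ((partialD 2)^[β 2] f))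

/-- The complex (equivalently: two-component real) Hilbert space `L²(Ω)`. -/
abbrev L2 (Ω : Set E3) : Type := Lp ℂ 2 (volume.restrict Ω)

/-- `g` is the weak derivative of `u` in `Ω` for the multi-index `β`:
`∫_Ω (∂^β φ) u = (-1)^{|β|} ∫_Ω φ g` for all test functions `φ ∈ C_c^∞(Ω)`. -/
def IsWeakDeriv (Ω : Set E3) (β : Fin 3 → ℕ) (u g : L2 Ω) : Prop :=
  ∀ φ : E3 → ℝ, ContDiff ℝ (⊤ : ℕ∞) φ → HasCompactSupport φ → tsupport φ ⊆ Ω →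
    ∫ p in Ω, multiD β φ p • u p = (-1 : ℝ) ^ (∑ i, β i) • ∫ p in Ω, φ p • g p

theorem contDiff_partialD_iterate (i : Fin 3) (n : ℕ) {f : E3 → ℝ}
    (hf : ContDiff ℝ (⊤ : ℕ∞) f) : ContDiff ℝ (⊤ : ℕ∞) ((partialD i)^[n] f) := by
  induction n with
  | zero => simpa using hf
  | succ n ih =>
    rw [Function.iterate_succ_apply']
    exact (ih.fderiv_right (m := ((⊤ : ℕ∞) : WithTop ℕ∞)) (by simp)).clm_apply contDiff_const

theorem hasCompactSupport_partialD_iterate (i : Fin 3) (n : ℕ) {f : E3 → ℝ}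
    (hf : HasCompactSupport f) : HasCompactSupport ((partialD i)^[n] f) := by
  induction n with
  | zero => simpa using hf
  | succ n ih =>
    rw [Function.iterate_succ_apply']
    exact ih.fderiv_apply ℝ _

theorem integrable_smul_L2 {Ω : Set E3} {φ : E3 → ℝ} (h1 : Continuous φ)
    (h2 : HasCompactSupport φ) (u : L2 Ω) :
    Integrable (fun p => φ p • u p) (volume.restrict Ω) := by
  have h3 : MemLp φ 2 (volume.restrict Ω) :=
    (h1.memLp_of_hasCompactSupport h2 (p := 2) (μ := volume)).restrict Ω
  exact memLp_one_iff_integrable.1 ((Lp.memLp u).smul h3)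

theorem integrable_multiD_smul {Ω : Set E3} (β : Fin 3 → ℕ) {φ : E3 → ℝ}
    (h1 : ContDiff ℝ (⊤ : ℕ∞) φ) (h2 : HasCompactSupport φ) (u : L2 Ω) :
    Integrable (fun p => multiD β φ p • u p) (volume.restrict Ω) := by
  refine integrable_smul_L2 ?_ ?_ u
  · exact (contDiff_partialD_iterate 0 _ (contDiff_partialD_iterate 1 _
      (contDiff_partialD_iterate 2 _ h1))).continuous
  · exact hasCompactSupport_partialD_iterate 0 _ (hasCompactSupport_partialD_iterate 1 _
      (hasCompactSupport_partialD_iterate 2 _ h2))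

theorem IsWeakDeriv.zero {Ω : Set E3} (β : Fin 3 → ℕ) : IsWeakDeriv Ω β 0 0 := by
  intro φ _ _ _
  have h0 : ∀ ψ : E3 → ℝ, ∫ p in Ω, ψ p • (0 : L2 Ω) p = 0 := by
    intro ψ
    refine integral_eq_zero_of_ae ?_
    filter_upwards [Lp.coeFn_zero ℂ 2 (volume.restrict Ω)] with p hp
    rw [hp]
    exact smul_zero _
  rw [h0, h0, smul_zero]

theorem IsWeakDeriv.add {Ω : Set E3} {β : Fin 3 → ℕ} {u v g h : L2 Ω}
    (hu : IsWeakDeriv Ω β u g) (hv : IsWeakDeriv Ω β v h) :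
    IsWeakDeriv Ω β (u + v) (g + h) := by
  intro φ h1 h2 h3
  have key : ∀ (ψ : E3 → ℝ) (a c : L2 Ω),
      Integrable (fun p => ψ p • a p) (volume.restrict Ω) →
      Integrable (fun p => ψ p • c p) (volume.restrict Ω) →
      ∫ p in Ω, ψ p • (a + c) p = (∫ p in Ω, ψ p • a p) + ∫ p in Ω, ψ p • c p := by
    intro ψ a c ha hc
    rw [← integral_add ha hc]
    refine integral_congr_ae ?_
    filter_upwards [Lp.coeFn_add a c] with p hp
    rw [hp]
    exact smul_add _ _ _
  rw [key _ _ _ (integrable_multiD_smul β h1 h2 u) (integrable_multiD_smul β h1 h2 v),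
    key _ _ _ (integrable_smul_L2 h1.continuous h2 g) (integrable_smul_L2 h1.continuous h2 h),
    hu φ h1 h2 h3, hv φ h1 h2 h3, smul_add]

theorem IsWeakDeriv.smul {Ω : Set E3} {β : Fin 3 → ℕ} {u g : L2 Ω} (c : ℂ)
    (hu : IsWeakDeriv Ω β u g) : IsWeakDeriv Ω β (c • u) (c • g) := by
  intro φ h1 h2 h3
  have key : ∀ (ψ : E3 → ℝ) (a : L2 Ω),
      ∫ p in Ω, ψ p • (c • a) p = c • ∫ p in Ω, ψ p • a p := by
    intro ψ a
    rw [← integral_smul]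
    refine integral_congr_ae ?_
    filter_upwards [Lp.coeFn_smul c a] with p hp
    simp only [hp, Pi.smul_apply]
    exact smul_comm _ _ _
  rw [key, key, hu φ h1 h2 h3, smul_comm]

/-- Weak derivatives in an open set are unique, so `weakD` below is well defined. -/
theorem IsWeakDeriv.unique {Ω : Set E3} (hΩ : IsOpen Ω) {β : Fin 3 → ℕ} {u g h : L2 Ω}
    (hg : IsWeakDeriv Ω β u g) (hh : IsWeakDeriv Ω β u h) : g = h := by
  have hloc : ∀ a : L2 Ω, LocallyIntegrableOn a Ω volume := by
    intro a
    have h1 : LocallyIntegrable a (volume.restrict Ω) :=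
      (Lp.memLp a).locallyIntegrable (by norm_num)
    exact locallyIntegrableOn_of_locallyIntegrable_restrict h1
  have hz := hΩ.ae_eq_zero_of_integral_contDiff_smul_eq_zero (μ := volume)
    (f := fun p => g p - h p) ((hloc g).sub (hloc h)) (by
      intro φ h1 h2 h3
      have e := (hg φ h1 h2 h3).symm.trans (hh φ h1 h2 h3)
      have hne : ((-1 : ℝ) ^ (∑ i, β i)) ≠ 0 := pow_ne_zero _ (by norm_num)
      have e' := smul_right_injective ℂ hne e
      have i1 := integrable_smul_L2 h1.continuous h2 g
      have i2 := integrable_smul_L2 h1.continuous h2 h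
      have hs : ∫ p, φ p • (g p - h p) = ∫ p in Ω, φ p • (g p - h p) := by
        refine (setIntegral_eq_integral_of_forall_compl_eq_zero ?_).symm
        intro p hp
        rw [image_eq_zero_of_notMem_tsupport (fun hq => hp (h3 hq)), zero_smul]
      rw [hs]
      simp_rw [smul_sub]
      rw [integral_sub i1 i2]
      exact sub_eq_zero.2 e')
  refine Lp.ext ?_
  rw [EventuallyEq, ae_restrict_iff' hΩ.measurableSet]
  filter_upwards [hz] with p hp hpΩ
  exact sub_eq_zero.1 (hp hpΩ)

/-- The Sobolev space `H^m(Ω)` of complex valued functions: the functions in `L²(Ω)` all of whose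
weak derivatives of order at most `m` exist and lie in `L²(Ω)`. -/
def sobolev (Ω : Set E3) (m : ℕ) : Submodule ℂ (L2 Ω) where
  carrier := {u | ∀ β : Fin 3 → ℕ, ∑ i, β i ≤ m → ∃ g : L2 Ω, IsWeakDeriv Ω β u g}
  zero_mem' := fun β _ => ⟨0, IsWeakDeriv.zero β⟩
  add_mem' := fun hu hv β hβ =>
    let ⟨g, hg⟩ := hu β hβ
    let ⟨h, hh⟩ := hv β hβ
    ⟨g + h, hg.add hh⟩
  smul_mem' := fun c _ hu β hβ =>
    let ⟨g, hg⟩ := hu β hβ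
    ⟨c • g, hg.smul c⟩

open Classical in
/-- The weak derivative `D^β u` (the value `0` is used where it does not exist in `L²(Ω)`). -/
def weakD {Ω : Set E3} (β : Fin 3 → ℕ) (u : L2 Ω) : L2 Ω :=
  if h : ∃ g : L2 Ω, IsWeakDeriv Ω β u g then h.choose else 0

/-- The multi-indices `β` with `|β| ≤ m`. -/
def multiIndices (m : ℕ) : Finset (Fin 3 → ℕ) :=
  (Fintype.piFinset fun _ : Fin 3 => Finset.range (m + 1)).filter fun β => ∑ i, β i ≤ m

/-- The norm `‖u‖_{H^m(Ω)} = (∑_{|β| ≤ m} ‖D^β u‖²_{L²(Ω)})^{1/2}`, for `u ∈ H^m(Ω)`. -/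
def sobolevNorm {Ω : Set E3} (m : ℕ) (u : L2 Ω) : ℝ :=
  Real.sqrt (∑ β ∈ multiIndices m, ‖weakD β u‖ ^ 2)

/-- The weak `z`-derivative `u_z`. -/
def weakDz {Ω : Set E3} (u : L2 Ω) : L2 Ω := weakD (Pi.single 2 1) u

/-- The Laplacian `Δu = u_xx + u_yy + u_zz`, for `u ∈ H²(Ω)`. -/
def weakLaplacian {Ω : Set E3} (u : L2 Ω) : L2 Ω :=
  ∑ i : Fin 3, weakD (Pi.single i 2) u

/-- `u = ψ` on the part `A` of the boundary of `Ω`: the class `u` has a representative that is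
continuous on the closure of `Ω`, and it takes the values `ψ` on `A`. For `u ∈ H³(Ω) ⊆ C¹(closure Ω)`
this applies both to `u` and to its first derivatives. -/
def HasBoundaryValues {Ω : Set E3} (u : L2 Ω) (A : Set E3) (ψ : E3 → ℂ) : Prop :=
  ∃ f : E3 → ℂ, ContinuousOn f (closure Ω) ∧ (f =ᵐ[volume.restrict Ω] u) ∧ ∀ p ∈ A, f p = ψ p

/-- The overdetermined boundary conditions
`u = ψ₀` and `u_z = ψ₁` on `Γ`, `u = 0` on `∂Ω \ Γ`. -/
structure BoundaryConditions (b d ξ : ℝ) (ψ₀ ψ₁ : E3 → ℂ) (u : L2 (domain b d ξ)) : Prop where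
  dirichlet : HasBoundaryValues u (backSide b ξ) ψ₀
  neumann : HasBoundaryValues (weakDz u) (backSide b ξ) ψ₁
  rest : HasBoundaryValues u (frontier (domain b d ξ) \ backSide b ξ) (fun _ => 0)

/-- `H³₀(Ω) = {u ∈ H³(Ω) : u = 0 on ∂Ω, u_z = 0 on Γ}`. -/
def H30 (b d ξ : ℝ) : Set (sobolev (domain b d ξ) 3) :=
  {u | HasBoundaryValues (u : L2 (domain b d ξ)) (frontier (domain b d ξ)) (fun _ => 0) ∧
    HasBoundaryValues (weakDz (u : L2 (domain b d ξ))) (backSide b ξ) (fun _ => 0)}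

/-- The Carleman weight function `φ_μ(z) = exp(2 μ (z + s)^{-ν})`. -/
def carlemanWeight (s ν μ z : ℝ) : ℝ := Real.exp (2 * μ * (z + s) ^ (-ν))

/-- The functional
`I_{μ,α}(V) = exp(-2 μ (s + d)^{-ν}) ∫_Ω |ΔV|² φ_μ(z) dx + α ‖V‖²_{H³(Ω)}`. -/
def tailFunctional (b d ξ s μ ν α : ℝ) (V : sobolev (domain b d ξ) 3) : ℝ :=
  Real.exp (-2 * μ * (s + d) ^ (-ν)) *
      (∫ p in domain b d ξ,
        ‖weakLaplacian (V : L2 (domain b d ξ)) p‖ ^ 2 * carlemanWeight s ν μ (p 2)) +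
    α * sobolevNorm 3 (V : L2 (domain b d ξ)) ^ 2

/-- `W` minimizes `W ↦ I_{μ,α}(W + Q)` over `H³₀(Ω)`. -/
def IsTailMinimizer (b d ξ s μ ν α : ℝ) (Q W : sobolev (domain b d ξ) 3) : Prop :=
  W ∈ H30 b d ξ ∧ ∀ W' ∈ H30 b d ξ,
    tailFunctional b d ξ s μ ν α (W + Q) ≤ tailFunctional b d ξ s μ ν α (W' + Q)

/-- The number `t_ν = (s - ξ)^{-ν} - (s + d)^{-ν}`. -/
def tNu (d ξ s ν : ℝ) : ℝ := (s - ξ) ^ (-ν) - (s + d) ^ (-ν)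

/-- The choice `μ(δ) = ln (δ^{-1/(2 t_ν)})`. -/
def muOf (d ξ s ν δ : ℝ) : ℝ := Real.log (δ ^ (-(1 / (2 * tNu d ξ s ν))))

/-- `f ∈ C¹(closure Ω)`: `f` is continuously differentiable in `Ω`, and `f` is continuous up to the
boundary, to which its first partial derivatives extend continuously. -/
def IsC1Closure (Ω : Set E3) (f : E3 → ℂ) : Prop :=
  ContDiffOn ℝ 1 f Ω ∧ ContinuousOn f (closure Ω) ∧
    ∀ i : Fin 3, ∃ g : E3 → ℂ, ContinuousOn g (closure Ω) ∧ ∀ p ∈ Ω, g p = partialD i f p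

/-- The `C¹(closure Ω)` norm `sup |f| + ∑ᵢ sup |∂ᵢ f|`. The suprema over the open set `Ω` are those
over its closure, by continuity. -/
def c1Norm (Ω : Set E3) (f : E3 → ℂ) : ℝ :=
  (⨆ p : Ω, ‖f p‖) + ∑ i : Fin 3, ⨆ p : Ω, ‖partialD i f p‖

end QuasiReversibility

end

open QuasiReversibility

/-! The estimate is an energy comparison followed by elliptic regularity on the box. After
normalisation by `exp(-2μ(s+d)^(-ν))` the weight lies between 1 and `exp(2μ t_ν)` on Ω, and μ(δ) is
chosen so that the upper bound is exactly 1/δ. Write E = Q - Q_* and N for the H³ norm of V_*. The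
difference V_* - Q_* belongs to H³₀, so it competes with W; the corresponding argument of the
functional is V_* + E, whose Laplacian is ΔE because V_* is harmonic. Minimality gives ‖ΔV‖² +
δ‖V‖²_{H³} ≤ δ⁻¹‖ΔE‖² + δ‖V_* + E‖²_{H³} ≤ 9δ + δ(1+N)², hence ‖V‖_{H³} = O(1+N) and ‖ΔV‖ =
O((1+N)√δ) (`le_tailFunctional`, `tailFunctional_le`, `minimizer_bounds`). The function h = V - V_*
- E vanishes on ∂Ω and ‖Δh‖ = O((1+N)√δ), so the estimate ‖h‖_{H²} ≤ K‖Δh‖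
(`exists_sobolevNorm_two_le`) yields the rate. No Carleman estimate enters: the weight is used only
through its two bounds, and the logarithmic factor only through being at least 1.

The H² estimate rests on ‖Δh‖² = ∑ ‖h_ij‖² for functions vanishing on the boundary of a box
(`inner_weakD_pure`, `norm_sq_weakLaplacian`), together with Poincaré's inequality. Two integrations
by parts are needed at a boundary with edges and corners. They are replaced by anisotropic
approximation (`exists_smooth_approx`): a function extended by zero is dilated outward across the
sides where nothing is known and contracted inward from the others, then mollified. Vanishing traces
enter through `HasWD.extend_by_zero`, which shows that the extension by zero keeps its weak first
derivatives on all of space.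

The embedding H³ ⊆ C¹ (`exists_c1_representative`) follows from a Sobolev inequality proved by
averaging a second-order Taylor formula. It gives the C¹ bound, and it also shows that the boundary
conditions survive H³ limits. Existence and uniqueness of the minimizer then reduce to orthogonal
projection: the functional is the squared norm of an injective linear map into a Hilbert space that
sends H³₀ onto a closed subspace. -/

noncomputable section
namespace QuasiReversibility

/-! ### Classical partial derivatives of smooth functions -/

section Calculus

variable {F G : Type*} [NormedAddCommGroup F] [NormedSpace ℝ F] [NormedAddCommGroup G]
  [NormedSpace ℝ G]

/-- The classical derivative `∂^β f` of a vector valued function. -/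
def mderiv (β : Fin 3 → ℕ) (f : E3 → F) : E3 → F :=
  (partialD 0)^[β 0] ((partialD 1)^[β 1] ((partialD 2)^[β 2] f))

theorem contDiff_partialD (i : Fin 3) {f : E3 → F}
    (hf : ContDiff ℝ (⊤ : ℕ∞) f) : ContDiff ℝ (⊤ : ℕ∞) (partialD i f) :=
  (hf.fderiv_right (m := ((⊤ : ℕ∞) : WithTop ℕ∞)) (by simp)).clm_apply contDiff_const

theorem iterate_partialD_induction {P : (E3 → F) → Prop} (i : Fin 3)
    (h : ∀ f, P f → P (partialD i f)) (n : ℕ) {f : E3 → F} (hf : P f) :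
    P ((partialD i)^[n] f) := by
  induction n with
  | zero => exact hf
  | succ n ih => rw [Function.iterate_succ_apply']; exact h _ ih

theorem contDiff_iterate_partialD (i : Fin 3) (n : ℕ) {f : E3 → F}
    (hf : ContDiff ℝ (⊤ : ℕ∞) f) : ContDiff ℝ (⊤ : ℕ∞) ((partialD i)^[n] f) :=
  iterate_partialD_induction i (fun _ h => contDiff_partialD i h) n hf

theorem mderiv_induction {P : (E3 → F) → Prop} (h : ∀ i f, P f → P (partialD i f))
    (β : Fin 3 → ℕ) {f : E3 → F} (hf : P f) : P (mderiv β f) :=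
  iterate_partialD_induction 0 (h 0) _ (iterate_partialD_induction 1 (h 1) _
    (iterate_partialD_induction 2 (h 2) _ hf))

theorem contDiff_mderiv (β : Fin 3 → ℕ) {f : E3 → F}
    (hf : ContDiff ℝ (⊤ : ℕ∞) f) : ContDiff ℝ (⊤ : ℕ∞) (mderiv β f) :=
  mderiv_induction (fun i _ h => contDiff_partialD i h) β hf

theorem tsupport_partialD_subset (i : Fin 3) (f : E3 → F) :
    tsupport (partialD i f) ⊆ tsupport f :=
  (tsupport_fderiv_apply_subset ℝ (EuclideanSpace.single i 1))

theorem tsupport_mderiv_subset (β : Fin 3 → ℕ) (f : E3 → F) :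
    tsupport (mderiv β f) ⊆ tsupport f :=
  mderiv_induction (P := fun g => tsupport g ⊆ tsupport f)
    (fun i g h => (tsupport_partialD_subset i g).trans h) β subset_rfl

theorem hasCompactSupport_mderiv (β : Fin 3 → ℕ) {f : E3 → F}
    (hf : HasCompactSupport f) : HasCompactSupport (mderiv β f) :=
  hf.of_isClosed_subset (isClosed_tsupport _) (tsupport_mderiv_subset β f)

theorem partialD_comm (i j : Fin 3) {f : E3 → F} (hf : ContDiff ℝ (⊤ : ℕ∞) f) :
    partialD i (partialD j f) = partialD j (partialD i f) := by
  have hd : Differentiable ℝ (fderiv ℝ f) :=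
    (hf.fderiv_right (m := ((⊤ : ℕ∞) : WithTop ℕ∞)) (by simp)).differentiable (by simp)
  have key : ∀ (i j : Fin 3) (p : E3), partialD i (partialD j f) p =
      fderiv ℝ (fderiv ℝ f) p (EuclideanSpace.single i 1) (EuclideanSpace.single j 1) := by
    intro i j p
    have : HasFDerivAt (partialD j f)
        ((ContinuousLinearMap.apply ℝ F (EuclideanSpace.single j (1 : ℝ))).comp
          (fderiv ℝ (fderiv ℝ f) p)) p :=
      (ContinuousLinearMap.apply ℝ F (EuclideanSpace.single j (1 : ℝ))).hasFDerivAt.comp p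
        (hd p).hasFDerivAt
    change fderiv ℝ (partialD j f) p _ = _
    rw [this.fderiv]; rfl
  funext p
  rw [key, key]
  exact (hf.contDiffAt.isSymmSndFDerivAt (by simpa using (WithTop.coe_le_coe.2 le_top : ((2 : ℕ∞) : WithTop ℕ∞) ≤ ((⊤ : ℕ∞) : WithTop ℕ∞)))) _ _

theorem partialD_iterate_comm (i j : Fin 3) (n : ℕ) {f : E3 → F}
    (hf : ContDiff ℝ (⊤ : ℕ∞) f) :
    partialD i ((partialD j)^[n] f) = (partialD j)^[n] (partialD i f) := by
  induction n generalizing f with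
  | zero => rfl
  | succ n ih =>
    rw [Function.iterate_succ_apply, Function.iterate_succ_apply, ih (contDiff_partialD j hf),
      partialD_comm i j hf]

theorem partialD_mderiv (i : Fin 3) (β : Fin 3 → ℕ) {f : E3 → F}
    (hf : ContDiff ℝ (⊤ : ℕ∞) f) :
    partialD i (mderiv β f) = mderiv (β + Pi.single i 1) f := by
  have h2 : ContDiff ℝ (⊤ : ℕ∞) ((partialD 2)^[β 2] f) :=
    contDiff_iterate_partialD 2 _ hf
  have h1 : ContDiff ℝ (⊤ : ℕ∞) ((partialD 1)^[β 1] ((partialD 2)^[β 2] f)) :=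
    contDiff_iterate_partialD 1 _ h2
  fin_cases i
  · simp [mderiv, Function.iterate_succ_apply']
  · simp [mderiv, Function.iterate_succ_apply', partialD_iterate_comm 1 0 _ h1]
  · simp [mderiv, Function.iterate_succ_apply', partialD_iterate_comm 2 0 _ h1,
      partialD_iterate_comm 2 1 _ h2]

theorem mderiv_zero (f : E3 → F) : mderiv 0 f = f := rfl

theorem mderiv_single (i : Fin 3) {f : E3 → F} (hf : ContDiff ℝ (⊤ : ℕ∞) f) :
    mderiv (Pi.single i 1) f = partialD i f := by
  rw [← zero_add (Pi.single i 1), ← partialD_mderiv i 0 hf, mderiv_zero]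

theorem mderiv_mderiv (β γ : Fin 3 → ℕ) {f : E3 → F} (hf : ContDiff ℝ (⊤ : ℕ∞) f) :
    mderiv β (mderiv γ f) = mderiv (β + γ) f := by
  have key : ∀ (i : Fin 3) (n : ℕ) (γ : Fin 3 → ℕ),
      (partialD i)^[n] (mderiv γ f) = mderiv (γ + Pi.single i n) f := by
    intro i n γ
    induction n with
    | zero => simp
    | succ n ih =>
      rw [Function.iterate_succ_apply', ih, partialD_mderiv i _ hf, add_assoc, ← Pi.single_add]
  rw [mderiv, key, key, key]
  congr 1
  funext i
  fin_cases i <;> simp <;> omega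

/-- Applied to real and imaginary parts, this lets real test functions handle complex ones; applied
to the projections of a pair, it gives linearity in `mderiv_sub`. -/
theorem mderiv_clm_comp (L : F →L[ℝ] G) (β : Fin 3 → ℕ) {f : E3 → F}
    (hf : ContDiff ℝ (⊤ : ℕ∞) f) :
    mderiv β (fun p => L (f p)) = fun p => L (mderiv β f p) := by
  have step : ∀ (i : Fin 3) (n : ℕ) (g : E3 → F), ContDiff ℝ (⊤ : ℕ∞) g →
      (partialD i)^[n] (fun p => L (g p)) = fun p => L ((partialD i)^[n] g p) := by
    intro i n
    induction n with
    | zero => intro g _; rfl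
    | succ n ih =>
      intro g hg
      rw [Function.iterate_succ_apply, Function.iterate_succ_apply]
      rw [← ih _ (contDiff_partialD i hg)]
      congr 1
      funext p
      have := L.hasFDerivAt.comp p (hg.differentiable (by simp) p).hasFDerivAt
      have h2 := this.fderiv
      simp only [partialD]
      change (fderiv ℝ (⇑L ∘ g) p) _ = _
      rw [h2]; rfl
  have h2 : ContDiff ℝ (⊤ : ℕ∞) ((partialD 2)^[β 2] f) :=
    contDiff_iterate_partialD 2 _ hf
  have h1 : ContDiff ℝ (⊤ : ℕ∞) ((partialD 1)^[β 1] ((partialD 2)^[β 2] f)) :=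
    contDiff_iterate_partialD 1 _ h2
  simp only [mderiv]
  rw [step 2 _ f hf, step 1 _ _ h2, step 0 _ _ h1]

/-- The diagonal linear map `p ↦ (t₀ p₀, t₁ p₁, t₂ p₂)`. -/
def scal (t : Fin 3 → ℝ) : E3 →L[ℝ] E3 :=
  ∑ i, t i • (EuclideanSpace.proj i : E3 →L[ℝ] ℝ).smulRight (EuclideanSpace.single i (1 : ℝ))

@[simp] theorem scal_apply (t : Fin 3 → ℝ) (p : E3) (i : Fin 3) : scal t p i = t i * p i := by
  fin_cases i <;> simp [scal, Fin.sum_univ_three]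

theorem scal_single (t : Fin 3 → ℝ) (i : Fin 3) :
    scal t (EuclideanSpace.single i 1) = t i • EuclideanSpace.single i (1 : ℝ) := by
  ext j
  by_cases h : j = i <;> simp [h]

theorem det_scal (t : Fin 3 → ℝ) : LinearMap.det (scal t : E3 →ₗ[ℝ] E3) = ∏ i, t i := by
  rw [← LinearMap.det_toMatrix (EuclideanSpace.basisFun (Fin 3) ℝ).toBasis]
  have : LinearMap.toMatrix (EuclideanSpace.basisFun (Fin 3) ℝ).toBasis
      (EuclideanSpace.basisFun (Fin 3) ℝ).toBasis (scal t : E3 →ₗ[ℝ] E3) = Matrix.diagonal t := by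
    ext i j
    rw [LinearMap.toMatrix_apply]
    by_cases h : i = j <;> simp [h]
  rw [this, Matrix.det_diagonal]

/-- A diagonal map does not mix coordinates, so the chain rule contributes only one factor `t i` for
each derivative in direction `i`. -/
theorem mderiv_comp_affine (a : E3) (t : Fin 3 → ℝ) (β : Fin 3 → ℕ) {f : E3 → F}
    (hf : ContDiff ℝ (⊤ : ℕ∞) f) :
    mderiv β (fun q => f (a + scal t q)) =
      fun q => (∏ i, t i ^ β i) • mderiv β f (a + scal t q) := by
  -- The scalar `c` is carried along so that the step can be iterated.
  have step1 : ∀ (i : Fin 3) (c : ℝ) (g : E3 → F), ContDiff ℝ (⊤ : ℕ∞) g →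
      partialD i (fun q => c • g (a + scal t q)) =
        fun q => (c * t i) • partialD i g (a + scal t q) := by
    intro i c g hg
    funext q
    have h1 : HasFDerivAt (fun q => a + scal t q) (scal t) q :=
      (scal t).hasFDerivAt.const_add a
    have h2 := ((hg.differentiable (by simp) (a + scal t q)).hasFDerivAt.comp q h1).const_smul c
    have h3 := h2.fderiv
    simp only [partialD]
    change (fderiv ℝ (c • (g ∘ fun q => a + scal t q)) q) _ = _
    rw [h3]
    simp [scal_single, mul_smul]
  have step : ∀ (i : Fin 3) (n : ℕ) (c : ℝ) (g : E3 → F), ContDiff ℝ (⊤ : ℕ∞) g →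
      (partialD i)^[n] (fun q => c • g (a + scal t q)) =
        fun q => (c * t i ^ n) • (partialD i)^[n] g (a + scal t q) := by
    intro i n
    induction n with
    | zero => intro c g _; simp
    | succ n ih =>
      intro c g hg
      rw [Function.iterate_succ_apply, Function.iterate_succ_apply, step1 i c g hg,
        ih _ _ (contDiff_partialD i hg), pow_succ']
      simp only [mul_assoc]
  have h2 : ContDiff ℝ (⊤ : ℕ∞) ((partialD 2)^[β 2] f) :=
    contDiff_iterate_partialD 2 _ hf
  have h1 : ContDiff ℝ (⊤ : ℕ∞) ((partialD 1)^[β 1] ((partialD 2)^[β 2] f)) :=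
    contDiff_iterate_partialD 1 _ h2
  have h0 : (fun q => f (a + scal t q)) = fun q => (1 : ℝ) • f (a + scal t q) := by simp
  simp only [mderiv]
  rw [h0, step 2 _ _ f hf, step 1 _ _ _ h2, step 0 _ _ _ h1, Fin.prod_univ_three]
  funext q
  congr 1
  ring

end Calculus

end QuasiReversibility
end

noncomputable section
namespace QuasiReversibility
open scoped ENNReal Convolution
open ContinuousLinearMap (lsmul)

/-! ### Mollification combined with coordinate dilations in L² -/

section Mollification

theorem eLpNorm_two_sq {α F : Type*} [MeasurableSpace α] [NormedAddCommGroup F] (f : α → F)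
    (μ : Measure α) : eLpNorm f 2 μ ^ 2 = ∫⁻ x, ‖f x‖ₑ ^ 2 ∂μ := by
  have h := eLpNorm_nnreal_pow_eq_lintegral (f := f) (μ := μ) (p := 2) (by norm_num)
  simpa using h

theorem sq_lintegral_le {α : Type*} [MeasurableSpace α] (μ : Measure α) {f : α → ℝ≥0∞}
    (hf : AEMeasurable f μ) : (∫⁻ x, f x ∂μ) ^ 2 ≤ μ univ * ∫⁻ x, f x ^ 2 ∂μ := by
  have h := ENNReal.lintegral_mul_le_Lp_mul_Lq μ (Real.HolderConjugate.two_two)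
    (aemeasurable_const (b := (1 : ℝ≥0∞))) hf
  have h2 : (∫⁻ x, f x ∂μ) ≤ (μ univ) ^ (1 / (2 : ℝ)) * (∫⁻ x, f x ^ 2 ∂μ) ^ (1 / (2 : ℝ)) := by
    simpa using h
  calc _ ≤ ((μ univ) ^ (1 / (2 : ℝ)) * (∫⁻ x, f x ^ 2 ∂μ) ^ (1 / (2 : ℝ))) ^ 2 := by gcongr
    _ = _ := by
      rw [mul_pow, ← ENNReal.rpow_natCast, ← ENNReal.rpow_natCast, ← ENNReal.rpow_mul,
        ← ENNReal.rpow_mul]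
      simp

/-- Young's inequality `‖ρ ⋆ v‖₂ ≤ ‖v‖₂` for a probability density `ρ`. -/
theorem eLpNorm_convolution_le {ρ : E3 → ℝ} (h0 : ∀ x, 0 ≤ ρ x) (hc : Continuous ρ)
    (hs : HasCompactSupport ρ) (h1 : ∫ x, ρ x = 1) {v : E3 → ℂ}
    (hv : AEStronglyMeasurable v volume) :
    eLpNorm (ρ ⋆[lsmul ℝ ℝ, volume] v) 2 volume ≤ eLpNorm v 2 volume := by
  have hρ : ∫⁻ x, ‖ρ x‖ₑ = 1 := by
    rw [← ofReal_integral_norm_eq_lintegral_enorm (hc.integrable_of_hasCompactSupport hs)]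
    simp [abs_of_nonneg (h0 _), h1]
  -- Cauchy–Schwarz against this probability measure bounds the square of the convolution by the
  -- convolution of the square; Tonelli and translation invariance then finish.
  set m : Measure E3 := volume.withDensity (fun x => ‖ρ x‖ₑ) with hm
  have hmeas : Measurable (fun x => ‖ρ x‖ₑ) := hc.measurable.enorm
  have hm1 : m univ = 1 := by simp [hm, hρ]
  have hac : ∀ p : E3, AEMeasurable (fun t => ‖v (p - t)‖ₑ) volume := fun p =>
    (hv.comp_quasiMeasurePreserving
      (quasiMeasurePreserving_sub_left_of_right_invariant volume p)).enorm
  have hpt : ∀ p, ‖(ρ ⋆[lsmul ℝ ℝ, volume] v) p‖ₑ ^ 2 ≤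
      ∫⁻ t, ‖ρ t‖ₑ * ‖v (p - t)‖ₑ ^ 2 := by
    intro p
    have hmp : AEMeasurable (fun t => ‖v (p - t)‖ₑ) m :=
      (hac p).mono_ac (withDensity_absolutelyContinuous _ _)
    calc ‖(ρ ⋆[lsmul ℝ ℝ, volume] v) p‖ₑ ^ 2
        ≤ (∫⁻ t, ‖ρ t • v (p - t)‖ₑ) ^ 2 := by
          gcongr
          exact enorm_integral_le_lintegral_enorm _
      _ = (∫⁻ t, ‖v (p - t)‖ₑ ∂m) ^ 2 := by
          rw [hm, lintegral_withDensity_eq_lintegral_mul₀ hmeas.aemeasurable (hac p)]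
          refine congrArg (· ^ 2) (lintegral_congr fun t => ?_)
          rw [enorm_smul]; rfl
      _ ≤ m univ * ∫⁻ t, ‖v (p - t)‖ₑ ^ 2 ∂m := sq_lintegral_le m hmp
      _ = _ := by
          rw [hm1, one_mul, hm, lintegral_withDensity_eq_lintegral_mul₀ hmeas.aemeasurable
            ((hac p).pow_const 2)]
          simp
  have hsq : eLpNorm (ρ ⋆[lsmul ℝ ℝ, volume] v) 2 volume ^ 2 ≤ eLpNorm v 2 volume ^ 2 := by
    rw [eLpNorm_two_sq, eLpNorm_two_sq]
    calc _ ≤ ∫⁻ p, ∫⁻ t, ‖ρ t‖ₑ * ‖v (p - t)‖ₑ ^ 2 := lintegral_mono hpt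
      _ = ∫⁻ t, ∫⁻ p, ‖ρ t‖ₑ * ‖v (p - t)‖ₑ ^ 2 := by
          refine lintegral_lintegral_swap ?_
          refine AEMeasurable.mul (hmeas.comp measurable_snd).aemeasurable ?_
          refine AEMeasurable.pow_const ?_ 2
          exact (hv.comp_quasiMeasurePreserving
            (quasiMeasurePreserving_sub volume volume)).enorm
      _ = ∫⁻ t, ‖ρ t‖ₑ * ∫⁻ p, ‖v p‖ₑ ^ 2 := by
          refine lintegral_congr fun t => ?_
          rw [lintegral_const_mul' _ _ (by simp)]
          congr 1
          exact lintegral_sub_right_eq_self (fun p => ‖v p‖ₑ ^ 2) t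
      _ = _ := by rw [lintegral_mul_const _ hmeas, hρ, one_mul]
  exact (ENNReal.pow_le_pow_left_iff (by norm_num)).1 hsq

theorem map_scal {a : Fin 3 → ℝ} (ha : ∀ i, 0 < a i) :
    Measure.map (scal a) (volume : Measure E3) = ENNReal.ofReal ((∏ i, a i)⁻¹) • volume := by
  have hd : LinearMap.det (scal a : E3 →ₗ[ℝ] E3) ≠ 0 := by
    rw [det_scal]; exact (Finset.prod_pos fun i _ => ha i).ne'
  have h := Measure.map_linearMap_addHaar_eq_smul_addHaar (volume : Measure E3) hd
  rw [det_scal, abs_of_pos (inv_pos.2 (Finset.prod_pos fun i _ => ha i))] at h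
  exact h

theorem scal_inv_scal {a : Fin 3 → ℝ} (ha : ∀ i, 0 < a i) (p : E3) : scal a⁻¹ (scal a p) = p := by
  ext i; simp [(ha i).ne']

theorem scal_scal_inv {a : Fin 3 → ℝ} (ha : ∀ i, 0 < a i) (p : E3) : scal a (scal a⁻¹ p) = p := by
  ext i; simp [(ha i).ne']

theorem measurableEmbedding_scal {a : Fin 3 → ℝ} (ha : ∀ i, 0 < a i) :
    MeasurableEmbedding (scal a) :=
  MeasurableEmbedding.of_measurable_inverse (scal a).continuous.measurable
    (by
      have : range (scal a) = univ :=
        range_eq_univ.2 fun p => ⟨scal a⁻¹ p, scal_scal_inv ha p⟩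
      rw [this]; exact MeasurableSet.univ)
    (scal a⁻¹).continuous.measurable (scal_inv_scal ha)

theorem quasiMeasurePreserving_scal {a : Fin 3 → ℝ} (ha : ∀ i, 0 < a i) :
    Measure.QuasiMeasurePreserving (scal a) (volume : Measure E3) volume :=
  ⟨(scal a).continuous.measurable, by
    rw [map_scal ha]; exact Measure.smul_absolutelyContinuous⟩

theorem integral_comp_scal {a : Fin 3 → ℝ} (ha : ∀ i, 0 < a i) (f : E3 → ℂ) :
    ∫ p, f (scal a p) = (∏ i, a i)⁻¹ • ∫ p, f p := by
  rw [← (measurableEmbedding_scal ha).integral_map, map_scal ha, integral_smul_measure,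
    ENNReal.toReal_ofReal (inv_nonneg.2 (Finset.prod_nonneg fun i _ => (ha i).le))]

theorem lintegral_comp_scal {a : Fin 3 → ℝ} (ha : ∀ i, 0 < a i) (f : E3 → ℝ≥0∞) :
    ∫⁻ p, f (scal a p) = ENNReal.ofReal ((∏ i, a i)⁻¹) * ∫⁻ p, f p := by
  rw [← (measurableEmbedding_scal ha).lintegral_map, map_scal ha, lintegral_smul_measure,
    smul_eq_mul]

theorem eLpNorm_comp_scal_le {a : Fin 3 → ℝ} (ha : ∀ i, 1 / 2 ≤ a i) (f : E3 → ℂ) :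
    eLpNorm (fun p => f (scal a p)) 2 volume ≤ 3 * eLpNorm f 2 volume := by
  have ha' : ∀ i, 0 < a i := fun i => by linarith [ha i]
  refine (ENNReal.pow_le_pow_left_iff (n := 2) (by norm_num)).1 ?_
  rw [mul_pow, eLpNorm_two_sq, eLpNorm_two_sq, lintegral_comp_scal ha' (fun p => ‖f p‖ₑ ^ 2)]
  gcongr
  -- The inverse Jacobian is at most 8, rounded up to 9 so that its square root is 3.
  have h8 : (1 / 8 : ℝ) ≤ ∏ i, a i := by
    calc (1 / 8 : ℝ) = ∏ _i : Fin 3, (1 / 2 : ℝ) := by norm_num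
      _ ≤ _ := Finset.prod_le_prod (fun _ _ => by norm_num) (fun i _ => ha i)
  have : (∏ i, a i)⁻¹ ≤ 9 := by
    rw [inv_le_comm₀ (by linarith) (by norm_num)]; linarith
  calc ENNReal.ofReal ((∏ i, a i)⁻¹) ≤ ENNReal.ofReal 9 := ENNReal.ofReal_le_ofReal this
    _ = 3 ^ 2 := by norm_num

theorem norm_scal_le (t : Fin 3 → ℝ) (p : E3) : ‖scal t p‖ ≤ (∑ i, |t i|) * ‖p‖ := by
  rw [Finset.sum_mul]
  have : scal t p = ∑ i, (t i * p i) • EuclideanSpace.single i (1 : ℝ) := by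
    simp [scal, mul_smul]
  rw [this]
  refine (norm_sum_le _ _).trans (Finset.sum_le_sum fun i _ => ?_)
  rw [norm_smul, norm_mul]
  simp only [PiLp.norm_single, norm_one, mul_one, Real.norm_eq_abs]
  gcongr
  exact PiLp.norm_apply_le p i

variable (φ : ContDiffBump (0 : E3))

theorem eLpNorm_mollify_comp_scal_le {a : Fin 3 → ℝ} (ha : ∀ i, 1 / 2 ≤ a i) {f : E3 → ℂ}
    (hf : AEStronglyMeasurable f volume) :
    eLpNorm (φ.normed volume ⋆[lsmul ℝ ℝ, volume] fun p => f (scal a p)) 2 volume ≤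
      3 * eLpNorm f 2 volume :=
  (eLpNorm_convolution_le φ.nonneg_normed φ.continuous_normed φ.hasCompactSupport_normed
    φ.integral_normed (hf.comp_quasiMeasurePreserving
      (quasiMeasurePreserving_scal fun i => by linarith [ha i]))).trans (eLpNorm_comp_scal_le ha f)

theorem memLp_comp_scal {a : Fin 3 → ℝ} (ha : ∀ i, 1 / 2 ≤ a i) {f : E3 → ℂ}
    (hf : MemLp f 2 volume) : MemLp (fun p => f (scal a p)) 2 volume :=
  ⟨hf.1.comp_quasiMeasurePreserving
      (quasiMeasurePreserving_scal fun i => by linarith [ha i]),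
    (eLpNorm_comp_scal_le ha f).trans_lt (ENNReal.mul_lt_top (by norm_num) hf.2)⟩

theorem convolutionExists_mollify {f : E3 → ℂ} (hf : MemLp f 2 volume) :
    ConvolutionExists (φ.normed volume) f (lsmul ℝ ℝ) volume :=
  φ.hasCompactSupport_normed.convolutionExists_left _ φ.continuous_normed
    (hf.locallyIntegrable (by norm_num))

/-- The operators are bounded on L² by 3, uniformly in `n`, so it suffices to treat a continuous
compactly supported `h` close to `g`. For such `h` convergence is uniform on the bounded set, by
uniform continuity. The error splits as 3·ε/8 + ε/2 + ε/8 = ε. -/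
theorem tendsto_mollify_comp_scal {Ω : Set E3} (hΩ : Bornology.IsBounded Ω) {g : E3 → ℂ}
    (hΩm : MeasurableSet Ω)
    (hg : MemLp g 2 volume) {a : ℕ → Fin 3 → ℝ} (ha : ∀ n i, 1 / 2 ≤ a n i)
    (ha1 : ∀ i, Tendsto (fun n => a n i) atTop (𝓝 1)) {φ : ℕ → ContDiffBump (0 : E3)}
    (hφ : Tendsto (fun n => (φ n).rOut) atTop (𝓝 0)) :
    Tendsto (fun n => eLpNorm (((φ n).normed volume ⋆[lsmul ℝ ℝ, volume]
      fun p => g (scal (a n) p)) - g) 2 (volume.restrict Ω)) atTop (𝓝 0) := by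
  rw [ENNReal.tendsto_nhds_zero]
  intro ε hε
  have hε' : ε / 8 ≠ 0 := by simp [hε.ne']
  obtain ⟨h, hhs, hgh, hhc, hhL⟩ := hg.exists_hasCompactSupport_eLpNorm_sub_le (by norm_num) hε'
  obtain ⟨R, hR⟩ := hΩ.exists_norm_le
  -- uniform closeness on the bounded set
  have hvol : volume Ω ≠ ∞ := hΩ.measure_lt_top.ne
  obtain ⟨η, hη0, hη⟩ : ∃ η : ℝ, 0 < η ∧ (volume Ω) ^ (1 / (2 : ℝ)) * ENNReal.ofReal η ≤ ε / 2 := by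
    have ht : Tendsto (fun η : ℝ => (volume Ω) ^ (1 / (2 : ℝ)) * ENNReal.ofReal η) (𝓝[>] 0)
        (𝓝 ((volume Ω) ^ (1 / (2 : ℝ)) * ENNReal.ofReal 0)) :=
      ENNReal.Tendsto.const_mul ((ENNReal.continuous_ofReal.tendsto 0).mono_left
        nhdsWithin_le_nhds) (Or.inr (ENNReal.rpow_ne_top_of_nonneg (by norm_num) hvol))
    rw [ENNReal.ofReal_zero, mul_zero] at ht
    have h1 := (ENNReal.tendsto_nhds_zero.1 ht) (ε / 2) (by simp [hε.ne'])
    obtain ⟨η, h2, h3⟩ := (h1.and self_mem_nhdsWithin).exists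
    exact ⟨η, h3, h2⟩
  obtain ⟨τ, hτ0, hτ⟩ := Metric.uniformContinuous_iff.1
    (hhc.uniformContinuous_of_tendsto_cocompact hhs.is_zero_at_infty) η hη0
  -- This bounds the distance from `scal (a n) q` to `p` when `p` lies in Ω and `q` lies within the
  -- mollification radius of `p`; the extra 1 allows for a radius below 1.
  have hsum : Tendsto (fun n => (∑ i, |(a n - 1) i|) * (|R| + 1) + (φ n).rOut) atTop
      (𝓝 ((∑ _i : Fin 3, 0) * (|R| + 1) + 0)) := by
    refine Tendsto.add (Tendsto.mul_const _ (tendsto_finsetSum _ fun i _ => ?_)) hφ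
    simpa using ((ha1 i).sub_const 1).abs
  have hev1 := hsum.eventually (gt_mem_nhds (show _ < τ by simpa using hτ0))
  have hev2 := hφ.eventually (gt_mem_nhds one_pos)
  filter_upwards [hev1, hev2] with n hn1 hn2
  have hTh : ∀ p ∈ Ω, dist (((φ n).normed volume ⋆[lsmul ℝ ℝ, volume]
      fun p => h (scal (a n) p)) p) (h p) ≤ η := by
    intro p hp
    have hd := dist_convolution_le (f := (φ n).normed volume) (μ := volume)
      (g := fun p => h (scal (a n) p)) (x₀ := p) (z₀ := h p) (ε := η) (R := (φ n).rOut) hη0.le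
      (φ n).support_normed_eq.subset (φ n).nonneg_normed (φ n).integral_normed
      (hhc.comp (scal (a n)).continuous).aestronglyMeasurable
    refine hd ?_
    intro q hq
    refine (hτ ?_).le
    rw [dist_eq_norm]
    have hqp : ‖q - p‖ < (φ n).rOut := by simpa [dist_eq_norm] using hq
    have e : scal (a n) q - p = scal (a n - 1) q + (q - p) := by
      ext i; simp; ring
    have hq2 : ‖q‖ ≤ |R| + 1 := by
      calc ‖q‖ = ‖p + (q - p)‖ := by simp
        _ ≤ ‖p‖ + ‖q - p‖ := norm_add_le _ _
        _ ≤ |R| + 1 := by linarith [hR p hp, le_abs_self R]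
    calc ‖scal (a n) q - p‖ ≤ ‖scal (a n - 1) q‖ + ‖q - p‖ := by rw [e]; exact norm_add_le _ _
      _ ≤ (∑ i, |(a n - 1) i|) * ‖q‖ + ‖q - p‖ := by gcongr; exact norm_scal_le _ _
      _ ≤ (∑ i, |(a n - 1) i|) * (|R| + 1) + (φ n).rOut := by gcongr
      _ < τ := hn1
  have hgL := memLp_comp_scal (ha n) hg
  have hhL' := memLp_comp_scal (ha n) hhL
  have hghL : MemLp (fun p => (g - h) (scal (a n) p)) 2 volume := hgL.sub hhL'
  have hdec : ((φ n).normed volume ⋆[lsmul ℝ ℝ, volume] fun p => g (scal (a n) p)) - g =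
      (((φ n).normed volume ⋆[lsmul ℝ ℝ, volume] fun p => (g - h) (scal (a n) p)) +
      (((φ n).normed volume ⋆[lsmul ℝ ℝ, volume] fun p => h (scal (a n) p)) - h)) - (g - h) := by
    have e : (fun p => g (scal (a n) p)) =
        (fun p => (g - h) (scal (a n) p)) + fun p => h (scal (a n) p) := by
      funext p; simp
    conv_lhs => rw [e]
    rw [(convolutionExists_mollify (φ n) hghL).distrib_add
      (convolutionExists_mollify (φ n) hhL')]
    abel
  have hcont : ∀ f : E3 → ℂ, MemLp f 2 volume →
      Continuous ((φ n).normed volume ⋆[lsmul ℝ ℝ, volume] f) := fun f hf =>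
    (φ n).hasCompactSupport_normed.continuous_convolution_left _ (φ n).continuous_normed
      (hf.locallyIntegrable (by norm_num))
  have hghm : AEStronglyMeasurable (g - h) volume := (hg.sub hhL).1
  have b1 : eLpNorm ((φ n).normed volume ⋆[lsmul ℝ ℝ, volume] fun p => (g - h) (scal (a n) p)) 2
      (volume.restrict Ω) ≤ 3 * (ε / 8) :=
    (eLpNorm_mono_measure _ Measure.restrict_le_self).trans
      ((eLpNorm_mollify_comp_scal_le (φ n) (ha n) hghm).trans (by gcongr))
  have b2 : eLpNorm (((φ n).normed volume ⋆[lsmul ℝ ℝ, volume] fun p => h (scal (a n) p)) - h) 2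
      (volume.restrict Ω) ≤ ε / 2 := by
    refine le_trans ?_ hη
    have := eLpNorm_le_of_ae_bound (p := 2) (μ := volume.restrict Ω) (C := η)
      (f := ((φ n).normed volume ⋆[lsmul ℝ ℝ, volume] fun p => h (scal (a n) p)) - h) ?_
    · simpa using this
    · rw [ae_restrict_iff' hΩm]
      exact Eventually.of_forall fun p hp => by simpa [dist_eq_norm] using hTh p hp
  have b3 : eLpNorm (g - h) 2 (volume.restrict Ω) ≤ ε / 8 :=
    (eLpNorm_mono_measure _ Measure.restrict_le_self).trans hgh
  have m1 := (hcont _ hghL).aestronglyMeasurable (μ := volume.restrict Ω)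
  have m2 := ((hcont _ hhL').sub hhc).aestronglyMeasurable (μ := volume.restrict Ω)
  rw [hdec]
  calc _ ≤ (eLpNorm _ 2 (volume.restrict Ω) + eLpNorm _ 2 (volume.restrict Ω)) +
        eLpNorm (g - h) 2 (volume.restrict Ω) :=
        (eLpNorm_sub_le (m1.add m2) hghm.restrict (by norm_num)).trans
          (by gcongr; exact eLpNorm_add_le m1 m2 (by norm_num))
    _ ≤ (3 * (ε / 8) + ε / 2) + ε / 8 := by gcongr
    _ = (ε / 8 + ε / 8 + ε / 8 + ε / 8) + ε / 2 := by ring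
    _ = ε := by
      have h8 : ε / 8 + ε / 8 + ε / 8 + ε / 8 = ε / 2 := by
        have e : (8 : ℝ≥0∞) = 2 * 4 := by norm_num
        have : ε / 8 = ε / 2 / 4 := by
          rw [e, ENNReal.div_eq_inv_mul, ENNReal.mul_inv (by simp) (by simp)]
          simp only [div_eq_mul_inv]; ring
        rw [this]
        have h4 : ∀ x : ℝ≥0∞, x / 4 + x / 4 + x / 4 + x / 4 = x := by
          intro x
          calc x / 4 + x / 4 + x / 4 + x / 4 = 4 * (x / 4) := by ring
            _ = x := ENNReal.mul_div_cancel (by norm_num) (by norm_num)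
        exact h4 _
      rw [h8, ENNReal.add_halves]

end Mollification

end QuasiReversibility
end

noncomputable section
namespace QuasiReversibility
open scoped ENNReal Convolution
open ContinuousLinearMap (lsmul)

/-! ### Smooth approximation on a box, direction by direction -/

section Density

/-- `∫ (∂^β φ) u = (-1)^{|β|} ∫ φ g` for all test functions `φ` supported in `A`. -/
def HasWD (A : Set E3) (β : Fin 3 → ℕ) (u g : E3 → ℂ) : Prop :=
  ∀ φ : E3 → ℝ, ContDiff ℝ (⊤ : ℕ∞) φ → HasCompactSupport φ → tsupport φ ⊆ A →
    ∫ p, mderiv β φ p • u p = (-1 : ℝ) ^ (∑ i, β i) • ∫ p, φ p • g p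

theorem HasWD.mono {A B : Set E3} (h : A ⊆ B) {β : Fin 3 → ℕ} {u g : E3 → ℂ}
    (hu : HasWD B β u g) : HasWD A β u g :=
  fun φ h1 h2 h3 => hu φ h1 h2 (h3.trans h)

/-- The points whose coordinates with index in `J` lie in the sides of the box. -/
def slab (l r : Fin 3 → ℝ) (J : Set (Fin 3)) : Set E3 := {p | ∀ j ∈ J, l j < p j ∧ p j < r j}

/-- The open box `∏ᵢ (lᵢ, rᵢ)`. -/
def box (l r : Fin 3 → ℝ) : Set E3 := {p | ∀ j, l j < p j ∧ p j < r j}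

theorem isOpen_slab (l r : Fin 3 → ℝ) (J : Set (Fin 3)) : IsOpen (slab l r J) := by
  have : slab l r J = ⋂ j ∈ J, {p : E3 | l j < p j ∧ p j < r j} := by
    ext p; simp [slab]
  rw [this]
  refine (toFinite J).isOpen_biInter fun j _ => ?_
  have h : IsOpen ({p : E3 | l j < p j} ∩ {p : E3 | p j < r j}) :=
    (isOpen_lt (by fun_prop) (by fun_prop)).inter (isOpen_lt (by fun_prop) (by fun_prop))
  exact h

theorem slab_univ (l r : Fin 3 → ℝ) : slab l r univ = box l r := by ext p; simp [slab, box]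

theorem isOpen_box (l r : Fin 3 → ℝ) : IsOpen (box l r) := slab_univ l r ▸ isOpen_slab l r univ

theorem isBounded_box (l r : Fin 3 → ℝ) : Bornology.IsBounded (box l r) := by
  refine isBounded_iff_forall_norm_le.2 ⟨∑ i, (|l i| + |r i|), fun p hp => ?_⟩
  have : p = ∑ i, p i • EuclideanSpace.single i (1 : ℝ) := by
    ext j; fin_cases j <;> simp [Fin.sum_univ_three]
  rw [this]
  refine (norm_sum_le _ _).trans (Finset.sum_le_sum fun i _ => ?_)
  rw [norm_smul, PiLp.norm_single, norm_one, mul_one, Real.norm_eq_abs, abs_le]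
  have := hp i
  constructor <;>
    linarith [neg_abs_le (l i), le_abs_self (r i), abs_nonneg (l i), abs_nonneg (r i)]

theorem partialD_convolution (i : Fin 3) {ρ : E3 → ℝ} (hρ : ContDiff ℝ (⊤ : ℕ∞) ρ)
    (hs : HasCompactSupport ρ) {v : E3 → ℂ} (hv : LocallyIntegrable v volume) :
    partialD i (ρ ⋆[lsmul ℝ ℝ, volume] v) = partialD i ρ ⋆[lsmul ℝ ℝ, volume] v := by
  funext p
  have h := hs.hasFDerivAt_convolution_left (lsmul ℝ ℝ) (hρ.of_le (by exact_mod_cast le_top)) hv p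
  rw [partialD, h.fderiv]
  have hex : ConvolutionExistsAt (fderiv ℝ ρ) v p ((lsmul ℝ ℝ).precompL E3) volume :=
    (hs.fderiv ℝ).convolutionExists_left _ (hρ.continuous_fderiv (by simp)) hv p
  rw [convolution_def, convolution_def, ContinuousLinearMap.integral_apply hex]
  rfl

theorem mderiv_convolution (β : Fin 3 → ℕ) {ρ : E3 → ℝ} (hρ : ContDiff ℝ (⊤ : ℕ∞) ρ)
    (hs : HasCompactSupport ρ) {v : E3 → ℂ} (hv : LocallyIntegrable v volume) :
    mderiv β (ρ ⋆[lsmul ℝ ℝ, volume] v) = mderiv β ρ ⋆[lsmul ℝ ℝ, volume] v := by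
  have key : ∀ (i : Fin 3) (n : ℕ) (σ : E3 → ℝ), ContDiff ℝ (⊤ : ℕ∞) σ → HasCompactSupport σ →
      (partialD i)^[n] (σ ⋆[lsmul ℝ ℝ, volume] v) =
        ((partialD i)^[n] σ) ⋆[lsmul ℝ ℝ, volume] v := by
    intro i n
    induction n with
    | zero => intro σ _ _; rfl
    | succ n ih =>
      intro σ h1 h2
      rw [Function.iterate_succ_apply, Function.iterate_succ_apply, partialD_convolution i h1 h2 hv,
        ih _ (contDiff_partialD i h1) (h2.fderiv_apply ℝ _)]
  have h2 := contDiff_iterate_partialD 2 (β 2) hρ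
  have c2 := hasCompactSupport_partialD_iterate 2 (β 2) hs
  have h1 := contDiff_iterate_partialD 1 (β 1) h2
  have c1 := hasCompactSupport_partialD_iterate 1 (β 1) c2
  rw [mderiv, mderiv, key 2 _ _ hρ hs, key 1 _ _ h2 c2, key 0 _ _ h1 c1]

/-- Derivatives may be placed on the kernel. After substituting through the dilation, the kernel `q
↦ ρ (p - a⁻¹ q)` is itself a test function, and `hp` says exactly that its support lies where the
weak derivative is known. -/
theorem mderiv_mollify_comp_scal {A : Set E3} {β : Fin 3 → ℕ} {u g : E3 → ℂ}
    (hug : HasWD A β u g) (hu : MemLp u 2 volume) {ρ : E3 → ℝ} (hρ : ContDiff ℝ (⊤ : ℕ∞) ρ)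
    (hs : HasCompactSupport ρ) {a : Fin 3 → ℝ} (ha : ∀ i, 1 / 2 ≤ a i) (p : E3)
    (hp : ∀ q, p - q ∈ tsupport ρ → scal a q ∈ A) :
    mderiv β (ρ ⋆[lsmul ℝ ℝ, volume] fun q => u (scal a q)) p =
      (∏ i, a i ^ β i) • (ρ ⋆[lsmul ℝ ℝ, volume] fun q => g (scal a q)) p := by
  have ha' : ∀ i, 0 < a i := fun i => by linarith [ha i]
  rw [mderiv_convolution β hρ hs ((memLp_comp_scal ha hu).locallyIntegrable (by norm_num))]
  rw [convolution_eq_swap, convolution_eq_swap]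
  simp only [ContinuousLinearMap.lsmul_apply]
  set φ : E3 → ℝ := fun q => ρ (p + scal (-a⁻¹) q) with hφ
  have hneg : ∀ q, scal (-a⁻¹) q = - scal a⁻¹ q := fun q => by ext i; simp
  have hφq : ∀ q, φ (scal a q) = ρ (p - q) := by
    intro q
    simp only [hφ, hneg, scal_inv_scal ha', sub_eq_add_neg]
  have hφs : ContDiff ℝ (⊤ : ℕ∞) φ := hρ.comp (contDiff_const.add (scal _).contDiff)
  have hts : ∀ q ∈ tsupport φ, p - scal a⁻¹ q ∈ tsupport ρ := by
    have hcl : IsClosed {q | p - scal a⁻¹ q ∈ tsupport ρ} :=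
      (isClosed_tsupport ρ).preimage (continuous_const.sub (scal a⁻¹).continuous)
    refine closure_minimal ?_ hcl
    intro q hq
    refine subset_tsupport _ ?_
    simpa [hφ, hneg, sub_eq_add_neg] using hq
  have hφc : HasCompactSupport φ := by
    have hK : IsCompact ((fun q => scal a (p - q)) '' tsupport ρ) :=
      hs.isCompact.image ((scal a).continuous.comp (continuous_const.sub continuous_id))
    refine hK.of_isClosed_subset (isClosed_tsupport _) fun q hq => ?_
    exact ⟨_, hts q hq, by simp [scal_scal_inv ha']⟩
  have hφA : tsupport φ ⊆ A := fun q hq => by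
    have := hp _ (hts q hq)
    rwa [scal_scal_inv ha'] at this
  have hw := hug φ hφs hφc hφA
  have hd : ∀ q, mderiv β φ (scal a q) =
      (∏ i, (-a⁻¹) i ^ β i) • mderiv β ρ (p - q) := by
    intro q
    rw [hφ, mderiv_comp_affine p (-a⁻¹) β hρ]
    simp only [hneg, scal_inv_scal ha', sub_eq_add_neg]
  have hI1 := integral_comp_scal ha' (fun q => mderiv β φ q • u q)
  have hI2 := integral_comp_scal ha' (fun q => φ q • g q)
  simp only [hd, hφq, smul_assoc] at hI1 hI2
  rw [integral_smul, hw] at hI1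
  -- The sign from reflecting the kernel cancels the sign in the definition of weak derivative; only
  -- the dilation factor survives.
  have hpr : (∏ i, (-a⁻¹) i ^ β i) * (∏ i, a i ^ β i) = (-1) ^ (∑ i, β i) := by
    rw [← Finset.prod_mul_distrib, ← Finset.prod_pow_eq_pow_sum]
    refine Finset.prod_congr rfl fun i _ => ?_
    rw [← mul_pow]
    congr 1
    simp [(ha' i).ne']
  have hsq : ((-1 : ℝ) ^ (∑ i, β i)) * (-1) ^ (∑ i, β i) = 1 := by
    rw [← mul_pow]; simp
  have hI3 : ((-1 : ℝ) ^ (∑ i, β i)) • ((∏ i, a i ^ β i) •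
      ((∏ i, (-a⁻¹) i ^ β i) • ∫ q, mderiv β ρ (p - q) • u (scal a q))) =
      ((-1 : ℝ) ^ (∑ i, β i)) • ((∏ i, a i ^ β i) •
        ((-1 : ℝ) ^ (∑ i, β i) • ∫ q, ρ (p - q) • g (scal a q))) := by
    rw [hI1, hI2, smul_comm ((∏ i, a i)⁻¹)]
  rw [smul_smul (∏ i, a i ^ β i), mul_comm (∏ i, a i ^ β i), hpr, smul_smul, hsq, one_smul,
    smul_comm (∏ i, a i ^ β i), smul_smul, hsq, one_smul] at hI3
  exact hI3

/-- Smooth approximation, in `L²` of the box and together with derivatives, of a function supported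
in the box; the approximations keep a distance from those sides through which the weak
derivatives extend by zero. -/
theorem exists_smooth_approx {l r : Fin 3 → ℝ} (hl : ∀ i, l i < 0) (hr : ∀ i, 0 < r i)
    (J : Set (Fin 3)) {u : E3 → ℂ} {g : (Fin 3 → ℕ) → E3 → ℂ} {B : Set (Fin 3 → ℕ)}
    (hu : MemLp u 2 volume) (husupp : ∀ p, p ∉ box l r → u p = 0)
    (hg : ∀ β ∈ B, MemLp (g β) 2 volume) (hB : ∀ β ∈ B, HasWD (slab l r J) β u (g β)) :
    ∃ w : ℕ → E3 → ℂ, (∀ n, ContDiff ℝ (⊤ : ℕ∞) (w n)) ∧ (∀ n, HasCompactSupport (w n)) ∧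
      (∀ n, tsupport (w n) ⊆ slab l r Jᶜ) ∧
      ∀ β ∈ B, Tendsto (fun n => eLpNorm (mderiv β (w n) - g β) 2 (volume.restrict (box l r)))
        atTop (𝓝 0) := by
  classical
  -- The least distance from the origin to a side: a dilation about the origin by a factor `1 + t`
  -- moves every side by at least `κ t`.
  obtain ⟨κ, hκ0, hκl, hκr⟩ : ∃ κ : ℝ, 0 < κ ∧ (∀ i, l i ≤ -κ) ∧ ∀ i, κ ≤ r i := by
    refine ⟨min (min (-l 0) (min (-l 1) (-l 2))) (min (r 0) (min (r 1) (r 2))), ?_, ?_, ?_⟩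
    · simp [hl, hr]
    · intro i
      rw [le_neg]
      fin_cases i <;> simp
    · intro i
      fin_cases i <;> simp
  set t : ℕ → ℝ := fun n => 1 / ((n : ℝ) + 2) with ht
  have ht0 : ∀ n, 0 < t n := fun n => by positivity
  have ht1 : ∀ n, t n ≤ 1 / 2 := fun n => by
    simp only [ht]
    exact one_div_le_one_div_of_le (by norm_num) (by linarith [(Nat.cast_nonneg n : (0 : ℝ) ≤ n)])
  have htl : Tendsto t atTop (𝓝 0) := by
    have := (tendsto_const_div_atTop_nhds_zero_nat (1 : ℝ)).comp (tendsto_add_atTop_nat 2)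
    refine this.congr fun n => ?_
    simp [ht]
  -- For `i ∈ J` the function is stretched beyond the sides, so mollifying at points of the box uses
  -- only values inside. For `i ∉ J` it is squeezed away from the sides, which is harmless because
  -- its weak derivatives extend across them by zero.
  set a : ℕ → Fin 3 → ℝ := fun n i => if i ∈ J then 1 / (1 + t n) else 1 + t n with ha_def
  have ha : ∀ n i, 1 / 2 ≤ a n i := by
    intro n i
    have := ht0 n
    have := ht1 n
    simp only [ha_def]
    split_ifs
    · exact one_div_le_one_div_of_le (by linarith) (by linarith)
    · linarith
  have ha1 : ∀ i, Tendsto (fun n => a n i) atTop (𝓝 1) := by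
    intro i
    simp only [ha_def]
    have h1 : Tendsto (fun n => 1 + t n) atTop (𝓝 1) := by simpa using htl.const_add 1
    split_ifs
    · simpa using h1.inv₀ one_ne_zero
    · exact h1
  -- The radius `κ t / 4` is below the gap left by either dilation, which is at least `κ t / 2`
  -- since `t ≤ 1/2`.
  set φ : ℕ → ContDiffBump (0 : E3) := fun n =>
    ⟨κ * t n / 8, κ * t n / 4, by have := mul_pos hκ0 (ht0 n); positivity,
      by have := mul_pos hκ0 (ht0 n); linarith⟩ with hφ_def
  have hφ : Tendsto (fun n => (φ n).rOut) atTop (𝓝 0) := by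
    have := (htl.const_mul κ).div_const 4
    simpa [hφ_def] using this
  have hcomp : ∀ (p q : E3) (i : Fin 3) (R : ℝ), p - q ∈ Metric.closedBall (0 : E3) R →
      p i - q i ≤ R ∧ q i - p i ≤ R := by
    intro p q i R h
    have h1 := PiLp.norm_apply_le (p - q) i
    have h2 : ‖p - q‖ ≤ R := by simpa using h
    rw [Real.norm_eq_abs] at h1
    have h3 := abs_le.1 (h1.trans h2)
    simp only [PiLp.sub_apply] at h3
    constructor <;> linarith
  have hρs : ∀ n, ContDiff ℝ (⊤ : ℕ∞) ((φ n).normed volume) := fun n => (φ n).contDiff_normed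
  have hρc : ∀ n, HasCompactSupport ((φ n).normed volume) := fun n => (φ n).hasCompactSupport_normed
  have hv : ∀ n, MemLp (fun q => u (scal (a n) q)) 2 volume := fun n => memLp_comp_scal (ha n) hu
  have hsupp : ∀ n p, p ∈ tsupport ((φ n).normed volume ⋆[lsmul ℝ ℝ, volume]
      fun q => u (scal (a n) q)) → ∀ i,
      l i / a n i - κ * t n / 4 ≤ p i ∧ p i ≤ r i / a n i + κ * t n / 4 := by
    intro n
    have hcl : IsClosed {p : E3 | ∀ i, l i / a n i - κ * t n / 4 ≤ p i ∧
        p i ≤ r i / a n i + κ * t n / 4} := by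
      simp only [ofPred_forall]
      refine isClosed_iInter fun i => ?_
      have h : IsClosed ({p : E3 | l i / a n i - κ * t n / 4 ≤ p i} ∩
          {p : E3 | p i ≤ r i / a n i + κ * t n / 4}) :=
        (isClosed_le (by fun_prop) (by fun_prop)).inter
          (isClosed_le (by fun_prop) (by fun_prop))
      exact h
    refine closure_minimal ?_ hcl
    intro p hp i
    have hp' := support_convolution_subset (lsmul ℝ ℝ) hp
    obtain ⟨x, hx, q, hq, rfl⟩ := hp'
    have hx' : x + q - q ∈ Metric.closedBall (0 : E3) (κ * t n / 4) := by
      rw [(φ n).support_normed_eq] at hx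
      simpa [hφ_def] using (Metric.ball_subset_closedBall hx)
    have hq' : scal (a n) q ∈ box l r := by
      by_contra hcon
      exact hq (husupp _ hcon)
    have h1 := hcomp _ _ i _ hx'
    have h2 := hq' i
    rw [scal_apply] at h2
    have h3 : 0 < a n i := by linarith [ha n i]
    have h4 : l i / a n i ≤ q i := by rw [div_le_iff₀ h3]; linarith
    have h5 : q i ≤ r i / a n i := by rw [le_div_iff₀ h3]; linarith
    constructor <;> linarith
  have hinner : ∀ n, ∀ i ∉ J, r i / a n i + κ * t n / 4 < r i ∧
      l i < l i / a n i - κ * t n / 4 := by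
    intro n i hi
    have e : a n i = 1 + t n := by simp [ha_def, hi]
    have h0 := ht0 n
    have h1 := ht1 n
    have key : ∀ x, κ ≤ x → x / (1 + t n) + κ * t n / 4 < x := by
      intro x hx
      have : x / (1 + t n) ≤ x - x * t n / 2 := by
        rw [div_le_iff₀ (by linarith)]
        have hx0 : 0 ≤ x := hκ0.le.trans hx
        nlinarith [mul_nonneg hx0 h0.le, mul_nonneg (mul_nonneg hx0 h0.le) (sub_nonneg.2 h1)]
      nlinarith [mul_le_mul_of_nonneg_right hx h0.le, mul_pos hκ0 h0]
    rw [e]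
    refine ⟨key _ (hκr i), ?_⟩
    have := key (-l i) (by linarith [hκl i])
    rw [neg_div] at this
    linarith
  refine ⟨fun n => (φ n).normed volume ⋆[lsmul ℝ ℝ, volume] fun q => u (scal (a n) q),
    fun n => ?_, fun n => ?_, fun n p hp i hi => ?_, fun β hβ => ?_⟩
  · exact (hρc n).contDiff_convolution_left _ (hρs n)
      ((hv n).locallyIntegrable (by norm_num))
  · have hbd : Bornology.IsBounded (tsupport ((φ n).normed volume ⋆[lsmul ℝ ℝ, volume]
        fun q => u (scal (a n) q))) := by
      refine (isBounded_box (fun i => l i / a n i - κ * t n / 4 - 1)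
        (fun i => r i / a n i + κ * t n / 4 + 1)).subset fun p hp i => ?_
      have := hsupp n p hp i
      constructor <;> simp only <;> linarith
    exact Metric.isCompact_of_isClosed_isBounded (isClosed_tsupport _) hbd
  · have h1 := hsupp n p hp i
    have h2 := hinner n i hi
    constructor <;> linarith
  · have hcoef : Tendsto (fun n => ∏ i, a n i ^ β i) atTop (𝓝 1) := by
      have := tendsto_finsetProd (Finset.univ : Finset (Fin 3))
        (fun i _ => (ha1 i).pow (β i))
      simpa using this
    have hmain := tendsto_mollify_comp_scal (isBounded_box l r) (isOpen_box l r).measurableSet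
      (hg β hβ) ha ha1 hφ
    have hbound : ∀ n, eLpNorm (mderiv β ((φ n).normed volume ⋆[lsmul ℝ ℝ, volume]
        fun q => u (scal (a n) q)) - g β) 2 (volume.restrict (box l r)) ≤
        ‖∏ i, a n i ^ β i‖ₑ * eLpNorm (((φ n).normed volume ⋆[lsmul ℝ ℝ, volume]
          fun p => g β (scal (a n) p)) - g β) 2 (volume.restrict (box l r)) +
        ‖(∏ i, a n i ^ β i) - 1‖ₑ * eLpNorm (g β) 2 (volume.restrict (box l r)) := by
      intro n
      have hae : mderiv β ((φ n).normed volume ⋆[lsmul ℝ ℝ, volume]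
          fun q => u (scal (a n) q)) - g β =ᵐ[volume.restrict (box l r)]
          (∏ i, a n i ^ β i) • (((φ n).normed volume ⋆[lsmul ℝ ℝ, volume]
          fun p => g β (scal (a n) p)) - g β) + ((∏ i, a n i ^ β i) - 1) • g β := by
        rw [EventuallyEq, ae_restrict_iff' (isOpen_box l r).measurableSet]
        refine Eventually.of_forall fun p hp => ?_
        have := mderiv_mollify_comp_scal (hB β hβ) hu (hρs n) (hρc n) (ha n) p ?_
        · simp only [Pi.sub_apply, Pi.add_apply, Pi.smul_apply, this, sub_smul, one_smul, smul_sub]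
          abel
        · intro q hq j hj
          have hq' : p - q ∈ Metric.closedBall (0 : E3) (κ * t n / 4) := by
            rw [(φ n).tsupport_normed_eq] at hq
            exact hq
          have h1 := hcomp _ _ j _ hq'
          have h2 := hp j
          have e : a n j = 1 / (1 + t n) := by simp [ha_def, hj]
          have h0 := ht0 n
          rw [scal_apply, e, one_div, inv_mul_eq_div, lt_div_iff₀ (by linarith),
            div_lt_iff₀ (by linarith)]
          have h3 := mul_le_mul_of_nonneg_right (hκr j) h0.le
          have h4 := mul_le_mul_of_nonneg_right (hκl j) h0.le
          have h5 := mul_pos hκ0 h0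
          constructor <;> nlinarith
      rw [eLpNorm_congr_ae hae]
      have hm := memLp_comp_scal (ha n) (hg β hβ)
      have hc : Continuous ((φ n).normed volume ⋆[lsmul ℝ ℝ, volume]
          fun p => g β (scal (a n) p)) :=
        (hρc n).continuous_convolution_left _ (φ n).continuous_normed
          (hm.locallyIntegrable (by norm_num))
      refine (eLpNorm_add_le ((hc.aestronglyMeasurable.sub (hg β hβ).1.restrict).const_smul _)
        ((hg β hβ).1.restrict.const_smul _) (by norm_num)).trans ?_
      rw [eLpNorm_const_smul, eLpNorm_const_smul]
    have hgfin : eLpNorm (g β) 2 (volume.restrict (box l r)) ≠ ∞ := ((hg β hβ).restrict _).2.ne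
    have hlim : Tendsto (fun n => ‖∏ i, a n i ^ β i‖ₑ *
        eLpNorm (((φ n).normed volume ⋆[lsmul ℝ ℝ, volume]
          fun p => g β (scal (a n) p)) - g β) 2 (volume.restrict (box l r)) +
        ‖(∏ i, a n i ^ β i) - 1‖ₑ * eLpNorm (g β) 2 (volume.restrict (box l r))) atTop
        (𝓝 (‖(1 : ℝ)‖ₑ * 0 + ‖(1 : ℝ) - 1‖ₑ * eLpNorm (g β) 2 (volume.restrict (box l r)))) := by
      refine Tendsto.add (ENNReal.Tendsto.mul hcoef.enorm (Or.inl (by simp)) hmain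
        (Or.inr (by simp))) (ENNReal.Tendsto.mul_const (hcoef.sub_const 1).enorm (Or.inr hgfin))
    simp only [mul_zero, sub_self, enorm_zero, zero_mul, add_zero] at hlim
    exact tendsto_of_tendsto_of_tendsto_of_le_of_le tendsto_const_nhds hlim
      (fun _ => zero_le) hbound

end Density

end QuasiReversibility
end

noncomputable section
namespace QuasiReversibility
open scoped ENNReal Convolution
open ContinuousLinearMap (lsmul)

/-! ### The Sobolev inequality on a bounded convex open set -/

section SobolevInequality

theorem lintegral_enorm_le_eLpNorm_two {α F : Type*} [MeasurableSpace α] [NormedAddCommGroup F]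
    {μ : Measure α} {f : α → F} (hf : AEStronglyMeasurable f μ) :
    ∫⁻ x, ‖f x‖ₑ ∂μ ≤ (μ univ + 1) * eLpNorm f 2 μ := by
  refine (ENNReal.pow_le_pow_left_iff (n := 2) (by norm_num)).1 ?_
  refine (sq_lintegral_le μ hf.enorm).trans ?_
  rw [mul_pow, eLpNorm_two_sq]
  gcongr
  calc μ univ ≤ (μ univ + 1) * 1 := by rw [mul_one]; exact le_self_add
    _ ≤ (μ univ + 1) * (μ univ + 1) := by gcongr; exact le_add_self
    _ = _ := (sq _).symm

/-- The expansion is based at the far end `x + v`, so the remainder carries a factor `τ` that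
vanishes at `x`. It is obtained by integrating the derivative of `τ φ'(τ) - φ(τ)` along the segment.
-/
theorem taylor_two_segment {w : E3 → ℂ} (hw : ContDiff ℝ (⊤ : ℕ∞) w) (x v : E3) :
    w x = w (x + v) - fderiv ℝ w (x + v) v +
      ∫ τ in (0 : ℝ)..1, τ • fderiv ℝ (fderiv ℝ w) (x + τ • v) v v := by
  have hw1 : ContDiff ℝ (⊤ : ℕ∞) (fderiv ℝ w) :=
    hw.fderiv_right (m := ((⊤ : ℕ∞) : WithTop ℕ∞)) (by simp)
  have hline : ∀ τ : ℝ, HasDerivAt (fun τ : ℝ => x + τ • v) v τ := fun τ => by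
    simpa using ((hasDerivAt_id τ).smul_const v).const_add x
  have h1 : ∀ τ : ℝ, HasDerivAt (fun τ : ℝ => w (x + τ • v)) (fderiv ℝ w (x + τ • v) v) τ :=
    fun τ => (hw.differentiable (by simp) _).hasFDerivAt.comp_hasDerivAt τ (hline τ)
  have h2 : ∀ τ : ℝ, HasDerivAt (fun τ : ℝ => fderiv ℝ w (x + τ • v) v)
      (fderiv ℝ (fderiv ℝ w) (x + τ • v) v v) τ := fun τ => by
    have := ((hw1.differentiable (by simp) (x + τ • v)).hasFDerivAt.comp_hasDerivAt τ (hline τ))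
    simpa using this.clm_apply (hasDerivAt_const τ v)
  have h3 : ∀ τ : ℝ, HasDerivAt (fun τ : ℝ => τ • fderiv ℝ w (x + τ • v) v - w (x + τ • v))
      (τ • fderiv ℝ (fderiv ℝ w) (x + τ • v) v v) τ := fun τ => by
    have := ((hasDerivAt_id τ).smul (h2 τ)).sub (h1 τ)
    refine this.congr_deriv ?_
    simp only [id, one_smul]
    ring
  have hc : Continuous fun τ : ℝ => τ • fderiv ℝ (fderiv ℝ w) (x + τ • v) v v := by
    have h4 : Continuous (fderiv ℝ (fderiv ℝ w)) := hw1.continuous_fderiv (by simp)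
    have h5 : Continuous fun τ : ℝ => fderiv ℝ (fderiv ℝ w) (x + τ • v) :=
      h4.comp (by fun_prop)
    exact continuous_id.smul ((h5.clm_apply continuous_const).clm_apply continuous_const)
  rw [intervalIntegral.integral_eq_sub_of_hasDerivAt (fun τ _ => h3 τ)
    (hc.intervalIntegrable 0 1)]
  simp only [one_smul, zero_smul, add_zero]
  ring

/-- By convexity the homothety centred at `x` maps Ω into itself; its Jacobian in dimension three is
`τ ^ 3`. -/
theorem setLIntegral_comp_homothety_le {Ω : Set E3} (hm : MeasurableSet Ω) (hc : Convex ℝ Ω)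
    {x : E3} (hx : x ∈ Ω) {τ : ℝ} (h0 : 0 < τ) (h1 : τ ≤ 1) (f : E3 → ℝ≥0∞) :
    ∫⁻ y in Ω, f (x + τ • (y - x)) ≤ ENNReal.ofReal ((τ ^ 3)⁻¹) * ∫⁻ y in Ω, f y := by
  rw [← lintegral_indicator hm, ← lintegral_indicator hm]
  calc ∫⁻ y, Ω.indicator (fun y => f (x + τ • (y - x))) y
      ≤ ∫⁻ y, Ω.indicator f (x + τ • (y - x)) := by
        refine lintegral_mono fun y => ?_
        by_cases hy : y ∈ Ω
        · have : x + τ • (y - x) ∈ Ω := hc.add_smul_sub_mem hx hy ⟨h0.le, h1⟩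
          simp [hy, this]
        · simp [hy]
    _ = ∫⁻ z, Ω.indicator f (x + τ • z) :=
        lintegral_sub_right_eq_self (fun z => Ω.indicator f (x + τ • z)) x
    _ = ∫⁻ z, Ω.indicator f (x + scal (fun _ => τ) z) := by
        refine lintegral_congr fun z => ?_
        congr 2
        ext i; simp
    _ = ENNReal.ofReal ((τ ^ 3)⁻¹) * ∫⁻ z, Ω.indicator f (x + z) := by
        rw [lintegral_comp_scal (fun _ => h0) (fun z => Ω.indicator f (x + z))]
        simp
    _ = _ := by rw [lintegral_add_left_eq_self]

/-- The Taylor formula is averaged over its base point `y ∈ Ω`. Contracting toward `x` costs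
`τ^(-3/2)` in L², the remainder supplies `τ`, and `τ^(-1/2)` is integrable on (0, 1]. This balance
is why two derivatives suffice in dimension three. -/
theorem exists_enorm_le_eLpNorm_fderiv {Ω : Set E3} (ho : IsOpen Ω) (hc : Convex ℝ Ω)
    (hb : Bornology.IsBounded Ω) (hne : Ω.Nonempty) :
    ∃ C : ℝ≥0∞, C ≠ ∞ ∧ ∀ w : E3 → ℂ, ContDiff ℝ (⊤ : ℕ∞) w → ∀ x ∈ closure Ω,
      ‖w x‖ₑ ≤ C * (eLpNorm w 2 (volume.restrict Ω) +
        eLpNorm (fderiv ℝ w) 2 (volume.restrict Ω) +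
        eLpNorm (fderiv ℝ (fderiv ℝ w)) 2 (volume.restrict Ω)) := by
  have hm := ho.measurableSet
  set V := volume Ω with hV
  have hV0 : V ≠ 0 := (ho.measure_pos volume hne).ne'
  have hVt : V ≠ ∞ := hb.measure_lt_top.ne
  obtain ⟨R, hR⟩ := hb.exists_norm_le
  set D : ℝ≥0∞ := ENNReal.ofReal (R + R) with hD
  have hDxy : ∀ x ∈ Ω, ∀ y ∈ Ω, ‖y - x‖ₑ ≤ D := by
    intro x hx y hy
    rw [← ofReal_norm]
    exact ENNReal.ofReal_le_ofReal ((norm_sub_le _ _).trans (add_le_add (hR y hy) (hR x hx)))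
  set K : ℝ≥0∞ := ∫⁻ τ in Ioc (0 : ℝ) 1, ENNReal.ofReal (τ ^ (-(1 / 2) : ℝ)) with hK
  have hKt : K ≠ ∞ := by
    have h : IntervalIntegrable (fun τ : ℝ => τ ^ (-(1 / 2) : ℝ)) volume 0 1 :=
      intervalIntegral.intervalIntegrable_rpow' (by norm_num)
    have h2 := (intervalIntegrable_iff_integrableOn_Ioc_of_le zero_le_one).1 h
    refine ne_of_lt (lt_of_le_of_lt ?_ h2.2)
    refine setLIntegral_mono' measurableSet_Ioc fun τ hτ => ?_
    rw [← ofReal_norm]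
    exact ENNReal.ofReal_le_ofReal (le_abs_self _)
  refine ⟨V⁻¹ * ((V + 1) * (1 + D + D ^ 2 * K)), ?_, fun w hw => ?_⟩
  · refine ENNReal.mul_ne_top (ENNReal.inv_ne_top.2 hV0) (ENNReal.mul_ne_top (by simp [hVt]) ?_)
    refine ENNReal.add_ne_top.2 ⟨by simp [hD], ENNReal.mul_ne_top (by simp [hD]) hKt⟩
  have hw1 : ContDiff ℝ (⊤ : ℕ∞) (fderiv ℝ w) :=
    hw.fderiv_right (m := ((⊤ : ℕ∞) : WithTop ℕ∞)) (by simp)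
  have c1 : Continuous (fderiv ℝ w) := hw1.continuous
  have c2 : Continuous (fderiv ℝ (fderiv ℝ w)) := hw1.continuous_fderiv (by simp)
  set N0 := eLpNorm w 2 (volume.restrict Ω)
  set N1 := eLpNorm (fderiv ℝ w) 2 (volume.restrict Ω)
  set N2 := eLpNorm (fderiv ℝ (fderiv ℝ w)) 2 (volume.restrict Ω)
  suffices hmain : ∀ x ∈ Ω, ‖w x‖ₑ ≤
      V⁻¹ * ((V + 1) * (1 + D + D ^ 2 * K)) * (N0 + N1 + N2) by
    have hcl : IsClosed {x | ‖w x‖ₑ ≤ V⁻¹ * ((V + 1) * (1 + D + D ^ 2 * K)) * (N0 + N1 + N2)} :=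
      isClosed_le hw.continuous.enorm continuous_const
    exact fun x hx => closure_minimal hmain hcl hx
  intro x hx
  have hpt : ∀ y ∈ Ω, ‖w x‖ₑ ≤ ‖w y‖ₑ + D * ‖fderiv ℝ w y‖ₑ + D ^ 2 *
      ∫⁻ τ in Ioc (0 : ℝ) 1, ENNReal.ofReal τ * ‖fderiv ℝ (fderiv ℝ w) (x + τ • (y - x))‖ₑ := by
    intro y hy
    have hT := taylor_two_segment hw x (y - x)
    rw [add_sub_cancel, intervalIntegral.integral_of_le zero_le_one] at hT
    have hd := hDxy x hx y hy
    calc ‖w x‖ₑ ≤ ‖w y - fderiv ℝ w y (y - x)‖ₑ + ‖∫ τ in Ioc (0 : ℝ) 1,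
          τ • fderiv ℝ (fderiv ℝ w) (x + τ • (y - x)) (y - x) (y - x)‖ₑ := by
          conv_lhs => rw [hT]
          exact enorm_add_le _ _
      _ ≤ (‖w y‖ₑ + ‖fderiv ℝ w y (y - x)‖ₑ) + ∫⁻ τ in Ioc (0 : ℝ) 1,
          ‖τ • fderiv ℝ (fderiv ℝ w) (x + τ • (y - x)) (y - x) (y - x)‖ₑ := by
          gcongr
          · exact enorm_sub_le
          · exact enorm_integral_le_lintegral_enorm _
      _ ≤ (‖w y‖ₑ + D * ‖fderiv ℝ w y‖ₑ) + ∫⁻ τ in Ioc (0 : ℝ) 1,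
          D ^ 2 * (ENNReal.ofReal τ * ‖fderiv ℝ (fderiv ℝ w) (x + τ • (y - x))‖ₑ) := by
          gcongr (_ + ?_) + ?_
          · calc _ ≤ ‖fderiv ℝ w y‖ₑ * ‖y - x‖ₑ := ContinuousLinearMap.le_opENorm _ _
              _ ≤ _ := by rw [mul_comm]; gcongr
          · refine setLIntegral_mono' measurableSet_Ioc fun τ hτ => ?_
            rw [enorm_smul, Real.enorm_of_nonneg hτ.1.le]
            calc _ ≤ ENNReal.ofReal τ * (‖fderiv ℝ (fderiv ℝ w) (x + τ • (y - x))‖ₑ * ‖y - x‖ₑ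
                  * ‖y - x‖ₑ) := by
                  gcongr
                  refine (ContinuousLinearMap.le_opENorm _ _).trans ?_
                  gcongr
                  exact ContinuousLinearMap.le_opENorm _ _
              _ ≤ ENNReal.ofReal τ * (‖fderiv ℝ (fderiv ℝ w) (x + τ • (y - x))‖ₑ * D * D) := by
                  gcongr
              _ = _ := by ring
      _ = _ := by rw [lintegral_const_mul' _ _ (by simp [hD])]
  have hcHess : Continuous fun q : E3 × ℝ => fderiv ℝ (fderiv ℝ w) (x + q.2 • (q.1 - x)) :=
    c2.comp (by fun_prop)
  have hcHess' : Measurable fun q : E3 × ℝ =>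
      ‖fderiv ℝ (fderiv ℝ w) (x + q.2 • (q.1 - x))‖ₑ := by
    simp only [← ofReal_norm]
    exact ENNReal.measurable_ofReal.comp hcHess.norm.measurable
  have hN2 : ∀ τ ∈ Ioc (0 : ℝ) 1,
      ENNReal.ofReal τ * ∫⁻ y in Ω, ‖fderiv ℝ (fderiv ℝ w) (x + τ • (y - x))‖ₑ ≤
      ENNReal.ofReal (τ ^ (-(1 / 2) : ℝ)) * ((V + 1) * N2) := by
    intro τ hτ
    have hcy : Continuous fun y : E3 => fderiv ℝ (fderiv ℝ w) (x + τ • (y - x)) :=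
      c2.comp (by fun_prop)
    have hmy : AEStronglyMeasurable (fun y : E3 => fderiv ℝ (fderiv ℝ w) (x + τ • (y - x)))
        (volume.restrict Ω) := hcy.aestronglyMeasurable
    have h1 := lintegral_enorm_le_eLpNorm_two (F := E3 →L[ℝ] E3 →L[ℝ] ℂ) hmy
    rw [Measure.restrict_apply_univ] at h1
    have h2 : eLpNorm (fun y : E3 => fderiv ℝ (fderiv ℝ w) (x + τ • (y - x))) 2
        (volume.restrict Ω) ≤ ENNReal.ofReal (τ ^ (-(3 / 2) : ℝ)) * N2 := by
      refine (ENNReal.pow_le_pow_left_iff (n := 2) (by norm_num)).1 ?_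
      rw [mul_pow, eLpNorm_two_sq (F := E3 →L[ℝ] E3 →L[ℝ] ℂ),
        eLpNorm_two_sq (F := E3 →L[ℝ] E3 →L[ℝ] ℂ)]
      refine (setLIntegral_comp_homothety_le hm hc hx hτ.1 hτ.2
        (fun y => ‖fderiv ℝ (fderiv ℝ w) y‖ₑ ^ 2)).trans (le_of_eq ?_)
      rw [← ENNReal.ofReal_pow (by have := hτ.1; positivity)]
      congr 2
      rw [← Real.rpow_natCast, ← Real.rpow_natCast, ← Real.rpow_mul hτ.1.le,
        ← Real.rpow_neg hτ.1.le]
      norm_num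
    calc _ ≤ ENNReal.ofReal τ * ((V + 1) * (ENNReal.ofReal (τ ^ (-(3 / 2) : ℝ)) * N2)) := by
          gcongr
          exact h1.trans (by gcongr)
      _ = (ENNReal.ofReal τ * ENNReal.ofReal (τ ^ (-(3 / 2) : ℝ))) * ((V + 1) * N2) := by ring
      _ = _ := by
          rw [← ENNReal.ofReal_mul hτ.1.le]
          congr 2
          conv_lhs => rw [← Real.rpow_one τ, ← Real.rpow_mul hτ.1.le, ← Real.rpow_add hτ.1]
          norm_num
  have hint : V * ‖w x‖ₑ ≤ (V + 1) * (1 + D + D ^ 2 * K) * (N0 + N1 + N2) := by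
    have b0 := lintegral_enorm_le_eLpNorm_two (μ := volume.restrict Ω)
      hw.continuous.aestronglyMeasurable
    have b1 := lintegral_enorm_le_eLpNorm_two (μ := volume.restrict Ω) c1.aestronglyMeasurable
    rw [Measure.restrict_apply_univ] at b0 b1
    calc V * ‖w x‖ₑ = ∫⁻ y in Ω, ‖w x‖ₑ := by rw [setLIntegral_const, mul_comm]
      _ ≤ ∫⁻ y in Ω, (‖w y‖ₑ + D * ‖fderiv ℝ w y‖ₑ + D ^ 2 * ∫⁻ τ in Ioc (0 : ℝ) 1,
          ENNReal.ofReal τ * ‖fderiv ℝ (fderiv ℝ w) (x + τ • (y - x))‖ₑ) :=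
          setLIntegral_mono' hm hpt
      _ = (∫⁻ y in Ω, ‖w y‖ₑ) + D * (∫⁻ y in Ω, ‖fderiv ℝ w y‖ₑ) + D ^ 2 *
          ∫⁻ y in Ω, ∫⁻ τ in Ioc (0 : ℝ) 1,
          ENNReal.ofReal τ * ‖fderiv ℝ (fderiv ℝ w) (x + τ • (y - x))‖ₑ := by
          rw [lintegral_add_left (f := fun y => ‖w y‖ₑ + D * ‖fderiv ℝ w y‖ₑ)
            (hw.continuous.measurable.enorm.add (c1.measurable.enorm.const_mul D)),
            lintegral_add_left hw.continuous.measurable.enorm,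
            lintegral_const_mul' _ _ (by simp [hD]), lintegral_const_mul' _ _ (by simp [hD])]
      _ = (∫⁻ y in Ω, ‖w y‖ₑ) + D * (∫⁻ y in Ω, ‖fderiv ℝ w y‖ₑ) + D ^ 2 *
          ∫⁻ τ in Ioc (0 : ℝ) 1, ENNReal.ofReal τ *
            ∫⁻ y in Ω, ‖fderiv ℝ (fderiv ℝ w) (x + τ • (y - x))‖ₑ := by
          rw [lintegral_lintegral_swap]
          · simp_rw [lintegral_const_mul' _ _ ENNReal.ofReal_ne_top]
          · exact ((ENNReal.measurable_ofReal.comp measurable_snd).mul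
              hcHess').aemeasurable
      _ ≤ (V + 1) * N0 + D * ((V + 1) * N1) + D ^ 2 * ∫⁻ τ in Ioc (0 : ℝ) 1,
          ENNReal.ofReal (τ ^ (-(1 / 2) : ℝ)) * ((V + 1) * N2) := by
          gcongr ?_ + D * ?_ + D ^ 2 * ?_
          exact setLIntegral_mono' measurableSet_Ioc hN2
      _ = (V + 1) * (1 * N0 + D * N1 + D ^ 2 * K * N2) := by
          rw [lintegral_mul_const _ (by fun_prop)]
          ring
      _ ≤ (V + 1) * ((1 + D + D ^ 2 * K) * N0 + (1 + D + D ^ 2 * K) * N1 +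
          (1 + D + D ^ 2 * K) * N2) := by
          gcongr
          · rw [add_assoc]; exact le_self_add
          · rw [add_comm 1 D, add_assoc]; exact le_self_add
          · exact le_add_self
      _ = _ := by ring
  calc ‖w x‖ₑ = V⁻¹ * (V * ‖w x‖ₑ) := by
        rw [← mul_assoc, ENNReal.inv_mul_cancel hV0 hVt, one_mul]
    _ ≤ V⁻¹ * ((V + 1) * (1 + D + D ^ 2 * K) * (N0 + N1 + N2)) := by gcongr
    _ = _ := by ring

theorem enorm_clm_le_sum {F : Type*} [NormedAddCommGroup F] [NormedSpace ℝ F] (T : E3 →L[ℝ] F) :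
    ‖T‖ₑ ≤ ∑ i, ‖T (EuclideanSpace.single i 1)‖ₑ := by
  have h : ‖T‖ ≤ ∑ i, ‖T (EuclideanSpace.single i 1)‖ := by
    refine T.opNorm_le_bound (Finset.sum_nonneg fun _ _ => norm_nonneg _) fun p => ?_
    have e : p = ∑ i, p i • EuclideanSpace.single i (1 : ℝ) := by
      ext j; fin_cases j <;> simp [Fin.sum_univ_three]
    conv_lhs => rw [e, map_sum]
    rw [Finset.sum_mul]
    refine (norm_sum_le _ _).trans (Finset.sum_le_sum fun i _ => ?_)
    rw [map_smul, norm_smul, mul_comm]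
    gcongr
    exact PiLp.norm_apply_le p i
  simp only [← ofReal_norm]
  rw [← ENNReal.ofReal_sum_of_nonneg fun _ _ => norm_nonneg _]
  exact ENNReal.ofReal_le_ofReal h

theorem eLpNorm_fderiv_le {F : Type*} [NormedAddCommGroup F] [NormedSpace ℝ F] {w : E3 → F}
    (hw : ContDiff ℝ (⊤ : ℕ∞) w) (μ : Measure E3) :
    eLpNorm (fderiv ℝ w) 2 μ ≤ ∑ i, eLpNorm (partialD i w) 2 μ := by
  have h1 : eLpNorm (fderiv ℝ w) 2 μ ≤ eLpNorm (∑ i, fun p => ‖partialD i w p‖) 2 μ := by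
    refine eLpNorm_mono_enorm fun p => (enorm_clm_le_sum _).trans (le_of_eq ?_)
    rw [Finset.sum_apply, ← ofReal_norm, Real.norm_of_nonneg
      (Finset.sum_nonneg fun _ _ => norm_nonneg _),
      ENNReal.ofReal_sum_of_nonneg fun _ _ => norm_nonneg _]
    simp [partialD]
  refine h1.trans ((eLpNorm_sum_le (fun i _ => ?_) (by norm_num)).trans (le_of_eq ?_))
  · exact (contDiff_partialD i hw).continuous.norm.aestronglyMeasurable
  · exact Finset.sum_congr rfl fun i _ => eLpNorm_norm _

theorem partialD_fderiv {w : E3 → ℂ} (hw : ContDiff ℝ (⊤ : ℕ∞) w) (i : Fin 3) :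
    partialD i (fderiv ℝ w) = fderiv ℝ (partialD i w) := by
  have hw1 : ContDiff ℝ (⊤ : ℕ∞) (fderiv ℝ w) :=
    hw.fderiv_right (m := ((⊤ : ℕ∞) : WithTop ℕ∞)) (by simp)
  funext p
  ext v
  have h := ((hw1.differentiable (by simp) p).hasFDerivAt.clm_apply
    (hasFDerivAt_const (EuclideanSpace.single i (1 : ℝ)) p)).fderiv
  change _ = fderiv ℝ (fun q => fderiv ℝ w q (EuclideanSpace.single i 1)) p v
  rw [h]
  have hs := hw.contDiffAt (x := p) |>.isSymmSndFDerivAt (by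
    simpa using (WithTop.coe_le_coe.2 le_top : ((2 : ℕ∞) : WithTop ℕ∞) ≤ ((⊤ : ℕ∞) : WithTop ℕ∞)))
  simpa [partialD] using hs _ _

/-- The Sobolev inequality `‖w‖_∞ ≤ C ∑_{|β| ≤ 2} ‖∂^β w‖₂` on a bounded convex open set. -/
theorem exists_enorm_le_eLpNorm_mderiv {Ω : Set E3} (ho : IsOpen Ω) (hc : Convex ℝ Ω)
    (hb : Bornology.IsBounded Ω) (hne : Ω.Nonempty) :
    ∃ C : ℝ≥0∞, C ≠ ∞ ∧ ∀ w : E3 → ℂ, ContDiff ℝ (⊤ : ℕ∞) w → ∀ x ∈ closure Ω,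
      ‖w x‖ₑ ≤ C * ∑ β ∈ multiIndices 2, eLpNorm (mderiv β w) 2 (volume.restrict Ω) := by
  obtain ⟨C, hC, h⟩ := exists_enorm_le_eLpNorm_fderiv ho hc hb hne
  -- 13 = 1 + 3 + 9 counts the components of the function, its gradient and its Hessian.
  refine ⟨C * 13, ENNReal.mul_ne_top hC (by norm_num), fun w hw x hx => (h w hw x hx).trans ?_⟩
  rw [mul_assoc]
  gcongr
  set S := ∑ β ∈ multiIndices 2, eLpNorm (mderiv β w) 2 (volume.restrict Ω)
  have hmem : ∀ β : Fin 3 → ℕ, ∑ i, β i ≤ 2 → eLpNorm (mderiv β w) 2 (volume.restrict Ω) ≤ S := by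
    intro β hβ
    refine Finset.single_le_sum (f := fun β => eLpNorm (mderiv β w) 2 (volume.restrict Ω))
      (fun _ _ => zero_le) ?_
    simp only [multiIndices, Finset.mem_filter, Fintype.mem_piFinset, Finset.mem_range]
    refine ⟨fun i => ?_, hβ⟩
    have := Finset.single_le_sum (f := β) (fun _ _ => Nat.zero_le _) (Finset.mem_univ i)
    omega
  have h0 : eLpNorm w 2 (volume.restrict Ω) ≤ S := hmem 0 (by simp)
  have h1 : eLpNorm (fderiv ℝ w) 2 (volume.restrict Ω) ≤ 3 * S := by
    refine (eLpNorm_fderiv_le hw _).trans ?_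
    calc _ ≤ ∑ _i : Fin 3, S := by
          refine Finset.sum_le_sum fun i _ => ?_
          rw [← mderiv_single i hw]
          exact hmem _ (by simp)
      _ = _ := by simp
  have h2 : eLpNorm (fderiv ℝ (fderiv ℝ w)) 2 (volume.restrict Ω) ≤ 9 * S := by
    have hw1 : ContDiff ℝ (⊤ : ℕ∞) (fderiv ℝ w) :=
      hw.fderiv_right (m := ((⊤ : ℕ∞) : WithTop ℕ∞)) (by simp)
    refine (eLpNorm_fderiv_le hw1 _).trans ?_
    calc _ ≤ ∑ _i : Fin 3, ∑ _j : Fin 3, S := by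
          refine Finset.sum_le_sum fun i _ => ?_
          rw [partialD_fderiv hw]
          refine (eLpNorm_fderiv_le (contDiff_partialD i hw) _).trans ?_
          refine Finset.sum_le_sum fun j _ => ?_
          rw [← mderiv_single i hw, partialD_mderiv j _ hw]
          exact hmem _ (by simp [Finset.sum_add_distrib])
      _ = _ := by simp; ring
  calc _ ≤ S + 3 * S + 9 * S := by gcongr
    _ = 13 * S := by ring

end SobolevInequality

end QuasiReversibility
end

noncomputable section
namespace QuasiReversibility
open scoped ENNReal Convolution
open ContinuousLinearMap (lsmul)

/-! ### Weak derivatives and extension by zero -/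

section WeakDerivatives

variable {Ω : Set E3}

theorem mem_multiIndices {m : ℕ} {β : Fin 3 → ℕ} : β ∈ multiIndices m ↔ ∑ i, β i ≤ m := by
  simp only [multiIndices, Finset.mem_filter, Fintype.mem_piFinset, Finset.mem_range]
  refine ⟨fun h => h.2, fun h => ⟨fun i => ?_, h⟩⟩
  have := Finset.single_le_sum (f := β) (fun _ _ => Nat.zero_le _) (Finset.mem_univ i)
  omega

theorem isWeakDeriv_weakD {m : ℕ} {u : L2 Ω} (hu : u ∈ sobolev Ω m) {β : Fin 3 → ℕ}
    (hβ : ∑ i, β i ≤ m) : IsWeakDeriv Ω β u (weakD β u) := by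
  have h := hu β hβ
  rw [weakD, dif_pos h]
  exact h.choose_spec

theorem weakD_eq (ho : IsOpen Ω) {β : Fin 3 → ℕ} {u g : L2 Ω} (h : IsWeakDeriv Ω β u g) :
    weakD β u = g := by
  have hex : ∃ g, IsWeakDeriv Ω β u g := ⟨g, h⟩
  rw [weakD, dif_pos hex]
  exact IsWeakDeriv.unique ho hex.choose_spec h

theorem isWeakDeriv_zero_index (u : L2 Ω) : IsWeakDeriv Ω 0 u u := by
  intro φ _ _ _
  simp [multiD]

theorem weakD_zero_index (ho : IsOpen Ω) (u : L2 Ω) : weakD 0 u = u :=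
  weakD_eq ho (isWeakDeriv_zero_index u)

theorem weakD_add (ho : IsOpen Ω) {m : ℕ} {u v : L2 Ω} (hu : u ∈ sobolev Ω m)
    (hv : v ∈ sobolev Ω m) {β : Fin 3 → ℕ} (hβ : ∑ i, β i ≤ m) :
    weakD β (u + v) = weakD β u + weakD β v :=
  weakD_eq ho ((isWeakDeriv_weakD hu hβ).add (isWeakDeriv_weakD hv hβ))

theorem weakD_smul (ho : IsOpen Ω) {m : ℕ} {u : L2 Ω} (hu : u ∈ sobolev Ω m) (c : ℂ)
    {β : Fin 3 → ℕ} (hβ : ∑ i, β i ≤ m) : weakD β (c • u) = c • weakD β u :=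
  weakD_eq ho ((isWeakDeriv_weakD hu hβ).smul c)

/-- Two weak derivatives compose: `D^β (D^γ u) = D^{β+γ} u`. -/
theorem IsWeakDeriv.of_add {β γ : Fin 3 → ℕ} {u g h : L2 Ω} (hg : IsWeakDeriv Ω γ u g)
    (hh : IsWeakDeriv Ω (β + γ) u h) : IsWeakDeriv Ω β g h := by
  intro φ h1 h2 h3
  have hts : tsupport (mderiv β φ) ⊆ Ω := (tsupport_mderiv_subset β φ).trans h3
  have e1 := hg (mderiv β φ) (contDiff_mderiv β h1) (hasCompactSupport_mderiv β h2) hts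
  have e2 := hh φ h1 h2 h3
  have e3 : multiD γ (mderiv β φ) = multiD (β + γ) φ := by
    rw [add_comm]; exact mderiv_mderiv γ β h1
  rw [e3, e2] at e1
  have hsq : ((-1 : ℝ) ^ (∑ i, γ i)) * (-1) ^ (∑ i, γ i) = 1 := by
    rw [← mul_pow]; simp
  have e4 := congrArg (fun z : ℂ => ((-1 : ℝ) ^ (∑ i, γ i)) • z) e1
  simp only [smul_smul, hsq, one_smul, Pi.add_apply, Finset.sum_add_distrib, pow_add] at e4
  change ∫ p in Ω, mderiv β φ p • g p = _
  rw [← e4]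
  congr 1
  linear_combination (-1 : ℝ) ^ (∑ i, β i) * hsq

/-- The extension by zero. -/
def zext (u : L2 Ω) : E3 → ℂ := Ω.indicator u

theorem memLp_zext (hm : MeasurableSet Ω) (u : L2 Ω) : MemLp (zext u) 2 volume :=
  (memLp_indicator_iff_restrict hm).2 (Lp.memLp u)

theorem zext_ae (hm : MeasurableSet Ω) (u : L2 Ω) : zext u =ᵐ[volume.restrict Ω] u := by
  rw [EventuallyEq, ae_restrict_iff' hm]
  exact Eventually.of_forall fun p hp => indicator_of_mem hp _

theorem integral_smul_zext (hm : MeasurableSet Ω) (φ : E3 → ℝ) (u : L2 Ω) :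
    ∫ p, φ p • zext u p = ∫ p in Ω, φ p • u p := by
  rw [← integral_indicator hm]
  refine integral_congr_ae (Eventually.of_forall fun p => ?_)
  by_cases hp : p ∈ Ω <;> simp [zext, hp]

theorem IsWeakDeriv.hasWD (hm : MeasurableSet Ω) {β : Fin 3 → ℕ} {u g : L2 Ω}
    (h : IsWeakDeriv Ω β u g) : HasWD Ω β (zext u) (zext g) := by
  intro φ h1 h2 h3
  rw [integral_smul_zext hm, integral_smul_zext hm]
  exact h φ h1 h2 h3

theorem eLpNorm_coe_eq (u : L2 Ω) : eLpNorm u 2 (volume.restrict Ω) = ‖u‖ₑ := by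
  rw [Lp.enorm_def]

theorem norm_weakD_le_sobolevNorm {m : ℕ} {β : Fin 3 → ℕ} (hβ : ∑ i, β i ≤ m) (u : L2 Ω) :
    ‖weakD β u‖ ≤ sobolevNorm m u := by
  refine Real.le_sqrt_of_sq_le ?_
  exact Finset.single_le_sum (f := fun β => ‖weakD β u‖ ^ 2) (fun _ _ => sq_nonneg _)
    (mem_multiIndices.2 hβ)

theorem sobolevNorm_nonneg (m : ℕ) (u : L2 Ω) : 0 ≤ sobolevNorm m u := Real.sqrt_nonneg _

theorem sobolevNorm_sq (m : ℕ) (u : L2 Ω) :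
    sobolevNorm m u ^ 2 = ∑ β ∈ multiIndices m, ‖weakD β u‖ ^ 2 :=
  Real.sq_sqrt (Finset.sum_nonneg fun _ _ => sq_nonneg _)

end WeakDerivatives

/-! ### The embedding of H³ into C¹ up to the boundary -/

section Embedding

theorem mderiv_sub (β : Fin 3 → ℕ) {f g : E3 → ℂ} (hf : ContDiff ℝ (⊤ : ℕ∞) f)
    (hg : ContDiff ℝ (⊤ : ℕ∞) g) : mderiv β (f - g) = mderiv β f - mderiv β g := by
  have hp : ContDiff ℝ (⊤ : ℕ∞) (fun p => (f p, g p)) := hf.prodMk hg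
  have h1 := mderiv_clm_comp (ContinuousLinearMap.fst ℝ ℂ ℂ) β hp
  have h2 := mderiv_clm_comp (ContinuousLinearMap.snd ℝ ℂ ℂ) β hp
  have h3 := mderiv_clm_comp (ContinuousLinearMap.fst ℝ ℂ ℂ - ContinuousLinearMap.snd ℝ ℂ ℂ) β hp
  simp only [ContinuousLinearMap.coe_fst', ContinuousLinearMap.coe_snd',
    sub_apply] at h1 h2 h3
  change mderiv β (fun p => f p - g p) = _
  rw [h3, h1, h2]
  rfl

/-- The Sobolev inequality applied to differences makes the sequence uniformly Cauchy on the
closure. Convergence in measure identifies the limit almost everywhere with `G 0`, and the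
inequality itself passes to the limit. -/
theorem exists_uniform_limit {Ω : Set E3} {C : ℝ≥0∞} (hC : C ≠ ∞)
    (hS : ∀ w : E3 → ℂ, ContDiff ℝ (⊤ : ℕ∞) w → ∀ x ∈ closure Ω,
      ‖w x‖ₑ ≤ C * ∑ β ∈ multiIndices 2, eLpNorm (mderiv β w) 2 (volume.restrict Ω))
    {v : ℕ → E3 → ℂ} (hv : ∀ n, ContDiff ℝ (⊤ : ℕ∞) (v n)) {G : (Fin 3 → ℕ) → E3 → ℂ}
    (hG : ∀ β ∈ multiIndices 2, AEStronglyMeasurable (G β) (volume.restrict Ω))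
    (hlim : ∀ β ∈ multiIndices 2,
      Tendsto (fun n => eLpNorm (mderiv β (v n) - G β) 2 (volume.restrict Ω)) atTop (𝓝 0)) :
    ∃ f : E3 → ℂ, TendstoUniformlyOn v f atTop (closure Ω) ∧ ContinuousOn f (closure Ω) ∧
      f =ᵐ[volume.restrict Ω] G 0 ∧ ∀ x ∈ closure Ω,
        ‖f x‖ₑ ≤ C * ∑ β ∈ multiIndices 2, eLpNorm (G β) 2 (volume.restrict Ω) := by
  set μ := (volume : Measure E3).restrict Ω
  have hmeas : ∀ n β, AEStronglyMeasurable (mderiv β (v n)) μ := fun n β =>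
    (contDiff_mderiv β (hv n)).continuous.aestronglyMeasurable
  set A : ℕ → ℝ≥0∞ := fun n => ∑ β ∈ multiIndices 2, eLpNorm (mderiv β (v n) - G β) 2 μ with hA
  have hA0 : Tendsto (fun n => C * A n) atTop (𝓝 0) := by
    have h1 : Tendsto A atTop (𝓝 (∑ β ∈ multiIndices 2, 0)) := tendsto_finsetSum _ hlim
    simpa using ENNReal.Tendsto.const_mul h1 (Or.inr hC)
  have hdiff : ∀ n k, ∀ x ∈ closure Ω, ‖v n x - v k x‖ₑ ≤ C * A n + C * A k := by
    intro n k x hx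
    refine (hS (v n - v k) ((hv n).sub (hv k)) x hx).trans ?_
    rw [← mul_add, hA, ← Finset.sum_add_distrib]
    gcongr with β hβ
    rw [mderiv_sub β (hv n) (hv k)]
    have e : mderiv β (v n) - mderiv β (v k) =
        (mderiv β (v n) - G β) - (mderiv β (v k) - G β) := by abel
    rw [e]
    exact eLpNorm_sub_le ((hmeas n β).sub (hG β hβ)) ((hmeas k β).sub (hG β hβ)) (by norm_num)
  have hcauchy : UniformCauchySeqOn v atTop (closure Ω) := by
    rw [Metric.uniformCauchySeqOn_iff]
    intro ε hε
    have hε4 : (0 : ℝ≥0∞) < ENNReal.ofReal (ε / 4) := by simpa using by positivity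
    obtain ⟨N, hN⟩ := eventually_atTop.1 ((ENNReal.tendsto_nhds_zero.1 hA0) _ hε4)
    refine ⟨N, fun m hm n hn x hx => ?_⟩
    have h := (hdiff m n x hx).trans (add_le_add (hN m hm) (hN n hn))
    rw [← ENNReal.ofReal_add (by positivity) (by positivity), ← ofReal_norm,
      ENNReal.ofReal_le_ofReal_iff (by positivity)] at h
    rw [dist_eq_norm]
    linarith
  have hpt : ∀ x, ∃ y, x ∈ closure Ω → Tendsto (fun n => v n x) atTop (𝓝 y) := by
    intro x
    by_cases hx : x ∈ closure Ω
    · obtain ⟨y, hy⟩ := cauchySeq_tendsto_of_complete (hcauchy.cauchySeq hx)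
      exact ⟨y, fun _ => hy⟩
    · exact ⟨0, fun h => absurd h hx⟩
  choose f hf using hpt
  have hunif : TendstoUniformlyOn v f atTop (closure Ω) :=
    hcauchy.tendstoUniformlyOn_of_tendsto fun x hx => hf x hx
  refine ⟨f, hunif, hunif.continuousOn (Frequently.of_forall fun n => (hv n).continuous.continuousOn),
    ?_, fun x hx => ?_⟩
  · have hmem : (0 : Fin 3 → ℕ) ∈ multiIndices 2 := mem_multiIndices.2 (by simp)
    have h0 := hlim 0 hmem
    have hm := tendstoInMeasure_of_tendsto_eLpNorm (by norm_num) (fun n => hmeas n 0) (hG 0 hmem) h0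
    obtain ⟨ns, hns, hae⟩ := hm.exists_seq_tendsto_ae
    have hsub : ∀ᵐ x ∂μ, x ∈ closure Ω :=
      (ae_restrict_of_ae_restrict_of_subset subset_closure
        (ae_restrict_mem isClosed_closure.measurableSet))
    filter_upwards [hae, hsub] with x hx hxΩ
    exact tendsto_nhds_unique ((hf x hxΩ).comp hns.tendsto_atTop) hx
  · have h1 : Tendsto (fun n => ‖v n x‖ₑ) atTop (𝓝 ‖f x‖ₑ) := (hf x hx).enorm
    have h2 : ∀ n, ‖v n x‖ₑ ≤ C * A n + C * ∑ β ∈ multiIndices 2, eLpNorm (G β) 2 μ := by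
      intro n
      refine (hS (v n) (hv n) x hx).trans ?_
      rw [← mul_add, hA, ← Finset.sum_add_distrib]
      gcongr with β hβ
      have e : mderiv β (v n) = (mderiv β (v n) - G β) + G β := by abel
      conv_lhs => rw [e]
      exact eLpNorm_add_le ((hmeas n β).sub (hG β hβ)) (hG β hβ) (by norm_num)
    have h3 := hA0.add_const (C * ∑ β ∈ multiIndices 2, eLpNorm (G β) 2 μ)
    rw [zero_add] at h3
    exact le_of_tendsto_of_tendsto' h1 h3 h2

theorem convex_box (l r : Fin 3 → ℝ) : Convex ℝ (box l r) := by
  have h : box l r = ⋂ i, {p : E3 | p i ∈ Ioo (l i) (r i)} := by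
    ext p; simp [box]
  rw [h]
  refine convex_iInter fun i => ?_
  exact (convex_Ioo (l i) (r i)).linear_preimage
    (EuclideanSpace.proj i : E3 →L[ℝ] ℝ).toLinearMap

theorem zero_mem_box {l r : Fin 3 → ℝ} (hl : ∀ i, l i < 0) (hr : ∀ i, 0 < r i) :
    (0 : E3) ∈ box l r := fun i => ⟨by simpa using hl i, by simpa using hr i⟩

variable {Ω : Set E3} {l r : Fin 3 → ℝ}

/-- With `J = univ` the dilation stretches across all sides, so no boundary condition is needed. -/
theorem exists_smooth_approx_sobolev (hΩ : Ω = box l r) (hl : ∀ i, l i < 0) (hr : ∀ i, 0 < r i)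
    {m : ℕ} {u : L2 Ω} (hu : u ∈ sobolev Ω m) :
    ∃ w : ℕ → E3 → ℂ, (∀ n, ContDiff ℝ (⊤ : ℕ∞) (w n)) ∧ ∀ β, ∑ i, β i ≤ m →
      Tendsto (fun n => eLpNorm (mderiv β (w n) - ⇑(weakD β u : L2 Ω)) 2 (volume.restrict Ω))
        atTop (𝓝 0) := by
  subst hΩ
  have hm := (isOpen_box l r).measurableSet
  obtain ⟨w, hw, -, -, hlim⟩ := exists_smooth_approx hl hr univ (u := zext u)
    (g := fun β => zext (weakD β u)) (B := {β | ∑ i, β i ≤ m}) (memLp_zext hm u)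
    (fun p hp => indicator_of_notMem hp _) (fun β _ => memLp_zext hm _)
    (fun β hβ => by rw [slab_univ]; exact (isWeakDeriv_weakD hu hβ).hasWD hm)
  refine ⟨w, hw, fun β hβ => (hlim β hβ).congr fun n => ?_⟩
  refine eLpNorm_congr_ae ?_
  filter_upwards [zext_ae hm (weakD β u)] with p hp
  simp [hp]

/-- The embedding `H³(Ω) ⊆ C¹(closure Ω)` for a box `Ω`. -/
theorem exists_c1_representative (hΩ : Ω = box l r) (hl : ∀ i, l i < 0) (hr : ∀ i, 0 < r i) :
    ∃ C : ℝ, 0 < C ∧ ∀ u ∈ sobolev Ω 3, ∃ (f : E3 → ℂ) (g : Fin 3 → E3 → ℂ),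
      ContinuousOn f (closure Ω) ∧ f =ᵐ[volume.restrict Ω] u ∧
      (∀ p ∈ closure Ω, ‖f p‖ ≤ C * sobolevNorm 3 u) ∧
      (∀ i, ContinuousOn (g i) (closure Ω)) ∧
      (∀ i, g i =ᵐ[volume.restrict Ω] (weakD (Pi.single i 1) u : L2 Ω)) ∧
      (∀ i, ∀ p ∈ closure Ω, ‖g i p‖ ≤ C * sobolevNorm 3 u) ∧
      ContDiffOn ℝ 1 f Ω ∧ ∀ i, ∀ p ∈ Ω, partialD i f p = g i p := by
  have ho : IsOpen Ω := hΩ ▸ isOpen_box l r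
  obtain ⟨C, hC, hS⟩ := exists_enorm_le_eLpNorm_mderiv ho (hΩ ▸ convex_box l r)
    (hΩ ▸ isBounded_box l r) ⟨0, hΩ ▸ zero_mem_box hl hr⟩
  refine ⟨(C * (multiIndices 2).card).toReal + 1, by positivity, fun u hu => ?_⟩
  obtain ⟨w, hw, hlim⟩ := exists_smooth_approx_sobolev hΩ hl hr hu
  -- One derivative plus the two consumed by the Sobolev inequality is the order available in H³.
  have hone : ∀ γ : Fin 3 → ℕ, ∑ i, γ i ≤ 1 → ∃ f : E3 → ℂ,
      TendstoUniformlyOn (fun n => mderiv γ (w n)) f atTop (closure Ω) ∧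
      ContinuousOn f (closure Ω) ∧ f =ᵐ[volume.restrict Ω] (weakD γ u : L2 Ω) ∧
      ∀ x ∈ closure Ω, ‖f x‖ ≤ ((C * (multiIndices 2).card).toReal + 1) * sobolevNorm 3 u := by
    intro γ hγ
    obtain ⟨f, h1, h2, h3, h4⟩ := exists_uniform_limit hC hS
      (v := fun n => mderiv γ (w n)) (fun n => contDiff_mderiv γ (hw n))
      (G := fun β => (weakD (β + γ) u : L2 Ω)) (fun β _ => (Lp.memLp _).1)
      (fun β hβ => by
        have hsum : ∑ i, (β + γ) i ≤ 3 := by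
          have := mem_multiIndices.1 hβ
          simp only [Pi.add_apply, Finset.sum_add_distrib]
          omega
        refine (hlim (β + γ) hsum).congr fun n => ?_
        rw [mderiv_mderiv β γ (hw n)])
    rw [zero_add] at h3
    refine ⟨f, h1, h2, h3, fun x hx => ?_⟩
    have h5 : ‖f x‖ₑ ≤ C * (multiIndices 2).card * ENNReal.ofReal (sobolevNorm 3 u) := by
      refine (h4 x hx).trans ?_
      rw [mul_assoc, ← nsmul_eq_mul]
      gcongr
      refine Finset.sum_le_card_nsmul _ _ _ fun β hβ => ?_
      rw [eLpNorm_coe_eq, ← ofReal_norm]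
      refine ENNReal.ofReal_le_ofReal (norm_weakD_le_sobolevNorm ?_ u)
      have := mem_multiIndices.1 hβ
      simp only [Pi.add_apply, Finset.sum_add_distrib]
      omega
    have hfin : C * (multiIndices 2).card ≠ ∞ := ENNReal.mul_ne_top hC (by simp)
    have h6 := ENNReal.toReal_mono (ENNReal.mul_ne_top hfin ENNReal.ofReal_ne_top) h5
    rw [ENNReal.toReal_mul, ENNReal.toReal_ofReal (sobolevNorm_nonneg 3 u), toReal_enorm] at h6
    linarith [sobolevNorm_nonneg 3 u]
  obtain ⟨f, hfu, hfc, hfae, hfb⟩ := hone 0 (by simp)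
  rw [weakD_zero_index ho] at hfae
  have hone' := fun i : Fin 3 => hone (Pi.single i 1) (by simp)
  choose g hgu hgc hgae hgb using hone'
  -- the candidate for the derivative of the limit
  set T : E3 → E3 →L[ℝ] ℂ := fun p =>
    ∑ i, (EuclideanSpace.proj i : E3 →L[ℝ] ℝ).smulRight (g i p) with hT
  have hTs : ∀ p i, T p (EuclideanSpace.single i 1) = g i p := by
    intro p i
    fin_cases i <;> simp [hT, Fin.sum_univ_three]
  -- Uniform convergence of the derivatives makes `T` the genuine derivative of the limit `f`.
  have hTu : TendstoUniformlyOn (fun n => fderiv ℝ (w n)) T atTop Ω := by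
    rw [Metric.tendstoUniformlyOn_iff]
    intro ε hε
    have hev : ∀ i : Fin 3, ∀ᶠ n in atTop, ∀ x ∈ closure Ω,
        dist (g i x) (mderiv (Pi.single i 1) (w n) x) < ε / 4 := fun i =>
      Metric.tendstoUniformlyOn_iff.1 (hgu i) (ε / 4) (by positivity)
    filter_upwards [eventually_all.2 hev] with n hn x hx
    have h1 := enorm_clm_le_sum (T x - fderiv ℝ (w n) x)
    have h2 : ‖T x - fderiv ℝ (w n) x‖ₑ ≤ ENNReal.ofReal (∑ _i : Fin 3, ε / 4) := by
      refine h1.trans ?_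
      rw [ENNReal.ofReal_sum_of_nonneg fun _ _ => by positivity]
      refine Finset.sum_le_sum fun i _ => ?_
      rw [sub_apply, hTs, ← ofReal_norm]
      refine ENNReal.ofReal_le_ofReal ?_
      have := hn i x (subset_closure hx)
      rw [mderiv_single i (hw n), dist_eq_norm] at this
      exact this.le
    rw [← ofReal_norm, ENNReal.ofReal_le_ofReal_iff (by positivity)] at h2
    rw [dist_eq_norm]
    simp only [Finset.sum_const, Finset.card_univ, Fintype.card_fin, nsmul_eq_mul] at h2
    push_cast at h2
    linarith
  have hderiv : ∀ p ∈ Ω, HasFDerivAt f (T p) p := fun p hp =>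
    hasFDerivAt_of_tendstoUniformlyOn ho hTu
      (fun n x _ => ((hw n).differentiable (by simp) x).hasFDerivAt)
      (fun x hx => hfu.tendsto_at (subset_closure hx)) hp
  have hTc : ContinuousOn T Ω := by
    refine hTu.continuousOn (Frequently.of_forall fun n => ?_)
    exact ((hw n).continuous_fderiv (by simp)).continuousOn
  refine ⟨f, g, hfc, hfae, hfb, hgc, hgae, hgb, ?_, fun i p hp => ?_⟩
  · rw [show (1 : WithTop ℕ∞) = 0 + 1 by simp, contDiffOn_succ_iff_fderiv_of_isOpen ho]
    refine ⟨fun p hp => (hderiv p hp).differentiableAt.differentiableWithinAt, by simp, ?_⟩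
    rw [contDiffOn_zero]
    exact hTc.congr fun p hp => (hderiv p hp).fderiv
  · rw [partialD, (hderiv p hp).fderiv, hTs]

end Embedding

end QuasiReversibility
end

noncomputable section
namespace QuasiReversibility
open scoped ENNReal Convolution ComplexConjugate
open ContinuousLinearMap (lsmul)

/-! ### Cutoff functions near the sides and weak derivatives across them -/

section Cutoff

/-- The cutoffs use the argument `x = (n+1)·dist - 1`, so `x + 1` is the rescaled distance to the
side and the bound says that the cutoff derivative is `O(1/dist)`, uniformly in `n`. The shift by 1
keeps the support away from the side. -/
theorem smoothTransition_deriv_bound : ∃ K : ℝ, 0 ≤ K ∧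
    (∀ x, |deriv Real.smoothTransition x| * |x + 1| ≤ K) ∧
    ∀ x, 1 < x → deriv Real.smoothTransition x = 0 := by
  have hlarge : ∀ x, 1 < x → deriv Real.smoothTransition x = 0 := by
    intro x hx
    have : Real.smoothTransition =ᶠ[𝓝 x] fun _ => 1 := by
      filter_upwards [lt_mem_nhds hx] with y hy
      exact Real.smoothTransition.one_of_one_le hy.le
    rw [this.deriv_eq, deriv_const]
  have hsmall : ∀ x, x < 0 → deriv Real.smoothTransition x = 0 := by
    intro x hx
    have : Real.smoothTransition =ᶠ[𝓝 x] fun _ => 0 := by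
      filter_upwards [gt_mem_nhds hx] with y hy
      exact Real.smoothTransition.zero_of_nonpos hy.le
    rw [this.deriv_eq, deriv_const]
  have hc : Continuous (fun x => |deriv Real.smoothTransition x| * |x + 1|) := by
    have := (Real.smoothTransition.contDiff (n := 1)).continuous_deriv le_rfl
    fun_prop
  obtain ⟨K, hK⟩ := isCompact_Icc.bddAbove_image (f := fun x =>
    |deriv Real.smoothTransition x| * |x + 1|) (K := Icc (0 : ℝ) 1) hc.continuousOn
  refine ⟨max K 0, le_max_right _ _, fun x => ?_, hlarge⟩
  by_cases h0 : x < 0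
  · simp [hsmall x h0]
  by_cases h1 : 1 < x
  · simp [hlarge x h1]
  · exact (hK ⟨x, ⟨not_lt.1 h0, not_lt.1 h1⟩, rfl⟩).trans (le_max_left _ _)

/-- A smooth cutoff function of the interval `(a, c)`, equal to one away from the end points. -/
def sideCut (a c : ℝ) (n : ℕ) (t : ℝ) : ℝ :=
  Real.smoothTransition ((n + 1) * (t - a) - 1) * Real.smoothTransition ((n + 1) * (c - t) - 1)

theorem contDiff_sideCut (a c : ℝ) (n : ℕ) {k : ℕ∞} : ContDiff ℝ k (sideCut a c n) := by
  refine ContDiff.mul ?_ ?_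
  · exact Real.smoothTransition.contDiff.comp (by fun_prop)
  · exact Real.smoothTransition.contDiff.comp (by fun_prop)

theorem abs_sideCut_le (a c : ℝ) (n : ℕ) (t : ℝ) : |sideCut a c n t| ≤ 1 := by
  rw [sideCut, abs_mul, abs_of_nonneg (Real.smoothTransition.nonneg _),
    abs_of_nonneg (Real.smoothTransition.nonneg _)]
  exact mul_le_one₀ (Real.smoothTransition.le_one _) (Real.smoothTransition.nonneg _)
    (Real.smoothTransition.le_one _)

theorem eventually_large {x : ℝ} (hx : 0 < x) : ∀ᶠ n : ℕ in atTop, 1 < ((n : ℝ) + 1) * x - 1 := by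
  obtain ⟨N, hN⟩ := exists_nat_gt (2 / x)
  filter_upwards [eventually_ge_atTop N] with n hn
  have h1 : 2 / x < (n : ℝ) + 1 := by
    have : (N : ℝ) ≤ n := by exact_mod_cast hn
    linarith
  rw [div_lt_iff₀ hx] at h1
  linarith

theorem eventually_sideCut_eq_one {a c t : ℝ} (h1 : a < t) (h2 : t < c) :
    ∀ᶠ n in atTop, sideCut a c n t = 1 := by
  filter_upwards [eventually_large (sub_pos.2 h1), eventually_large (sub_pos.2 h2)] with n e1 e2
  rw [sideCut, Real.smoothTransition.one_of_one_le e1.le, Real.smoothTransition.one_of_one_le e2.le,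
    one_mul]

theorem sideCut_ne_zero {a c t : ℝ} {n : ℕ} (h : sideCut a c n t ≠ 0) :
    a + 1 / ((n : ℝ) + 1) ≤ t ∧ t ≤ c - 1 / ((n : ℝ) + 1) := by
  have hn : (0 : ℝ) < (n : ℝ) + 1 := by positivity
  have key : ∀ x : ℝ, Real.smoothTransition (((n : ℝ) + 1) * x - 1) ≠ 0 → 1 / ((n : ℝ) + 1) ≤ x := by
    intro x hx
    by_contra hcon
    refine hx (Real.smoothTransition.zero_of_nonpos ?_)
    rw [not_le, lt_div_iff₀ hn] at hcon
    linarith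
  have h1 := key _ (left_ne_zero_of_mul h)
  have h2 := key _ (right_ne_zero_of_mul h)
  constructor <;> linarith

theorem hasDerivAt_sideCut (a c : ℝ) (n : ℕ) (t : ℝ) :
    HasDerivAt (sideCut a c n)
      (deriv Real.smoothTransition ((n + 1) * (t - a) - 1) * (n + 1) *
        Real.smoothTransition ((n + 1) * (c - t) - 1) -
      Real.smoothTransition ((n + 1) * (t - a) - 1) *
        (deriv Real.smoothTransition ((n + 1) * (c - t) - 1) * (n + 1))) t := by
  have hd : ∀ x, HasDerivAt Real.smoothTransition (deriv Real.smoothTransition x) x := fun x =>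
    ((Real.smoothTransition.contDiff (n := 1)).differentiable (by simp) x).hasDerivAt
  have e1 : HasDerivAt (fun t : ℝ => ((n : ℝ) + 1) * (t - a) - 1) ((n : ℝ) + 1) t := by
    simpa using (((hasDerivAt_id t).sub_const a).const_mul ((n : ℝ) + 1)).sub_const 1
  have e2 : HasDerivAt (fun t : ℝ => ((n : ℝ) + 1) * (c - t) - 1) (-((n : ℝ) + 1)) t := by
    simpa using (((hasDerivAt_id t).const_sub c).const_mul ((n : ℝ) + 1)).sub_const 1
  have h := ((hd _).comp t e1).mul ((hd _).comp t e2)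
  refine h.congr_deriv ?_
  simp only [Function.comp]
  ring

/-- A quantity decaying linearly at both ends compensates the `O(1/dist)` growth of the cutoff
derivative. The bound does not depend on `n` and serves as the dominating constant in
`HasWD.extend_by_zero`. -/
theorem exists_abs_deriv_sideCut_mul_le : ∃ K : ℝ, 0 ≤ K ∧ ∀ (a c t : ℝ) (n : ℕ), a < t → t < c →
    ∀ M y : ℝ, 0 ≤ y → y ≤ M * (t - a) → y ≤ M * (c - t) →
      |deriv (sideCut a c n) t| * y ≤ K * M := by
  obtain ⟨K, hK0, hK, -⟩ := smoothTransition_deriv_bound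
  refine ⟨2 * K, by positivity, fun a c t n h1 h2 M y hy0 hy1 hy2 => ?_⟩
  have hn : (0 : ℝ) < (n : ℝ) + 1 := by positivity
  have hM : 0 ≤ M := by
    by_contra hcon
    have := mul_neg_of_neg_of_pos (not_le.1 hcon) (sub_pos.2 h1)
    linarith
  have key : ∀ x : ℝ, 0 < x → y ≤ M * x →
      |deriv Real.smoothTransition (((n : ℝ) + 1) * x - 1)| * ((n : ℝ) + 1) * y ≤ K * M := by
    intro x hx hyx
    have h3 := hK (((n : ℝ) + 1) * x - 1)
    rw [sub_add_cancel, abs_of_pos (mul_pos hn hx)] at h3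
    calc _ ≤ |deriv Real.smoothTransition (((n : ℝ) + 1) * x - 1)| * ((n : ℝ) + 1) * (M * x) := by
          gcongr
      _ = |deriv Real.smoothTransition (((n : ℝ) + 1) * x - 1)| * (((n : ℝ) + 1) * x) * M := by ring
      _ ≤ _ := by gcongr
  rw [(hasDerivAt_sideCut a c n t).deriv]
  have k1 := key _ (sub_pos.2 h1) hy1
  have k2 := key _ (sub_pos.2 h2) hy2
  set A := deriv Real.smoothTransition ((n + 1) * (t - a) - 1)
  set B := deriv Real.smoothTransition ((n + 1) * (c - t) - 1)
  set s1 := Real.smoothTransition ((n + 1) * (t - a) - 1)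
  set s2 := Real.smoothTransition ((n + 1) * (c - t) - 1)
  have hs1 : |s1| ≤ 1 := abs_le.2 ⟨by linarith [Real.smoothTransition.nonneg ((n + 1) * (t - a) - 1)],
    Real.smoothTransition.le_one _⟩
  have hs2 : |s2| ≤ 1 := abs_le.2 ⟨by linarith [Real.smoothTransition.nonneg ((n + 1) * (c - t) - 1)],
    Real.smoothTransition.le_one _⟩
  have hb : |A * (n + 1) * s2 - s1 * (B * (n + 1))| ≤ |A| * (n + 1) + |B| * (n + 1) := by
    refine (abs_sub _ _).trans ?_
    rw [abs_mul, abs_mul, abs_mul s1, abs_mul B, abs_of_pos hn]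
    gcongr ?_ + ?_
    · exact mul_le_of_le_one_right (by positivity) hs2
    · exact mul_le_of_le_one_left (by positivity) hs1
  calc _ ≤ (|A| * (n + 1) + |B| * (n + 1)) * y := by gcongr
    _ = |A| * (n + 1) * y + |B| * (n + 1) * y := by ring
    _ ≤ K * M + K * M := add_le_add k1 k2
    _ = _ := by ring

theorem eventually_deriv_sideCut_eq_zero {a c t : ℝ} (h1 : a < t) (h2 : t < c) :
    ∀ᶠ n in atTop, deriv (sideCut a c n) t = 0 := by
  obtain ⟨-, -, -, hK⟩ := smoothTransition_deriv_bound
  filter_upwards [eventually_large (sub_pos.2 h1), eventually_large (sub_pos.2 h2)] with n e1 e2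
  rw [(hasDerivAt_sideCut a c n t).deriv, hK _ e1, hK _ e2]
  simp

/-- The cutoff function of the `i`-th coordinate. -/
def coordCut (l r : Fin 3 → ℝ) (i : Fin 3) (n : ℕ) (p : E3) : ℝ := sideCut (l i) (r i) n (p i)

variable {l r : Fin 3 → ℝ}

theorem contDiff_coordCut (i : Fin 3) (n : ℕ) : ContDiff ℝ (⊤ : ℕ∞) (coordCut l r i n) :=
  (contDiff_sideCut (l i) (r i) n).comp (EuclideanSpace.proj i : E3 →L[ℝ] ℝ).contDiff

theorem partialD_coordCut (i j : Fin 3) (n : ℕ) (p : E3) :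
    partialD j (coordCut l r i n) p = if j = i then deriv (sideCut (l i) (r i) n) (p i) else 0 := by
  have h := ((hasDerivAt_sideCut (l i) (r i) n (p i)).differentiableAt.hasDerivAt.comp_hasFDerivAt p
    (EuclideanSpace.proj i : E3 →L[ℝ] ℝ).hasFDerivAt)
  have h2 := h.fderiv
  change fderiv ℝ (sideCut (l i) (r i) n ∘ (EuclideanSpace.proj i : E3 →L[ℝ] ℝ)) p _ = _
  rw [h2]
  by_cases hij : j = i
  · subst hij; simp
  · simp [hij, Ne.symm hij]

theorem tsupport_coordCut_subset (i : Fin 3) (n : ℕ) :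
    tsupport (coordCut l r i n) ⊆ slab l r {i} := by
  have hn : (0 : ℝ) < 1 / ((n : ℝ) + 1) := by positivity
  have hcl : IsClosed ({p : E3 | l i + 1 / ((n : ℝ) + 1) ≤ p i} ∩
      {p : E3 | p i ≤ r i - 1 / ((n : ℝ) + 1)}) :=
    (isClosed_le (by fun_prop) (by fun_prop)).inter (isClosed_le (by fun_prop) (by fun_prop))
  have hsub : tsupport (coordCut l r i n) ⊆ {p : E3 | l i + 1 / ((n : ℝ) + 1) ≤ p i} ∩
      {p : E3 | p i ≤ r i - 1 / ((n : ℝ) + 1)} :=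
    closure_minimal (fun p hp => sideCut_ne_zero hp) hcl
  intro p hp j hj
  rw [mem_singleton_iff] at hj
  subst hj
  have := hsub hp
  simp only [mem_inter_iff, mem_ofPred_eq] at this
  constructor <;> linarith [this.1, this.2]

theorem partialD_mul (j : Fin 3) {φ ψ : E3 → ℝ} (hφ : ContDiff ℝ (⊤ : ℕ∞) φ)
    (hψ : ContDiff ℝ (⊤ : ℕ∞) ψ) (p : E3) :
    partialD j (fun p => φ p * ψ p) p = φ p * partialD j ψ p + partialD j φ p * ψ p := by
  have h := (hφ.differentiable (by simp) p).hasFDerivAt.mul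
    (hψ.differentiable (by simp) p).hasFDerivAt
  have h2 := h.fderiv
  simp only [partialD]
  change fderiv ℝ (φ * ψ) p _ = _
  rw [h2]
  simp [mul_comm]

theorem mderiv_mul_coordCut (i : Fin 3) (n : ℕ) {β : Fin 3 → ℕ} (hβ : β i = 0) {φ : E3 → ℝ}
    (hφ : ContDiff ℝ (⊤ : ℕ∞) φ) :
    mderiv β (fun p => φ p * coordCut l r i n p) = fun p => mderiv β φ p * coordCut l r i n p := by
  have step : ∀ (j : Fin 3) (k : ℕ) (f : E3 → ℝ), ContDiff ℝ (⊤ : ℕ∞) f → (j = i → k = 0) →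
      (partialD j)^[k] (fun p => f p * coordCut l r i n p) =
        fun p => (partialD j)^[k] f p * coordCut l r i n p := by
    intro j k
    induction k with
    | zero => intro f _ _; rfl
    | succ k ih =>
      intro f hf hj
      have hji : j ≠ i := fun h => by simpa using hj h
      rw [Function.iterate_succ_apply, Function.iterate_succ_apply,
        ← ih _ (contDiff_partialD j hf) (fun h => absurd h hji)]
      congr 1
      funext p
      rw [partialD_mul j hf (contDiff_coordCut i n), partialD_coordCut, if_neg hji]
      ring
  have h2 := contDiff_iterate_partialD 2 (β 2) hφ
  have h1 := contDiff_iterate_partialD 1 (β 1) h2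
  simp only [mderiv]
  rw [step 2 _ φ hφ (fun h => h ▸ hβ), step 1 _ _ h2 (fun h => h ▸ hβ),
    step 0 _ _ h1 (fun h => h ▸ hβ)]

theorem integrable_smul_of_compact {ψ : E3 → ℝ} (h1 : Continuous ψ) (h2 : HasCompactSupport ψ)
    {u : E3 → ℂ} (hu : MemLp u 2 volume) : Integrable (fun p => ψ p • u p) volume :=
  memLp_one_iff_integrable.1 (hu.smul (h1.memLp_of_hasCompactSupport h2 (p := 2)))

theorem tendsto_integral_mul_coordCut (i : Fin 3) {ψ : E3 → ℝ} (h1 : Continuous ψ)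
    (h2 : HasCompactSupport ψ) {u : E3 → ℂ} (hu : MemLp u 2 volume)
    (hu0 : ∀ p ∉ box l r, u p = 0) :
    Tendsto (fun n => ∫ p, (ψ p * coordCut l r i n p) • u p) atTop (𝓝 (∫ p, ψ p • u p)) := by
  refine tendsto_integral_of_dominated_convergence (fun p => ‖ψ p • u p‖) (fun n => ?_)
    (integrable_smul_of_compact h1 h2 hu).norm (fun n => Eventually.of_forall fun p => ?_)
    (Eventually.of_forall fun p => ?_)
  · exact (h1.mul (contDiff_coordCut i n).continuous).aestronglyMeasurable.smul hu.1
  · rw [norm_smul, norm_smul, norm_mul]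
    gcongr
    exact mul_le_of_le_one_right (norm_nonneg _) (abs_sideCut_le _ _ _ _)
  · by_cases hp : p ∈ box l r
    · refine tendsto_const_nhds.congr' ?_
      filter_upwards [eventually_sideCut_eq_one (hp i).1 (hp i).2] with n hn
      rw [coordCut, hn, mul_one]
    · simp [hu0 p hp]

theorem tsupport_mul_coordCut_subset {J : Set (Fin 3)} (i : Fin 3) (n : ℕ) {φ : E3 → ℝ}
    (h3 : tsupport φ ⊆ slab l r J) :
    tsupport (fun p => φ p * coordCut l r i n p) ⊆ slab l r (insert i J) := by
  intro p hp j hj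
  rcases hj with rfl | hj
  · exact tsupport_coordCut_subset _ n (tsupport_mul_subset_right hp) _ rfl
  · exact h3 (tsupport_mul_subset_left hp) j hj

/-- Derivatives in other directions do not see the sides orthogonal to `eᵢ`. -/
theorem HasWD.drop_of_eq_zero {J : Set (Fin 3)} (i : Fin 3) {β : Fin 3 → ℕ} (hβ : β i = 0)
    {u g : E3 → ℂ} (hu : MemLp u 2 volume) (hg : MemLp g 2 volume)
    (hu0 : ∀ p ∉ box l r, u p = 0) (hg0 : ∀ p ∉ box l r, g p = 0)
    (h : HasWD (slab l r (insert i J)) β u g) : HasWD (slab l r J) β u g := by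
  intro φ h1 h2 h3
  have hn : ∀ n, ∫ p, (mderiv β φ p * coordCut l r i n p) • u p =
      (-1 : ℝ) ^ (∑ i, β i) • ∫ p, (φ p * coordCut l r i n p) • g p := by
    intro n
    have := h (fun p => φ p * coordCut l r i n p) (h1.mul (contDiff_coordCut i n)) h2.mul_right
      (tsupport_mul_coordCut_subset i n h3)
    rwa [mderiv_mul_coordCut i n hβ h1] at this
  have t1 := tendsto_integral_mul_coordCut i (contDiff_mderiv β h1).continuous
    (hasCompactSupport_mderiv β h2) hu hu0
  have t2 := (tendsto_integral_mul_coordCut i h1.continuous h2 hg hg0).const_smul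
    ((-1 : ℝ) ^ (∑ i, β i))
  exact tendsto_nhds_unique (t1.congr hn) t2

/-- A pure derivative in direction `j` passes through cutoffs in the two other coordinates, so test
functions need only avoid the sides orthogonal to `e_j`. No boundary condition is involved. -/
theorem HasWD.to_slab_singleton (j : Fin 3) {k : ℕ}
    {u g : E3 → ℂ} (hu : MemLp u 2 volume) (hg : MemLp g 2 volume)
    (hu0 : ∀ p ∉ box l r, u p = 0) (hg0 : ∀ p ∉ box l r, g p = 0)
    (h : HasWD (box l r) (Pi.single j k) u g) : HasWD (slab l r {j}) (Pi.single j k) u g := by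
  -- Addition in `Fin 3` is cyclic, so these are all three indices.
  have e : slab l r (insert (j + 1) (insert (j + 2) {j})) = box l r := by
    rw [← slab_univ]
    congr 1
    ext i
    fin_cases i <;> fin_cases j <;> simp
  have h1 : j + 1 ≠ j := by fin_cases j <;> decide
  have h2 : j + 2 ≠ j := by fin_cases j <;> decide
  rw [← e] at h
  exact HasWD.drop_of_eq_zero (j + 2) (by simp [h2]) hu hg hu0 hg0
    (HasWD.drop_of_eq_zero (j + 1) (by simp [h1]) hu hg hu0 hg0 h)

/-- A function that decays linearly at the sides orthogonal to `eᵢ` has an extension by zero with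
weak derivative in `L²`. -/
theorem HasWD.extend_by_zero (i : Fin 3) {u g f : E3 → ℂ} (hu : MemLp u 2 volume)
    (hg : MemLp g 2 volume) (hu0 : ∀ p ∉ box l r, u p = 0) (hg0 : ∀ p ∉ box l r, g p = 0)
    (huf : ∀ᵐ p, p ∈ box l r → u p = f p) {M : ℝ} (hM0 : 0 ≤ M)
    (hM1 : ∀ p ∈ box l r, ‖f p‖ ≤ M * (p i - l i)) (hM2 : ∀ p ∈ box l r, ‖f p‖ ≤ M * (r i - p i))
    (h : HasWD (box l r) (Pi.single i 1) u g) : HasWD univ (Pi.single i 1) u g := by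
  have hslab := HasWD.to_slab_singleton i hu hg hu0 hg0 h
  obtain ⟨K, hK0, hK⟩ := exists_abs_deriv_sideCut_mul_le
  intro φ h1 h2 _
  -- The test function is multiplied by the cutoff; the product rule produces the desired identity
  -- plus one term containing the cutoff derivative.
  have hn : ∀ n, (∫ p, (φ p * deriv (sideCut (l i) (r i) n) (p i)) • u p) +
      (∫ p, (mderiv (Pi.single i 1) φ p * coordCut l r i n p) • u p) =
      (-1 : ℝ) ^ (∑ j, (Pi.single i 1 : Fin 3 → ℕ) j) •
        ∫ p, (φ p * coordCut l r i n p) • g p := by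
    intro n
    have hs : ContDiff ℝ (⊤ : ℕ∞) (fun p => φ p * coordCut l r i n p) :=
      h1.mul (contDiff_coordCut i n)
    have := hslab (fun p => φ p * coordCut l r i n p) hs h2.mul_right (by
      have := tsupport_mul_coordCut_subset (l := l) (r := r) (J := ∅) i n (φ := φ)
        (fun p _ j hj => hj.elim)
      simpa using this)
    rw [← this, mderiv_single i hs, mderiv_single i h1, ← integral_add]
    · refine integral_congr_ae (Eventually.of_forall fun p => ?_)
      simp only
      rw [partialD_mul i h1 (contDiff_coordCut i n), partialD_coordCut, if_pos rfl, add_smul]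
    · refine integrable_smul_of_compact (ψ := fun p => φ p * deriv (sideCut (l i) (r i) n) (p i))
        ?_ h2.mul_right hu
      have hc : Continuous (deriv (sideCut (l i) (r i) n)) :=
        (contDiff_sideCut (l i) (r i) n (k := 1)).continuous_deriv le_rfl
      exact h1.continuous.mul (hc.comp (by fun_prop))
    · exact integrable_smul_of_compact
        (ψ := fun p => partialD i φ p * coordCut l r i n p)
        ((contDiff_partialD i h1).continuous.mul (contDiff_coordCut i n).continuous)
        ((h2.fderiv_apply ℝ _).mul_right) hu
  -- The extra term is dominated by `|φ| K M` thanks to the linear decay, and it vanishes pointwise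
  -- because the cutoff is eventually constant near each point of the box.
  have t0 : Tendsto (fun n => ∫ p, (φ p * deriv (sideCut (l i) (r i) n) (p i)) • u p) atTop
      (𝓝 (∫ _p : E3, (0 : ℂ))) := by
    refine tendsto_integral_of_dominated_convergence (fun p => |φ p| * (K * M)) (fun n => ?_)
      ?_ (fun n => ?_) (Eventually.of_forall fun p => ?_)
    · have hc : Continuous (deriv (sideCut (l i) (r i) n)) :=
        (contDiff_sideCut (l i) (r i) n (k := 1)).continuous_deriv le_rfl
      have hc2 : Continuous fun p : E3 => φ p * deriv (sideCut (l i) (r i) n) (p i) :=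
        h1.continuous.mul (hc.comp (by fun_prop))
      exact hc2.aestronglyMeasurable.smul hu.1
    · exact (h1.continuous.integrable_of_hasCompactSupport h2).abs.mul_const _
    · filter_upwards [huf] with p hp
      by_cases hpb : p ∈ box l r
      · rw [hp hpb, norm_smul, norm_mul, Real.norm_eq_abs, Real.norm_eq_abs, mul_assoc]
        exact mul_le_mul_of_nonneg_left (hK _ _ _ n (hpb i).1 (hpb i).2 M _ (norm_nonneg _)
          (hM1 p hpb) (hM2 p hpb)) (abs_nonneg _)
      · rw [hu0 p hpb, smul_zero, norm_zero]
        positivity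
    · by_cases hpb : p ∈ box l r
      · refine tendsto_const_nhds.congr' ?_
        filter_upwards [eventually_deriv_sideCut_eq_zero (hpb i).1 (hpb i).2] with n hn
        rw [hn, mul_zero, zero_smul]
      · simp [hu0 p hpb]
  have t1 := tendsto_integral_mul_coordCut i (contDiff_mderiv (Pi.single i 1) h1).continuous
    (hasCompactSupport_mderiv (Pi.single i 1) h2) hu hu0
  have t2 := (tendsto_integral_mul_coordCut i h1.continuous h2 hg hg0).const_smul
    ((-1 : ℝ) ^ (∑ j, (Pi.single i 1 : Fin 3 → ℕ) j))
  have t3 := t0.add t1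
  simp only [integral_zero, zero_add] at t3
  exact tendsto_nhds_unique (t3.congr hn) t2

end Cutoff

end QuasiReversibility
end

noncomputable section
namespace QuasiReversibility
open scoped ENNReal Convolution ComplexConjugate
open ContinuousLinearMap (lsmul)

/-! ### The H² estimate by the Laplacian for functions vanishing on the boundary -/

section APriori

/-- The mean value inequality is used along the straight segment from `p` to the nearest point of
the opposite or adjacent side in direction `e_i`, where `f` vanishes. The end point lies only in the
closure, so it is reached as a limit. -/
theorem norm_le_of_frontier_eq_zero {l r : Fin 3 → ℝ} {f : E3 → ℂ}
    (hc : ContinuousOn f (closure (box l r))) (hd : ∀ p ∈ box l r, DifferentiableAt ℝ f p)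
    {M : ℝ} (hM : ∀ p ∈ box l r, ‖fderiv ℝ f p‖ ≤ M) (h0 : ∀ p ∈ frontier (box l r), f p = 0)
    (i : Fin 3) {p : E3} (hp : p ∈ box l r) :
    ‖f p‖ ≤ M * (p i - l i) ∧ ‖f p‖ ≤ M * (r i - p i) := by
  have hM0 : 0 ≤ M := (norm_nonneg _).trans (hM p hp)
  have key : ∀ c : ℝ, l i ≤ c → c ≤ r i → (c = l i ∨ c = r i) → ‖f p‖ ≤ M * |c - p i| := by
    intro c hc1 hc2 hc3
    set v : E3 := (c - p i) • EuclideanSpace.single i (1 : ℝ) with hv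
    have hvn : ‖v‖ = |c - p i| := by
      rw [hv, norm_smul, PiLp.norm_single, norm_one, mul_one, Real.norm_eq_abs]
    have hvi : ∀ (t : ℝ) (j : Fin 3), (p + t • v) j = p j + if j = i then t * (c - p i) else 0 := by
      intro t j
      by_cases hj : j = i <;> simp [hv, hj]
    have hin : ∀ t ∈ Ico (0 : ℝ) 1, p + t • v ∈ box l r := by
      intro t ht j
      rw [hvi]
      have h1 := hp j
      split_ifs with hj
      · subst hj
        have ha : p j + t * (c - p j) = (1 - t) * p j + t * c := by ring
        rw [ha]
        constructor
        · nlinarith [mul_pos (sub_pos.2 ht.2) (sub_pos.2 h1.1),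
            mul_nonneg ht.1 (sub_nonneg.2 hc1)]
        · nlinarith [mul_pos (sub_pos.2 ht.2) (sub_pos.2 h1.2),
            mul_nonneg ht.1 (sub_nonneg.2 hc2)]
      · simpa using h1
    have hγ : Continuous fun t : ℝ => p + t • v := by fun_prop
    have hne : (𝓝[Ico (0 : ℝ) 1] 1).NeBot := right_nhdsWithin_Ico_neBot zero_lt_one
    have htend : Tendsto (fun t : ℝ => p + t • v) (𝓝[Ico (0 : ℝ) 1] 1)
        (𝓝[box l r] (p + (1 : ℝ) • v)) :=
      tendsto_nhdsWithin_iff.2 ⟨hγ.continuousWithinAt, by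
        filter_upwards [self_mem_nhdsWithin] with t ht using hin t ht⟩
    have hcl : p + (1 : ℝ) • v ∈ closure (box l r) :=
      mem_closure_of_tendsto (tendsto_nhds_of_tendsto_nhdsWithin htend) (by
        filter_upwards [self_mem_nhdsWithin] with t ht using hin t ht)
    have hfr : p + (1 : ℝ) • v ∈ frontier (box l r) := by
      rw [(isOpen_box l r).frontier_eq]
      refine ⟨hcl, fun hmem => ?_⟩
      have h1 := hmem i
      rw [hvi, if_pos rfl, one_mul, add_sub_cancel] at h1
      rcases hc3 with h | h <;> simp [h] at h1
    have hlim : Tendsto (fun t : ℝ => ‖f (p + t • v) - f p‖) (𝓝[Ico (0 : ℝ) 1] 1)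
        (𝓝 ‖f (p + (1 : ℝ) • v) - f p‖) := by
      have h1 : Tendsto f (𝓝[box l r] (p + (1 : ℝ) • v)) (𝓝 (f (p + (1 : ℝ) • v))) :=
        (hc _ hcl).mono_left (nhdsWithin_mono _ subset_closure)
      exact ((h1.comp htend).sub_const _).norm
    have hbd : ‖f (p + (1 : ℝ) • v) - f p‖ ≤ M * |c - p i| := by
      refine le_of_tendsto hlim ?_
      filter_upwards [self_mem_nhdsWithin] with t ht
      refine ((convex_box l r).norm_image_sub_le_of_norm_fderiv_le hd hM hp (hin t ht)).trans ?_
      rw [add_sub_cancel_left, norm_smul, hvn, Real.norm_eq_abs, abs_of_nonneg ht.1]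
      gcongr
      exact mul_le_of_le_one_left (abs_nonneg _) ht.2.le
    rwa [h0 _ hfr, zero_sub, norm_neg] at hbd
  have hpi := hp i
  constructor
  · have := key (l i) le_rfl (by linarith) (Or.inl rfl)
    rwa [abs_sub_comm, abs_of_pos (sub_pos.2 hpi.1)] at this
  · have := key (r i) (by linarith) le_rfl (Or.inr rfl)
    rwa [abs_of_pos (sub_pos.2 hpi.2)] at this

variable {Ω : Set E3}

theorem eqOn_closure_of_ae_eq (ho : IsOpen Ω) {f g : E3 → ℂ} (hf : ContinuousOn f (closure Ω))
    (hg : ContinuousOn g (closure Ω)) (h : f =ᵐ[volume.restrict Ω] g) : EqOn f g (closure Ω) :=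
  (Measure.eqOn_open_of_ae_eq h ho (hf.mono subset_closure)
    (hg.mono subset_closure)).of_subset_closure hf hg subset_closure subset_rfl

/-- The class in `L²(Ω)` of a continuous compactly supported function. -/
def ccLp (Ω : Set E3) (w : E3 → ℂ) (h1 : Continuous w) (h2 : HasCompactSupport w) : L2 Ω :=
  ((h1.memLp_of_hasCompactSupport h2 (p := 2) (μ := volume)).restrict Ω).toLp w

theorem ccLp_ae (w : E3 → ℂ) (h1 : Continuous w) (h2 : HasCompactSupport w) :
    ccLp Ω w h1 h2 =ᵐ[volume.restrict Ω] w := MemLp.coeFn_toLp _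

/-- Weak derivatives are tested with real functions only; splitting the conjugated first argument
into real and imaginary parts makes them usable in complex inner products. -/
theorem inner_ccLp (hm : MeasurableSet Ω) (w : E3 → ℂ) (h1 : Continuous w)
    (h2 : HasCompactSupport w) (u : L2 Ω) :
    inner ℂ (ccLp Ω w h1 h2) u =
      (∫ p, (w p).re • zext u p) - Complex.I * ∫ p, (w p).im • zext u p := by
  rw [integral_smul_zext hm, integral_smul_zext hm, L2.inner_def, ← integral_const_mul,
    ← integral_sub]
  · refine integral_congr_ae ?_
    filter_upwards [ccLp_ae (Ω := Ω) w h1 h2] with p hp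
    rw [hp, RCLike.inner_apply]
    apply Complex.ext <;> simp <;> ring
  · exact integrable_smul_L2 (Complex.continuous_re.comp h1) (h2.comp_left Complex.zero_re) u
  · exact (integrable_smul_L2 (Complex.continuous_im.comp h1)
      (h2.comp_left Complex.zero_im) u).const_mul _

theorem HasWD.inner_ccLp_mderiv (hm : MeasurableSet Ω) {A : Set E3} {β : Fin 3 → ℕ} {u g : L2 Ω}
    (h : HasWD A β (zext u) (zext g)) {w : E3 → ℂ} (h1 : ContDiff ℝ (⊤ : ℕ∞) w)
    (h2 : HasCompactSupport w) (h3 : tsupport w ⊆ A) :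
    inner ℂ (ccLp Ω (mderiv β w) (contDiff_mderiv β h1).continuous
      (hasCompactSupport_mderiv β h2)) u =
      (-1 : ℝ) ^ (∑ i, β i) • inner ℂ (ccLp Ω w h1.continuous h2) g := by
  rw [inner_ccLp hm, inner_ccLp hm]
  have hre := h (fun p => (w p).re) (Complex.reCLM.contDiff.comp h1)
    (h2.comp_left Complex.zero_re) ((tsupport_comp_subset Complex.zero_re w).trans h3)
  have him := h (fun p => (w p).im) (Complex.imCLM.contDiff.comp h1)
    (h2.comp_left Complex.zero_im) ((tsupport_comp_subset Complex.zero_im w).trans h3)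
  have e1 := mderiv_clm_comp Complex.reCLM β h1
  have e2 := mderiv_clm_comp Complex.imCLM β h1
  simp only [Complex.reCLM_apply, Complex.imCLM_apply] at e1 e2
  rw [e1] at hre
  rw [e2] at him
  rw [hre, him, smul_sub, mul_smul_comm]

theorem exists_ccLp_approx {l r : Fin 3 → ℝ} (hΩ : Ω = box l r) (hl : ∀ i, l i < 0)
    (hr : ∀ i, 0 < r i) (J : Set (Fin 3)) {u : L2 Ω} {g : (Fin 3 → ℕ) → L2 Ω}
    {B : Set (Fin 3 → ℕ)} (hB : ∀ β ∈ B, HasWD (slab l r J) β (zext u) (zext (g β))) :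
    ∃ (w : ℕ → E3 → ℂ) (h1 : ∀ n, ContDiff ℝ (⊤ : ℕ∞) (w n)) (h2 : ∀ n, HasCompactSupport (w n)),
      (∀ n, tsupport (w n) ⊆ slab l r Jᶜ) ∧
      ∀ β ∈ B, Tendsto (fun n => ccLp Ω (mderiv β (w n)) (contDiff_mderiv β (h1 n)).continuous
        (hasCompactSupport_mderiv β (h2 n))) atTop (𝓝 (g β)) := by
  subst hΩ
  have hm := (isOpen_box l r).measurableSet
  obtain ⟨w, h1, h2, h3, hlim⟩ := exists_smooth_approx hl hr J (u := zext u)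
    (g := fun β => zext (g β)) (B := B) (memLp_zext hm u)
    (fun p hp => indicator_of_notMem hp _) (fun β _ => memLp_zext hm _) hB
  refine ⟨w, h1, h2, h3, fun β hβ => ?_⟩
  rw [Lp.tendsto_Lp_iff_tendsto_eLpNorm']
  refine (hlim β hβ).congr fun n => eLpNorm_congr_ae ?_
  filter_upwards [zext_ae hm (g β), ccLp_ae (Ω := box l r) (mderiv β (w n))
    (contDiff_mderiv β (h1 n)).continuous (hasCompactSupport_mderiv β (h2 n))] with p hp hp2
  simp [hp, hp2]

variable {l r : Fin 3 → ℝ}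

theorem single_add_single_sum (i j : Fin 3) :
    ∑ k, (Pi.single i 1 + Pi.single j 1 : Fin 3 → ℕ) k = 2 := by
  simp [Finset.sum_add_distrib]

/-- The C¹ representative vanishes on the boundary and has bounded gradient, so it decays linearly
at every side and `HasWD.extend_by_zero` applies. -/
theorem HasBoundaryValues.hasWD_univ (hΩ : Ω = box l r) (hl : ∀ i, l i < 0) (hr : ∀ i, 0 < r i)
    {h : L2 Ω} (hh : h ∈ sobolev Ω 3) (h0 : HasBoundaryValues h (frontier Ω) fun _ => 0)
    (i : Fin 3) :
    HasWD univ (Pi.single i 1) (zext h) (zext (weakD (Pi.single i 1) h)) := by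
  obtain ⟨C, hC, hE⟩ := exists_c1_representative hΩ hl hr
  obtain ⟨f, g, hfc, hfae, -, -, -, hgb, hfd, hfg⟩ := hE h hh
  obtain ⟨f', hf'c, hf'ae, hf'0⟩ := h0
  subst hΩ
  have ho := isOpen_box l r
  have hm := ho.measurableSet
  have heq := eqOn_closure_of_ae_eq ho hfc hf'c (hfae.trans hf'ae.symm)
  have hzero : ∀ p ∈ frontier (box l r), f p = 0 := fun p hp => by
    rw [heq (frontier_subset_closure hp), hf'0 p hp]
  have hdiff : ∀ p ∈ box l r, DifferentiableAt ℝ f p := fun p hp =>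
    (hfd.differentiableOn (by simp) p hp).differentiableAt (ho.mem_nhds hp)
  set M := 3 * (C * sobolevNorm 3 h) with hMdef
  have hM0 : 0 ≤ M := by have := sobolevNorm_nonneg 3 h; positivity
  have hM : ∀ p ∈ box l r, ‖fderiv ℝ f p‖ ≤ M := by
    intro p hp
    have h1 := enorm_clm_le_sum (fderiv ℝ f p)
    have h2 : ‖fderiv ℝ f p‖ₑ ≤ ENNReal.ofReal M := by
      refine h1.trans ?_
      have : M = ∑ _i : Fin 3, C * sobolevNorm 3 h := by simp [hMdef]
      rw [this, ENNReal.ofReal_sum_of_nonneg fun _ _ => by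
        have := sobolevNorm_nonneg 3 h; positivity]
      refine Finset.sum_le_sum fun j _ => ?_
      rw [← ofReal_norm]
      refine ENNReal.ofReal_le_ofReal ?_
      have h3 := hfg j p hp
      rw [partialD] at h3
      rw [h3]
      exact hgb j p (subset_closure hp)
    rwa [← ofReal_norm, ENNReal.ofReal_le_ofReal_iff hM0] at h2
  refine HasWD.extend_by_zero (l := l) (r := r) i (f := f) (memLp_zext hm h) (memLp_zext hm _)
    (fun p hp => indicator_of_notMem hp _) (fun p hp => indicator_of_notMem hp _) ?_ hM0
    (fun p hp => (norm_le_of_frontier_eq_zero hfc hdiff hM hzero i hp).1)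
    (fun p hp => (norm_le_of_frontier_eq_zero hfc hdiff hM hzero i hp).2)
    ((isWeakDeriv_weakD hh (by simp)).hasWD hm)
  have := (ae_restrict_iff' hm).1 hfae
  filter_upwards [this] with p hp hpb
  rw [hp hpb]
  exact indicator_of_mem hpb _

/-- For `h ∈ H³` with zero boundary values, `⟪h_jj, h_ii⟫ = ‖h_ij‖²`. -/
theorem inner_weakD_pure (hΩ : Ω = box l r) (hl : ∀ i, l i < 0) (hr : ∀ i, 0 < r i)
    {h : L2 Ω} (hh : h ∈ sobolev Ω 3) (h0 : HasBoundaryValues h (frontier Ω) fun _ => 0)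
    {i j : Fin 3} (hij : i ≠ j) :
    inner ℂ (weakD (Pi.single j 2) h : L2 Ω) (weakD (Pi.single i 2) h) =
      inner ℂ (weakD (Pi.single i 1 + Pi.single j 1) h : L2 Ω)
        (weakD (Pi.single i 1 + Pi.single j 1) h) := by
  have hm : MeasurableSet Ω := hΩ ▸ (isOpen_box l r).measurableSet
  have huniv := HasBoundaryValues.hasWD_univ hΩ hl hr hh h0
  have hout : ∀ u : L2 Ω, ∀ p ∉ box l r, zext u p = 0 := fun u p hp =>
    indicator_of_notMem (hΩ ▸ hp) _
  -- Pure second derivatives see only their own pair of sides.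
  have hpure : ∀ k, HasWD (slab l r {k}) (Pi.single k 2) (zext h)
      (zext (weakD (Pi.single k 2) h)) := fun k =>
    HasWD.to_slab_singleton k (memLp_zext hm _) (memLp_zext hm _) (hout _) (hout _)
      (hΩ ▸ (isWeakDeriv_weakD hh (by simp)).hasWD hm)
  -- The vanishing trace allows the `m`-derivative to be moved over all of space; the remaining
  -- `k`-derivative then requires test functions to avoid only the `k`-sides.
  have hmix : ∀ k m : Fin 3, HasWD (slab l r {k}) (Pi.single k 1 + Pi.single m 1) (zext h)
      (zext (weakD (Pi.single k 1 + Pi.single m 1) h)) := by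
    intro k m
    have h1 : IsWeakDeriv Ω (Pi.single k 1) (weakD (Pi.single m 1) h)
        (weakD (Pi.single k 1 + Pi.single m 1) h) :=
      IsWeakDeriv.of_add (isWeakDeriv_weakD hh (by simp))
        (isWeakDeriv_weakD hh (by rw [single_add_single_sum]; norm_num))
    have h2 : HasWD (slab l r {k}) (Pi.single k 1) (zext (weakD (Pi.single m 1) h))
        (zext (weakD (Pi.single k 1 + Pi.single m 1) h)) :=
      HasWD.to_slab_singleton k (memLp_zext hm _) (memLp_zext hm _) (hout _) (hout _)
        (hΩ ▸ h1.hasWD hm)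
    intro φ c1 c2 c3
    have e1 := huniv m (mderiv (Pi.single k 1) φ) (contDiff_mderiv _ c1)
      (hasCompactSupport_mderiv _ c2) (subset_univ _)
    rw [mderiv_mderiv _ _ c1, add_comm, h2 φ c1 c2 c3, smul_smul, ← pow_add] at e1
    rw [e1, single_add_single_sum]
    simp
  -- Stretching in direction `j` and squeezing in the others gives approximations whose supports
  -- avoid the `i`-sides, so they are admissible in both identities on `slab l r {i}`.
  obtain ⟨w, h1, h2, h3, hlim⟩ := exists_ccLp_approx hΩ hl hr {j} (u := h)
    (g := fun β => weakD β h) (B := {Pi.single j 2, Pi.single i 1 + Pi.single j 1}) (by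
      rintro β (rfl | rfl)
      · exact hpure j
      · have := hmix j i
        rwa [add_comm] at this)
  have hts : ∀ n, tsupport (w n) ⊆ slab l r {i} := fun n p hp k hk => by
    rw [mem_singleton_iff] at hk
    subst hk
    exact h3 n hp k (by simpa using hij)
  -- Both sides equal the pairing of `∂_i² ∂_j² w` with `h`; the signs disappear because both orders
  -- are even.
  have hid : ∀ n, inner ℂ (ccLp Ω (mderiv (Pi.single j 2) (w n))
        (contDiff_mderiv _ (h1 n)).continuous (hasCompactSupport_mderiv _ (h2 n)))
        (weakD (Pi.single i 2) h) =
      inner ℂ (ccLp Ω (mderiv (Pi.single i 1 + Pi.single j 1) (w n))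
        (contDiff_mderiv _ (h1 n)).continuous (hasCompactSupport_mderiv _ (h2 n)))
        (weakD (Pi.single i 1 + Pi.single j 1) h) := by
    intro n
    have a1 := (hpure i).inner_ccLp_mderiv hm (contDiff_mderiv (Pi.single j 2) (h1 n))
      (hasCompactSupport_mderiv _ (h2 n)) ((tsupport_mderiv_subset _ _).trans (hts n))
    have a2 := (hmix i j).inner_ccLp_mderiv hm
      (contDiff_mderiv (Pi.single i 1 + Pi.single j 1) (h1 n))
      (hasCompactSupport_mderiv _ (h2 n)) ((tsupport_mderiv_subset _ _).trans (hts n))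
    rw [single_add_single_sum] at a2
    have s1 : ∑ k, (Pi.single i 2 : Fin 3 → ℕ) k = 2 := by simp
    rw [s1] at a1
    simp only [even_two.neg_pow, one_pow, one_smul] at a1 a2
    rw [← a1, ← a2]
    congr 2
    rw [mderiv_mderiv _ _ (h1 n), mderiv_mderiv _ _ (h1 n)]
    congr 1
    rw [show (2 : ℕ) = 1 + 1 from rfl, Pi.single_add, Pi.single_add]
    abel
  have t1 := (hlim _ (Or.inl rfl)).inner (𝕜 := ℂ)
    (tendsto_const_nhds (x := (weakD (Pi.single i 2) h : L2 Ω)))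
  have t2 := (hlim _ (Or.inr rfl)).inner (𝕜 := ℂ)
    (tendsto_const_nhds (x := (weakD (Pi.single i 1 + Pi.single j 1) h : L2 Ω)))
  exact tendsto_nhds_unique (t1.congr hid) t2

theorem inner_self_eq_ofReal (u : L2 Ω) : inner ℂ u u = ((‖u‖ ^ 2 : ℝ) : ℂ) := by
  rw [inner_self_eq_norm_sq_to_K]
  push_cast
  rfl

/-- Expanding the square, each off-diagonal product of pure derivatives becomes a squared mixed
derivative. On flat faces with zero trace no curvature term appears, so this is an identity. -/
theorem norm_sq_weakLaplacian (hΩ : Ω = box l r) (hl : ∀ i, l i < 0) (hr : ∀ i, 0 < r i)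
    {h : L2 Ω} (hh : h ∈ sobolev Ω 3) (h0 : HasBoundaryValues h (frontier Ω) fun _ => 0) :
    ‖weakLaplacian h‖ ^ 2 =
      ∑ i, ∑ j, ‖(weakD (Pi.single i 1 + Pi.single j 1) h : L2 Ω)‖ ^ 2 := by
  have h1 : ((‖weakLaplacian h‖ ^ 2 : ℝ) : ℂ) =
      ∑ i, ∑ j, ((‖(weakD (Pi.single i 1 + Pi.single j 1) h : L2 Ω)‖ ^ 2 : ℝ) : ℂ) := by
    rw [← inner_self_eq_ofReal, weakLaplacian, inner_sum]
    refine Finset.sum_congr rfl fun i _ => ?_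
    rw [sum_inner]
    refine Finset.sum_congr rfl fun j _ => ?_
    by_cases hij : i = j
    · subst hij
      rw [← Pi.single_add, inner_self_eq_ofReal]
    · rw [inner_weakD_pure hΩ hl hr hh h0 hij, inner_self_eq_ofReal]
  exact_mod_cast h1

/-- Poincaré's inequality and the energy estimate. -/
theorem exists_norm_le_weakLaplacian (hΩ : Ω = box l r) (hl : ∀ i, l i < 0) (hr : ∀ i, 0 < r i) :
    ∃ K : ℝ, 0 ≤ K ∧ ∀ h ∈ sobolev Ω 3, HasBoundaryValues h (frontier Ω) (fun _ => 0) →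
      ‖h‖ ≤ K * ‖weakLaplacian h‖ ∧
      ∀ i, ‖(weakD (Pi.single i 1) h : L2 Ω)‖ ≤ K * ‖weakLaplacian h‖ := by
  have ho : IsOpen Ω := hΩ ▸ isOpen_box l r
  have hm : MeasurableSet Ω := ho.measurableSet
  have hb : Bornology.IsBounded Ω := hΩ ▸ isBounded_box l r
  set C : ℝ := (eLpNormLESNormFDerivOfLeConst ℂ (volume : Measure E3) Ω 2 2 : ℝ) with hCdef
  have hC0 : 0 ≤ C := NNReal.coe_nonneg _
  -- With `S` the sum of the gradient norms, Poincaré gives `‖h‖ ≤ C S` and the energy identity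
  -- gives `S² ≤ 3‖h‖‖Δh‖`. Hence `S ≤ 3C‖Δh‖` and `‖h‖ ≤ 3C²‖Δh‖`.
  refine ⟨3 * C + 3 * C ^ 2, by positivity, fun h hh h0 => ?_⟩
  have huniv := HasBoundaryValues.hasWD_univ hΩ hl hr hh h0
  set B : Set (Fin 3 → ℕ) := {β | β = 0 ∨ ∃ i, β = Pi.single i 1} with hBdef
  -- With `J = ∅` the function is squeezed in every direction, so the approximations are test
  -- functions compactly supported in Ω.
  obtain ⟨w, h1, h2, h3, hlim⟩ := exists_ccLp_approx hΩ hl hr ∅ (u := h)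
    (g := fun β => weakD β h) (B := B) (by
      rintro β (rfl | ⟨i, rfl⟩)
      · intro φ _ _ _
        rw [weakD_zero_index ho]
        simp [mderiv_zero]
      · exact (huniv i).mono (subset_univ _))
  have hts : ∀ n, tsupport (w n) ⊆ Ω := fun n => by
    have := h3 n
    rwa [compl_empty, slab_univ, ← hΩ] at this
  have l0 := hlim 0 (Or.inl rfl)
  have li := fun i => hlim (Pi.single i 1) (Or.inr ⟨i, rfl⟩)
  simp only [weakD_zero_index ho] at l0
  -- Poincaré's inequality
  have hP : ‖h‖ ≤ C * ∑ i, ‖(weakD (Pi.single i 1) h : L2 Ω)‖ := by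
    refine le_of_tendsto_of_tendsto' l0.norm
      ((tendsto_finsetSum Finset.univ fun i _ => (li i).norm).const_mul C) fun n => ?_
    have hnorm : ∀ (v : E3 → ℂ) (c1 : Continuous v) (c2 : HasCompactSupport v), tsupport v ⊆ Ω →
        ‖ccLp Ω v c1 c2‖ₑ = eLpNorm v 2 volume := by
      intro v c1 c2 c3
      rw [Lp.enorm_def, eLpNorm_congr_ae (ccLp_ae v c1 c2)]
      rw [← eLpNorm_indicator_eq_eLpNorm_restrict hm]
      congr 1
      exact indicator_eq_self.2 ((subset_tsupport v).trans c3)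
    have hG := eLpNorm_le_eLpNorm_fderiv (volume : Measure E3) ((h1 n).of_le (by
      exact_mod_cast le_top)) ((subset_tsupport _).trans (hts n)) (p := 2) (by norm_num)
      (by simp [finrank_euclideanSpace]; norm_num) hb
    have hG2 : ‖ccLp Ω (mderiv 0 (w n)) (contDiff_mderiv 0 (h1 n)).continuous
        (hasCompactSupport_mderiv 0 (h2 n))‖ₑ ≤ ENNReal.ofReal C *
        ∑ i, ‖ccLp Ω (mderiv (Pi.single i 1) (w n)) (contDiff_mderiv _ (h1 n)).continuous
          (hasCompactSupport_mderiv _ (h2 n))‖ₑ := by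
      rw [hnorm _ _ _ ((tsupport_mderiv_subset _ _).trans (hts n)), mderiv_zero]
      refine hG.trans ?_
      rw [hCdef, ENNReal.ofReal_coe_nnreal]
      gcongr
      refine (eLpNorm_fderiv_le (h1 n) volume).trans (le_of_eq ?_)
      refine Finset.sum_congr rfl fun i _ => ?_
      rw [hnorm _ _ _ ((tsupport_mderiv_subset _ _).trans (hts n)), mderiv_single i (h1 n)]
    simp only [← ofReal_norm] at hG2
    rw [← ENNReal.ofReal_sum_of_nonneg (fun _ _ => norm_nonneg _), ← ENNReal.ofReal_mul hC0,
      ENNReal.ofReal_le_ofReal_iff (by positivity)] at hG2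
    exact hG2
  -- the energy identity
  have hE : ∀ i, inner ℂ h (weakD (Pi.single i 2) h : L2 Ω) =
      -inner ℂ (weakD (Pi.single i 1) h : L2 Ω) (weakD (Pi.single i 1) h) := by
    intro i
    have t1 := l0.inner (𝕜 := ℂ) (tendsto_const_nhds (x := (weakD (Pi.single i 2) h : L2 Ω)))
    have t2 := ((li i).inner (𝕜 := ℂ)
      (tendsto_const_nhds (x := (weakD (Pi.single i 1) h : L2 Ω)))).neg
    refine tendsto_nhds_unique (t1.congr fun n => ?_) t2
    have hd : HasWD Ω (Pi.single i 1) (zext (weakD (Pi.single i 1) h))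
        (zext (weakD (Pi.single i 2) h)) := by
      refine IsWeakDeriv.hasWD hm (IsWeakDeriv.of_add (isWeakDeriv_weakD hh (by simp)) ?_)
      rw [← Pi.single_add]
      exact isWeakDeriv_weakD hh (by simp)
    have a1 := hd.inner_ccLp_mderiv hm (contDiff_mderiv 0 (h1 n))
      (hasCompactSupport_mderiv _ (h2 n)) ((tsupport_mderiv_subset _ _).trans (hts n))
    have s1 : ∑ k, (Pi.single i 1 : Fin 3 → ℕ) k = 1 := by simp
    rw [s1, pow_one, neg_smul, one_smul] at a1
    rw [← neg_eq_iff_eq_neg, ← a1]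
    rfl
  set G := fun i : Fin 3 => ‖(weakD (Pi.single i 1) h : L2 Ω)‖ with hG
  have hsumsq : ∑ i, G i ^ 2 ≤ ‖h‖ * ‖weakLaplacian h‖ := by
    have e1 : inner ℂ h (weakLaplacian h) = -((∑ i, G i ^ 2 : ℝ) : ℂ) := by
      rw [weakLaplacian, inner_sum]
      push_cast
      rw [← Finset.sum_neg_distrib]
      refine Finset.sum_congr rfl fun i _ => ?_
      rw [hE, inner_self_eq_norm_sq_to_K]
      rfl
    have e2 := norm_inner_le_norm (𝕜 := ℂ) h (weakLaplacian h)
    rw [e1, norm_neg, Complex.norm_real, Real.norm_eq_abs] at e2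
    exact (le_abs_self _).trans e2
  set S := ∑ i, G i with hS
  have hS0 : 0 ≤ S := Finset.sum_nonneg fun _ _ => norm_nonneg _
  have hL0 : 0 ≤ ‖weakLaplacian h‖ := norm_nonneg _
  have hSq : S ^ 2 ≤ 3 * ∑ i, G i ^ 2 := by
    have := sq_sum_le_card_mul_sum_sq (s := (Finset.univ : Finset (Fin 3))) (f := G)
    simpa using this
  have hSb : S ≤ 3 * C * ‖weakLaplacian h‖ := by
    have h4 : S * S ≤ 3 * C * ‖weakLaplacian h‖ * S := by
      calc S * S = S ^ 2 := (sq S).symm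
        _ ≤ 3 * (‖h‖ * ‖weakLaplacian h‖) := hSq.trans (by linarith)
        _ ≤ 3 * ((C * S) * ‖weakLaplacian h‖) := by gcongr
        _ = _ := by ring
    rcases hS0.eq_or_lt with h5 | h5
    · rw [← h5]; positivity
    · exact le_of_mul_le_mul_right h4 h5
  have hCL : 0 ≤ C ^ 2 * ‖weakLaplacian h‖ := by positivity
  have hCL1 : 0 ≤ C * ‖weakLaplacian h‖ := by positivity
  constructor
  · have := mul_le_mul_of_nonneg_left hSb hC0
    nlinarith
  · intro i
    have : G i ≤ S := Finset.single_le_sum (f := G) (fun _ _ => norm_nonneg _) (Finset.mem_univ i)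
    have e : (3 * C + 3 * C ^ 2) * ‖weakLaplacian h‖ =
      3 * C * ‖weakLaplacian h‖ + 3 * (C ^ 2 * ‖weakLaplacian h‖) := by ring
    rw [e]
    change G i ≤ _
    linarith

theorem index_of_sum_le_two {β : Fin 3 → ℕ} (hβ : ∑ i, β i ≤ 2) :
    β = 0 ∨ (∃ i, β = Pi.single i 1) ∨ ∃ i j, β = Pi.single i 1 + Pi.single j 1 := by
  rcases Finset.eq_empty_or_nonempty (Finset.univ.filter fun i => β i ≠ 0) with h | ⟨i, hi⟩
  · left
    funext i
    by_contra hne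
    have : i ∈ Finset.univ.filter fun i => β i ≠ 0 := by simpa using hne
    simp [h] at this
  · right
    have hi0 : β i ≠ 0 := by simpa using hi
    obtain ⟨γ, hγ⟩ : ∃ γ : Fin 3 → ℕ, β = Pi.single i 1 + γ := by
      refine ⟨fun k => if k = i then β k - 1 else β k, ?_⟩
      funext k
      by_cases hk : k = i
      · subst hk; simp; omega
      · simp [hk]
    subst hγ
    simp only [Pi.add_apply, Finset.sum_add_distrib] at hβ
    rcases Finset.eq_empty_or_nonempty (Finset.univ.filter fun i => γ i ≠ 0) with h | ⟨j, hj⟩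
    · left
      refine ⟨i, ?_⟩
      have : γ = 0 := by
        funext k
        by_contra hne
        have : k ∈ Finset.univ.filter fun i => γ i ≠ 0 := by simpa using hne
        simp [h] at this
      rw [this, add_zero]
    · right
      refine ⟨i, j, ?_⟩
      congr 1
      have hj0 : γ j ≠ 0 := by simpa using hj
      have hs : ∑ k, γ k ≤ 1 := by
        have : ∑ k, (Pi.single i 1 : Fin 3 → ℕ) k = 1 := by simp
        omega
      have hsplit := Finset.add_sum_erase Finset.univ γ (Finset.mem_univ j)
      funext k
      by_cases hk : k = j
      · subst hk; simp; omega
      · have : γ k ≤ ∑ x ∈ Finset.univ.erase j, γ x :=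
          Finset.single_le_sum (f := γ) (fun _ _ => Nat.zero_le _) (by simp [hk])
        simp [hk]; omega

theorem le_sum_sum (a : Fin 3 → Fin 3 → ℝ) (ha : ∀ i j, 0 ≤ a i j) (i j : Fin 3) :
    a i j ≤ ∑ i, ∑ j, a i j :=
  (Finset.single_le_sum (f := a i) (fun j _ => ha i j) (Finset.mem_univ j)).trans
    (Finset.single_le_sum (f := fun i => ∑ j, a i j)
      (fun i _ => Finset.sum_nonneg fun j _ => ha i j) (Finset.mem_univ i))

theorem norm_weakD_mixed_le (hΩ : Ω = box l r) (hl : ∀ i, l i < 0) (hr : ∀ i, 0 < r i)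
    {h : L2 Ω} (hh : h ∈ sobolev Ω 3) (h0 : HasBoundaryValues h (frontier Ω) fun _ => 0)
    (i j : Fin 3) : ‖(weakD (Pi.single i 1 + Pi.single j 1) h : L2 Ω)‖ ≤ ‖weakLaplacian h‖ := by
  have h1 := norm_sq_weakLaplacian hΩ hl hr hh h0
  have h2 := le_sum_sum (fun i j => ‖(weakD (Pi.single i 1 + Pi.single j 1) h : L2 Ω)‖ ^ 2)
    (fun _ _ => sq_nonneg _) i j
  refine (pow_le_pow_iff_left₀ (norm_nonneg _) (norm_nonneg _) two_ne_zero).1 ?_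
  exact h2.trans_eq h1.symm

/-- The a priori estimate `‖h‖_{H²} ≤ K ‖Δh‖` for `h` vanishing on the boundary of the box. -/
theorem exists_sobolevNorm_two_le (hΩ : Ω = box l r) (hl : ∀ i, l i < 0) (hr : ∀ i, 0 < r i) :
    ∃ K : ℝ, 0 ≤ K ∧ ∀ h ∈ sobolev Ω 3, HasBoundaryValues h (frontier Ω) (fun _ => 0) →
      sobolevNorm 2 h ≤ K * ‖weakLaplacian h‖ := by
  have ho : IsOpen Ω := hΩ ▸ isOpen_box l r
  obtain ⟨K, hK0, hK⟩ := exists_norm_le_weakLaplacian hΩ hl hr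
  -- Derivatives of order at most one are controlled with the factor `K`, those of order two with
  -- the factor 1.
  refine ⟨(multiIndices 2).card * (K + 1), by positivity, fun h hh h0 => ?_⟩
  obtain ⟨b0, b1⟩ := hK h hh h0
  have hL0 : 0 ≤ ‖weakLaplacian h‖ := norm_nonneg _
  have hKL : K * ‖weakLaplacian h‖ ≤ (K + 1) * ‖weakLaplacian h‖ := by nlinarith
  have hall : ∀ β ∈ multiIndices 2, ‖(weakD β h : L2 Ω)‖ ≤ (K + 1) * ‖weakLaplacian h‖ := by
    intro β hβ
    rcases index_of_sum_le_two (mem_multiIndices.1 hβ) with rfl | ⟨i, rfl⟩ | ⟨i, j, rfl⟩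
    · rw [weakD_zero_index ho]; exact b0.trans hKL
    · exact (b1 i).trans hKL
    · refine (norm_weakD_mixed_le hΩ hl hr hh h0 i j).trans ?_
      linarith [mul_nonneg hK0 hL0]
  calc sobolevNorm 2 h ≤ ∑ β ∈ multiIndices 2, ‖(weakD β h : L2 Ω)‖ := by
        refine Real.sqrt_le_iff.2 ⟨Finset.sum_nonneg fun _ _ => norm_nonneg _, ?_⟩
        exact Finset.sum_sq_le_sq_sum_of_nonneg fun _ _ => norm_nonneg _
    _ ≤ (multiIndices 2).card • ((K + 1) * ‖weakLaplacian h‖) := Finset.sum_le_card_nsmul _ _ _ hall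
    _ = _ := by rw [nsmul_eq_mul]; ring

end APriori

end QuasiReversibility
end

noncomputable section
namespace QuasiReversibility
open scoped ENNReal

/-! ### Boundary values and weak derivatives under sums and limits -/

section BoundaryValues

variable {Ω : Set E3}

theorem HasBoundaryValues.add {u v : L2 Ω} {A : Set E3} {ψ χ : E3 → ℂ}
    (hu : HasBoundaryValues u A ψ) (hv : HasBoundaryValues v A χ) :
    HasBoundaryValues (u + v) A (fun p => ψ p + χ p) := by
  obtain ⟨f, f1, f2, f3⟩ := hu
  obtain ⟨g, g1, g2, g3⟩ := hv
  refine ⟨fun p => f p + g p, f1.add g1, ?_, fun p hp => by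
    simp only [f3 p hp, g3 p hp]⟩
  filter_upwards [f2, g2, Lp.coeFn_add u v] with p h1 h2 h3
  rw [h3, Pi.add_apply, h1, h2]

theorem HasBoundaryValues.smul {u : L2 Ω} {A : Set E3} {ψ : E3 → ℂ} (c : ℂ)
    (hu : HasBoundaryValues u A ψ) : HasBoundaryValues (c • u) A (fun p => c * ψ p) := by
  obtain ⟨f, f1, f2, f3⟩ := hu
  refine ⟨fun p => c * f p, continuousOn_const.mul f1, ?_, fun p hp => by
    simp only [f3 p hp]⟩
  filter_upwards [f2, Lp.coeFn_smul c u] with p h1 h2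
  rw [h2, Pi.smul_apply, h1, smul_eq_mul]

theorem HasBoundaryValues.zero (A : Set E3) : HasBoundaryValues (0 : L2 Ω) A (fun _ => 0) :=
  ⟨fun _ => 0, continuousOn_const, (Lp.coeFn_zero ℂ 2 (volume.restrict Ω)).symm, fun _ _ => rfl⟩

theorem HasBoundaryValues.sub_eq_zero {u v : L2 Ω} {A : Set E3} {ψ : E3 → ℂ}
    (hu : HasBoundaryValues u A ψ) (hv : HasBoundaryValues v A ψ) :
    HasBoundaryValues (u - v) A (fun _ => 0) := by
  have h := hu.add (hv.smul (-1))
  rw [neg_one_smul, ← sub_eq_add_neg] at h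
  simpa using h

/-- The two witnesses are the same function on the closure, since a continuous representative on an
open set is unique and extends uniquely. -/
theorem HasBoundaryValues.union (ho : IsOpen Ω) {u : L2 Ω} {A B : Set E3} {ψ : E3 → ℂ}
    (hA : A ⊆ closure Ω) (h1 : HasBoundaryValues u A ψ)
    (h2 : HasBoundaryValues u B ψ) : HasBoundaryValues u (A ∪ B) ψ := by
  obtain ⟨f, f1, f2, f3⟩ := h1
  obtain ⟨g, g1, g2, g3⟩ := h2
  have heq := eqOn_closure_of_ae_eq ho f1 g1 (f2.trans g2.symm)
  refine ⟨g, g1, g2, fun p hp => ?_⟩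
  rcases hp with hp | hp
  · rw [← heq (hA hp), f3 p hp]
  · exact g3 p hp

/-- Vanishing boundary values persist under limits that are dominated up to the boundary. -/
theorem HasBoundaryValues.of_tendsto (ho : IsOpen Ω) {A : Set E3} (hA : A ⊆ closure Ω)
    {u : L2 Ω} {v : ℕ → L2 Ω} {f : E3 → ℂ} (hf : ContinuousOn f (closure Ω))
    (hfu : f =ᵐ[volume.restrict Ω] u) {φ : ℕ → E3 → ℂ} (hφ : ∀ n, ContinuousOn (φ n) (closure Ω))
    (hφv : ∀ n, φ n =ᵐ[volume.restrict Ω] (v n - u : L2 Ω)) {ε : ℕ → ℝ}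
    (hε : Tendsto ε atTop (𝓝 0)) (hφε : ∀ n, ∀ p ∈ closure Ω, ‖φ n p‖ ≤ ε n)
    (hv : ∀ n, HasBoundaryValues (v n) A (fun _ => 0)) :
    HasBoundaryValues u A (fun _ => 0) := by
  refine ⟨f, hf, hfu, fun p hp => ?_⟩
  have hb : ∀ n, ‖f p‖ ≤ ε n := by
    intro n
    obtain ⟨g, g1, g2, g3⟩ := hv n
    -- The representative of `v n` is `f + φ n` up to the boundary, so where it vanishes `f` equals
    -- `-φ n`.
    have heq := eqOn_closure_of_ae_eq ho g1 (hf.add (hφ n)) (by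
      filter_upwards [g2, hfu, hφv n, Lp.coeFn_sub (v n) u] with q h1 h2 h3 h4
      rw [Pi.add_apply, h1, h2, h3, h4, Pi.sub_apply]
      ring)
    have h0 := heq (hA hp)
    rw [g3 p hp, Pi.add_apply] at h0
    have : f p = -φ n p := by linear_combination -h0
    rw [this, norm_neg]
    exact hφε n p (hA hp)
  have h1 := ge_of_tendsto' hε hb
  exact norm_eq_zero.1 (le_antisymm h1 (norm_nonneg _))

theorem integral_smul_eq_inner (hm : MeasurableSet Ω) {φ : E3 → ℝ} (h1 : Continuous φ)
    (h2 : HasCompactSupport φ) (u : L2 Ω) :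
    ∫ p in Ω, φ p • u p =
      inner ℂ (ccLp Ω (fun p => (φ p : ℂ)) (Complex.continuous_ofReal.comp h1)
        (h2.comp_left Complex.ofReal_zero)) u := by
  rw [inner_ccLp hm, ← integral_smul_zext hm]
  simp

/-- For a fixed test function both sides of the defining identity are inner products with fixed
elements of L², hence continuous. -/
theorem IsWeakDeriv.of_tendsto (hm : MeasurableSet Ω) {β : Fin 3 → ℕ} {u g : L2 Ω}
    {v w : ℕ → L2 Ω} (hv : Tendsto v atTop (𝓝 u)) (hw : Tendsto w atTop (𝓝 g))
    (h : ∀ n, IsWeakDeriv Ω β (v n) (w n)) : IsWeakDeriv Ω β u g := by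
  intro φ h1 h2 h3
  have c1 : Continuous (multiD β φ) := (contDiff_mderiv β h1).continuous
  have c2 : HasCompactSupport (multiD β φ) := hasCompactSupport_mderiv β h2
  have hn := fun n => h n φ h1 h2 h3
  simp only [integral_smul_eq_inner hm c1 c2, integral_smul_eq_inner hm h1.continuous h2] at hn ⊢
  exact tendsto_nhds_unique
    ((tendsto_const_nhds.inner hv).congr hn)
    ((tendsto_const_nhds.inner hw).const_smul ((-1 : ℝ) ^ (∑ i, β i)))

theorem weakLaplacian_add (ho : IsOpen Ω) {u v : L2 Ω} (hu : u ∈ sobolev Ω 3)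
    (hv : v ∈ sobolev Ω 3) : weakLaplacian (u + v) = weakLaplacian u + weakLaplacian v := by
  simp only [weakLaplacian, ← Finset.sum_add_distrib]
  exact Finset.sum_congr rfl fun i _ => weakD_add ho hu hv (by simp)

theorem weakLaplacian_smul (ho : IsOpen Ω) {u : L2 Ω} (hu : u ∈ sobolev Ω 3) (c : ℂ) :
    weakLaplacian (c • u) = c • weakLaplacian u := by
  simp only [weakLaplacian, Finset.smul_sum]
  exact Finset.sum_congr rfl fun i _ => weakD_smul ho hu c (by simp)

theorem weakD_sub (ho : IsOpen Ω) {m : ℕ} {u v : L2 Ω} (hu : u ∈ sobolev Ω m)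
    (hv : v ∈ sobolev Ω m) {β : Fin 3 → ℕ} (hβ : ∑ i, β i ≤ m) :
    weakD β (u - v) = weakD β u - weakD β v := by
  have h := weakD_add ho hu ((sobolev Ω m).smul_mem (-1) hv) hβ
  rw [weakD_smul ho hv _ hβ] at h
  simpa [sub_eq_add_neg] using h

theorem L2_norm_sq (u : L2 Ω) : ‖u‖ ^ 2 = ∫ p in Ω, ‖u p‖ ^ 2 := by
  have h := inner_self_eq_ofReal u
  rw [L2.inner_def] at h
  have h2 : ∫ p in Ω, inner ℂ (u p) (u p) = ((∫ p in Ω, ‖u p‖ ^ 2 : ℝ) : ℂ) := by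
    rw [← integral_complex_ofReal]
    refine integral_congr_ae (Eventually.of_forall fun p => ?_)
    simp only [inner_self_eq_norm_sq_to_K]
    push_cast
    rfl
  rw [h2] at h
  exact_mod_cast h.symm

end BoundaryValues

/-! ### Existence and uniqueness of the minimizer -/

section Minimization

/-- Let `P` be the orthogonal projection of `T q` onto the closed image of `S`. By Pythagoras the
quantity to minimize is `‖T w + P‖²` plus a constant, so the minimizer is the preimage of `-P`,
unique by injectivity. -/
theorem existsUnique_norm_minimizer {X Y : Type*} [AddCommGroup X] [Module ℂ X]
    [NormedAddCommGroup Y] [InnerProductSpace ℂ Y] [CompleteSpace Y] (T : X →ₗ[ℂ] Y)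
    (hT : Function.Injective T) (S : Submodule ℂ X) (hcl : IsClosed ((S.map T : Submodule ℂ Y) : Set Y))
    (q : X) : ∃! w, w ∈ S ∧ ∀ w' ∈ S, ‖T (w + q)‖ ^ 2 ≤ ‖T (w' + q)‖ ^ 2 := by
  set K : Submodule ℂ Y := S.map T
  have : CompleteSpace K := hcl.completeSpace_coe
  set P := K.starProjection (T q) with hP
  have hPK : P ∈ K := K.starProjection_apply_mem (T q)
  have hpyth : ∀ w ∈ S, ‖T (w + q)‖ ^ 2 = ‖T w + P‖ ^ 2 + ‖T q - P‖ ^ 2 := by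
    intro w hw
    have horth : inner ℂ (T w + P) (T q - P) = 0 :=
      (Submodule.mem_orthogonal K _).1 (K.sub_starProjection_mem_orthogonal (T q)) _
        (K.add_mem ⟨w, hw, rfl⟩ hPK)
    have h := norm_add_sq_eq_norm_sq_add_norm_sq_of_inner_eq_zero _ _ horth
    have e : T (w + q) = (T w + P) + (T q - P) := by rw [map_add]; abel
    rw [e, sq, sq, sq, h]
  obtain ⟨w0, hw0, hTw0⟩ := K.neg_mem hPK
  refine ⟨w0, ⟨hw0, fun w' hw' => ?_⟩, fun w hw => hT ?_⟩
  · rw [hpyth w0 hw0, hpyth w' hw', hTw0]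
    simp
  · have h := hw.2 w0 hw0
    rw [hpyth w0 hw0, hpyth w hw.1, hTw0] at h
    simp only [neg_add_cancel, norm_zero] at h
    have h2 : ‖T w + P‖ ^ 2 = 0 := le_antisymm (by linarith) (sq_nonneg _)
    rw [sq_eq_zero_iff, norm_eq_zero] at h2
    rw [hTw0]
    exact eq_neg_of_add_eq_zero_left h2

/-- Multiplication by a bounded function on `L²(Ω)`. -/
theorem exists_mul_clm {Ω : Set E3} (hm : MeasurableSet Ω) {k : E3 → ℝ} (hk : Measurable k)
    {R : ℝ} (hR : ∀ p ∈ Ω, |k p| ≤ R) :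
    ∃ M : L2 Ω →L[ℂ] L2 Ω, ∀ u, ‖M u‖ ^ 2 = ∫ p in Ω, ‖u p‖ ^ 2 * k p ^ 2 := by
  have hmem : MemLp (fun p => (k p : ℂ)) ∞ (volume.restrict Ω) := by
    refine memLp_top_of_bound (Complex.measurable_ofReal.comp hk).aestronglyMeasurable R ?_
    rw [ae_restrict_iff' hm]
    exact Eventually.of_forall fun p hp => by simpa using hR p hp
  refine ⟨(ContinuousLinearMap.mul ℂ ℂ).holderL (volume.restrict Ω) ∞ 2 2 (hmem.toLp _),
    fun u => ?_⟩
  rw [L2_norm_sq]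
  refine integral_congr_ae ?_
  have h1 := (ContinuousLinearMap.mul ℂ ℂ).coeFn_holder (r := 2) (hmem.toLp _) u
  filter_upwards [h1, hmem.coeFn_toLp] with p e1 e2
  change ‖((ContinuousLinearMap.mul ℂ ℂ).holder 2 (hmem.toLp _) u : L2 Ω) p‖ ^ 2 = _
  rw [e1, e2]
  simp [mul_pow, mul_comm]

variable {b d ξ : ℝ}

/-- The lower corner of the domain. -/
def lowerCorner (b ξ : ℝ) : Fin 3 → ℝ := ![-b, -b, -ξ]

/-- The upper corner of the domain. -/
def upperCorner (b d : ℝ) : Fin 3 → ℝ := ![b, b, d]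

theorem domain_eq_box : domain b d ξ = box (lowerCorner b ξ) (upperCorner b d) := by
  ext p
  simp [domain, box, Fin.forall_fin_succ, lowerCorner, upperCorner, abs_lt]

theorem lowerCorner_neg (hb : 0 < b) (hξ : 0 < ξ) (i : Fin 3) : lowerCorner b ξ i < 0 := by
  fin_cases i <;> simp [lowerCorner, hb, hξ]

theorem upperCorner_pos (hb : 0 < b) (hd : 0 < d) (i : Fin 3) : 0 < upperCorner b d i := by
  fin_cases i <;> simp [upperCorner, hb, hd]

theorem isOpen_domain : IsOpen (domain b d ξ) := domain_eq_box ▸ isOpen_box _ _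

theorem backSide_subset_frontier (hd : 0 < d) (hξ : 0 < ξ) :
    backSide b ξ ⊆ frontier (domain b d ξ) := by
  intro p hp
  rw [isOpen_domain.frontier_eq]
  refine ⟨?_, fun hmem => by have := hmem.2.2.1; rw [hp.2.2] at this; exact lt_irrefl _ this⟩
  have hγ : Continuous fun t : ℝ => p + t • EuclideanSpace.single (2 : Fin 3) (1 : ℝ) := by fun_prop
  have htend : Tendsto (fun t : ℝ => p + t • EuclideanSpace.single (2 : Fin 3) (1 : ℝ))
      (𝓝[>] 0) (𝓝 p) := by
    have := hγ.tendsto 0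
    rw [zero_smul, add_zero] at this
    exact this.mono_left nhdsWithin_le_nhds
  refine mem_closure_of_tendsto htend ?_
  filter_upwards [Ioo_mem_nhdsGT (show (0 : ℝ) < d + ξ by linarith)] with t ht
  have h2 := hp.2.2
  refine ⟨by simpa using hp.1, by simpa using hp.2.1, ?_, ?_⟩
  · simp [h2, ht.1]
  · have := ht.2
    simp [h2]; linarith

/-- `H³₀(Ω)` as a subspace. -/
def H30Submodule (b d ξ : ℝ) : Submodule ℂ (sobolev (domain b d ξ) 3) where
  carrier := H30 b d ξ
  zero_mem' := by
    refine ⟨HasBoundaryValues.zero _, ?_⟩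
    have : weakDz (0 : L2 (domain b d ξ)) = 0 := weakD_eq isOpen_domain (IsWeakDeriv.zero _)
    change HasBoundaryValues (weakDz (0 : L2 (domain b d ξ))) _ _
    rw [this]
    exact HasBoundaryValues.zero _
  add_mem' := by
    intro u v hu hv
    refine ⟨by simpa using hu.1.add hv.1, ?_⟩
    have : weakDz ((u + v : sobolev (domain b d ξ) 3) : L2 (domain b d ξ)) =
        weakDz (u : L2 (domain b d ξ)) + weakDz (v : L2 (domain b d ξ)) :=
      weakD_add isOpen_domain u.2 v.2 (by simp)
    rw [this]
    simpa using hu.2.add hv.2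
  smul_mem' := by
    intro c u hu
    refine ⟨by simpa using hu.1.smul c, ?_⟩
    have : weakDz ((c • u : sobolev (domain b d ξ) 3) : L2 (domain b d ξ)) =
        c • weakDz (u : L2 (domain b d ξ)) :=
      weakD_smul isOpen_domain u.2 c (by simp)
    rw [this]
    simpa using hu.2.smul c

/-- The multi-indices of order at most three. -/
abbrev Idx : Type := {β : Fin 3 → ℕ // β ∈ multiIndices 3}

/-- The linear map `V ↦ (M ΔV, √α D^β V)` whose squared norm is the functional. -/
def tailMap (M : L2 (domain b d ξ) →L[ℂ] L2 (domain b d ξ)) (α : ℝ) :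
    sobolev (domain b d ξ) 3 →ₗ[ℂ] PiLp 2 (fun _ : Option Idx => L2 (domain b d ξ)) where
  toFun V := WithLp.toLp 2 fun k => k.elim (M (weakLaplacian (V : L2 (domain b d ξ))))
    fun β => ((Real.sqrt α : ℝ) : ℂ) • weakD β.1 (V : L2 (domain b d ξ))
  map_add' u v := by
    ext k : 1
    rcases k with _ | β
    · simp [weakLaplacian_add isOpen_domain u.2 v.2]
    · change ((Real.sqrt α : ℝ) : ℂ) • weakD β.1 ((u : L2 (domain b d ξ)) + (v : L2 (domain b d ξ))) =
        ((Real.sqrt α : ℝ) : ℂ) • weakD β.1 (u : L2 (domain b d ξ)) +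
          ((Real.sqrt α : ℝ) : ℂ) • weakD β.1 (v : L2 (domain b d ξ))
      rw [weakD_add isOpen_domain u.2 v.2 (mem_multiIndices.1 β.2), smul_add]
  map_smul' c u := by
    ext k : 1
    rcases k with _ | β
    · simp [weakLaplacian_smul isOpen_domain u.2]
    · change ((Real.sqrt α : ℝ) : ℂ) • weakD β.1 (c • (u : L2 (domain b d ξ))) =
        c • ((Real.sqrt α : ℝ) : ℂ) • weakD β.1 (u : L2 (domain b d ξ))
      rw [weakD_smul isOpen_domain u.2 c (mem_multiIndices.1 β.2), smul_comm]

variable (M : L2 (domain b d ξ) →L[ℂ] L2 (domain b d ξ)) {α : ℝ}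

theorem norm_sq_tailMap (hα : 0 < α) (V : sobolev (domain b d ξ) 3) :
    ‖tailMap M α V‖ ^ 2 = ‖M (weakLaplacian (V : L2 (domain b d ξ)))‖ ^ 2 +
      α * sobolevNorm 3 (V : L2 (domain b d ξ)) ^ 2 := by
  rw [PiLp.norm_sq_eq_of_L2, Fintype.sum_option, sobolevNorm_sq, Finset.mul_sum,
    ← Finset.sum_coe_sort (multiIndices 3)
      (fun β => α * ‖weakD β (V : L2 (domain b d ξ))‖ ^ 2)]
  congr 1
  refine Finset.sum_congr rfl fun β _ => ?_
  change ‖((Real.sqrt α : ℝ) : ℂ) • weakD β.1 (V : L2 (domain b d ξ))‖ ^ 2 = _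
  rw [norm_smul, mul_pow, Complex.norm_real, Real.norm_eq_abs, sq_abs, Real.sq_sqrt hα.le]

theorem tailMap_injective (hα : 0 < α) : Function.Injective (tailMap M α) := by
  intro u v huv
  have h := congrArg (fun y : PiLp 2 (fun _ : Option Idx => L2 (domain b d ξ)) =>
    y (some ⟨0, mem_multiIndices.2 (by simp)⟩)) huv
  change ((Real.sqrt α : ℝ) : ℂ) • weakD 0 (u : L2 (domain b d ξ)) =
    ((Real.sqrt α : ℝ) : ℂ) • weakD 0 (v : L2 (domain b d ξ)) at h
  have hne : ((Real.sqrt α : ℝ) : ℂ) ≠ 0 := by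
    exact_mod_cast (Real.sqrt_pos.2 hα).ne'
  have h2 := smul_right_injective _ hne h
  rw [weakD_zero_index isOpen_domain, weakD_zero_index isOpen_domain] at h2
  exact Subtype.ext h2

/-- By the C¹ embedding, convergence in H³ is uniform up to the boundary for the function and its
first derivatives, so both vanishing conditions persist. -/
theorem H30_closed (hb : 0 < b) (hd : 0 < d) (hξ : 0 < ξ) {u : sobolev (domain b d ξ) 3}
    {v : ℕ → sobolev (domain b d ξ) 3} (hv : ∀ n, v n ∈ H30 b d ξ)
    (hlim : ∀ β ∈ multiIndices 3, Tendsto (fun n => weakD β (v n : L2 (domain b d ξ))) atTop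
      (𝓝 (weakD β (u : L2 (domain b d ξ))))) : u ∈ H30 b d ξ := by
  obtain ⟨C, hC, hE⟩ := exists_c1_representative (domain_eq_box (b := b) (d := d) (ξ := ξ))
    (lowerCorner_neg hb hξ) (upperCorner_pos hb hd)
  obtain ⟨f, g, hfc, hfae, -, hgc, hgae, -, -, -⟩ := hE u u.2
  have hEn := fun n => hE ((v n - u : sobolev (domain b d ξ) 3) : L2 (domain b d ξ)) (v n - u).2
  choose φ γ hφc hφae hφb hγc hγae hγb _ _ using hEn
  have hε : Tendsto (fun n => C * sobolevNorm 3
      ((v n - u : sobolev (domain b d ξ) 3) : L2 (domain b d ξ))) atTop (𝓝 0) := by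
    have h1 : Tendsto (fun n => Real.sqrt (∑ β ∈ multiIndices 3,
        ‖weakD β ((v n - u : sobolev (domain b d ξ) 3) : L2 (domain b d ξ))‖ ^ 2)) atTop
        (𝓝 (Real.sqrt (∑ _β ∈ multiIndices 3, 0))) := by
      refine (Real.continuous_sqrt.tendsto _).comp (tendsto_finsetSum _ fun β hβ => ?_)
      have h2 := (tendsto_iff_norm_sub_tendsto_zero.1 (hlim β hβ)).pow 2
      rw [zero_pow two_ne_zero] at h2
      refine h2.congr fun n => ?_
      rw [← weakD_sub isOpen_domain (v n).2 u.2 (mem_multiIndices.1 hβ)]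
      rfl
    have h3 := h1.const_mul C
    simp only [Finset.sum_const_zero, Real.sqrt_zero, mul_zero] at h3
    exact h3
  have hAf : frontier (domain b d ξ) ⊆ closure (domain b d ξ) := frontier_subset_closure
  refine ⟨HasBoundaryValues.of_tendsto isOpen_domain hAf (v := fun n => (v n : L2 (domain b d ξ)))
    hfc hfae hφc hφae hε hφb fun n => (hv n).1, ?_⟩
  refine HasBoundaryValues.of_tendsto isOpen_domain ((backSide_subset_frontier hd hξ).trans hAf)
    (v := fun n => weakDz (v n : L2 (domain b d ξ)))
    (hgc 2) (hgae 2) (φ := fun n => γ n 2) (fun n => hγc n 2) (fun n => ?_) hε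
    (fun n => hγb n 2) fun n => (hv n).2
  have e : weakDz (v n : L2 (domain b d ξ)) - weakDz (u : L2 (domain b d ξ)) =
      weakD (Pi.single 2 1) ((v n - u : sobolev (domain b d ξ) 3) : L2 (domain b d ξ)) :=
    (weakD_sub isOpen_domain (v n).2 u.2 (by simp)).symm
  rw [e]
  exact hγae n 2

/-- Positivity of `α` makes every derivative a recoverable coordinate, so convergence of the images
forces H³ convergence. Weak derivatives and boundary conditions are both closed under it, and the
remaining coordinate follows by continuity of `M`. -/
theorem isClosed_tailMap_H30 (hb : 0 < b) (hd : 0 < d) (hξ : 0 < ξ) (hα : 0 < α) :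
    IsClosed (((H30Submodule b d ξ).map (tailMap M α) : Submodule ℂ _) :
      Set (PiLp 2 (fun _ : Option Idx => L2 (domain b d ξ)))) := by
  refine isClosed_of_closure_subset fun y hy => ?_
  obtain ⟨x, hx, hxy⟩ := mem_closure_iff_seq_limit.1 hy
  choose v hv hvx using hx
  have hne : ((Real.sqrt α : ℝ) : ℂ) ≠ 0 := by
    exact_mod_cast (Real.sqrt_pos.2 hα).ne'
  have hcomp : ∀ k, Tendsto (fun n => x n k) atTop (𝓝 (y k)) := fun k =>
    ((PiLp.continuous_apply 2 (fun _ : Option Idx => L2 (domain b d ξ)) k).tendsto y).comp hxy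
  set g : (Fin 3 → ℕ) → L2 (domain b d ξ) := fun β =>
    if h : β ∈ multiIndices 3 then (((Real.sqrt α : ℝ) : ℂ))⁻¹ • y (some ⟨β, h⟩) else 0 with hg
  have hlim : ∀ β ∈ multiIndices 3,
      Tendsto (fun n => weakD β (v n : L2 (domain b d ξ))) atTop (𝓝 (g β)) := by
    intro β hβ
    have h1 := (hcomp (some ⟨β, hβ⟩)).const_smul (((Real.sqrt α : ℝ) : ℂ))⁻¹
    have h2 : g β = (((Real.sqrt α : ℝ) : ℂ))⁻¹ • y (some ⟨β, hβ⟩) := by simp [hg, hβ]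
    rw [h2]
    refine h1.congr fun n => ?_
    rw [← hvx n]
    change (((Real.sqrt α : ℝ) : ℂ))⁻¹ • ((Real.sqrt α : ℝ) : ℂ) • weakD β _ = _
    rw [inv_smul_smul₀ hne]
  have h0 := hlim 0 (mem_multiIndices.2 (by simp))
  simp only [weakD_zero_index isOpen_domain] at h0
  have hwd : ∀ β ∈ multiIndices 3, IsWeakDeriv (domain b d ξ) β (g 0) (g β) := fun β hβ =>
    IsWeakDeriv.of_tendsto isOpen_domain.measurableSet h0 (hlim β hβ) fun n =>
      isWeakDeriv_weakD (v n).2 (mem_multiIndices.1 hβ)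
  set u : sobolev (domain b d ξ) 3 := ⟨g 0, fun β hβ => ⟨g β, hwd β (mem_multiIndices.2 hβ)⟩⟩
  have hgu : ∀ β ∈ multiIndices 3, weakD β (u : L2 (domain b d ξ)) = g β := fun β hβ =>
    weakD_eq isOpen_domain (hwd β hβ)
  have hlim' : ∀ β ∈ multiIndices 3, Tendsto (fun n => weakD β (v n : L2 (domain b d ξ))) atTop
      (𝓝 (weakD β (u : L2 (domain b d ξ)))) := fun β hβ => by
    rw [hgu β hβ]; exact hlim β hβ
  refine ⟨u, H30_closed hb hd hξ hv hlim', ?_⟩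
  ext k : 1
  rcases k with _ | β
  · have h1 : Tendsto (fun n => M (weakLaplacian (v n : L2 (domain b d ξ)))) atTop
        (𝓝 (M (weakLaplacian (u : L2 (domain b d ξ))))) := by
      refine (M.continuous.tendsto _).comp (tendsto_finsetSum _ fun i _ => ?_)
      exact hlim' _ (mem_multiIndices.2 (by simp))
    refine tendsto_nhds_unique (h1.congr fun n => ?_) (hcomp none)
    rw [← hvx n]
    rfl
  · change ((Real.sqrt α : ℝ) : ℂ) • weakD β.1 (u : L2 (domain b d ξ)) = _
    rw [hgu β.1 β.2]
    simp only [hg, β.2, dif_pos]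
    rw [smul_inv_smul₀ hne]

theorem carlemanWeight_le {s ν μ z : ℝ} (hs : ξ < s) (hν : 0 ≤ ν) (hμ : 0 ≤ μ) (hz : -ξ < z) :
    carlemanWeight s ν μ z ≤ Real.exp (2 * μ * (s - ξ) ^ (-ν)) := by
  refine Real.exp_le_exp.2 ?_
  have : (z + s) ^ (-ν) ≤ (s - ξ) ^ (-ν) :=
    Real.rpow_le_rpow_of_nonpos (by linarith) (by linarith) (by linarith)
  gcongr

theorem le_carlemanWeight {s ν μ z : ℝ} (hs : ξ < s) (hν : 0 ≤ ν) (hμ : 0 ≤ μ) (hz : -ξ < z)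
    (hzd : z < d) : Real.exp (2 * μ * (s + d) ^ (-ν)) ≤ carlemanWeight s ν μ z := by
  refine Real.exp_le_exp.2 ?_
  have : (s + d) ^ (-ν) ≤ (z + s) ^ (-ν) :=
    Real.rpow_le_rpow_of_nonpos (by linarith) (by linarith) (by linarith)
  gcongr

theorem measurable_carlemanWeight (s ν μ : ℝ) : Measurable (carlemanWeight s ν μ) :=
  Real.measurable_exp.comp (measurable_const.mul ((measurable_id.add_const s).pow_const (-ν)))

theorem existsUnique_tailMinimizer (hb : 0 < b) (hd : 0 < d) (hξ : 0 < ξ) {s μ ν : ℝ}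
    (hs : ξ < s) (hμ : 0 < μ) (hν : 0 < ν) (hα : 0 < α) (Q : sobolev (domain b d ξ) 3) :
    ∃! W : sobolev (domain b d ξ) 3, IsTailMinimizer b d ξ s μ ν α Q W := by
  set e := Real.exp (-2 * μ * (s + d) ^ (-ν)) with he
  -- Multiplication by the square root of the normalised weight turns the weighted integral into a
  -- plain L² norm.
  set k : E3 → ℝ := fun p => Real.sqrt (e * carlemanWeight s ν μ (p 2)) with hk
  have hkm : Measurable k :=
    (((measurable_carlemanWeight s ν μ).comp
      (by fun_prop : Measurable fun p : E3 => p 2)).const_mul e).sqrt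
  obtain ⟨M, hM⟩ := exists_mul_clm (isOpen_domain (b := b) (d := d) (ξ := ξ)).measurableSet hkm
    (R := Real.sqrt (e * Real.exp (2 * μ * (s - ξ) ^ (-ν)))) (fun p hp => by
      rw [hk, abs_of_nonneg (Real.sqrt_nonneg _)]
      refine Real.sqrt_le_sqrt ?_
      have := carlemanWeight_le hs hν.le hμ.le hp.2.2.1
      gcongr)
  have hI : ∀ V : sobolev (domain b d ξ) 3,
      ‖tailMap M α V‖ ^ 2 = tailFunctional b d ξ s μ ν α V := by
    intro V
    rw [norm_sq_tailMap M hα, hM, tailFunctional, ← integral_const_mul]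
    congr 1
    refine integral_congr_ae (Eventually.of_forall fun p => ?_)
    simp only [hk]
    rw [Real.sq_sqrt (by rw [he, carlemanWeight]; positivity)]
    ring
  have h := existsUnique_norm_minimizer (tailMap M α) (tailMap_injective M hα)
    (H30Submodule b d ξ) (isClosed_tailMap_H30 M hb hd hξ hα) Q
  simp only [hI] at h
  exact h

end Minimization

end QuasiReversibility
end

noncomputable section
namespace QuasiReversibility

/-! ### Comparison of Sobolev and C¹ norms -/

section Norms

variable {Ω : Set E3} {m : ℕ}

theorem sobolevNorm_eq_norm (m : ℕ) (u : L2 Ω) : sobolevNorm m u =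
    ‖(WithLp.toLp 2 fun β : {β // β ∈ multiIndices m} => weakD β.1 u :
      PiLp 2 fun _ : {β // β ∈ multiIndices m} => L2 Ω)‖ := by
  rw [PiLp.norm_eq_of_L2, sobolevNorm,
    ← Finset.sum_coe_sort (multiIndices m) (fun β => ‖weakD β u‖ ^ 2)]

theorem sobolevNorm_add_le (ho : IsOpen Ω) {u v : L2 Ω} (hu : u ∈ sobolev Ω m)
    (hv : v ∈ sobolev Ω m) : sobolevNorm m (u + v) ≤ sobolevNorm m u + sobolevNorm m v := by
  simp only [sobolevNorm_eq_norm]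
  refine le_trans (le_of_eq ?_) (norm_add_le _ _)
  congr 1
  ext β : 1
  exact weakD_add ho hu hv (mem_multiIndices.1 β.2)

theorem sobolevNorm_mono {k : ℕ} (h : k ≤ m) (u : L2 Ω) : sobolevNorm k u ≤ sobolevNorm m u :=
  Real.sqrt_le_sqrt (Finset.sum_le_sum_of_subset_of_nonneg
    (fun _ hβ => mem_multiIndices.2 ((mem_multiIndices.1 hβ).trans h)) fun _ _ _ => sq_nonneg _)

theorem norm_weakLaplacian_le (u : L2 Ω) : ‖weakLaplacian u‖ ≤ 3 * sobolevNorm 3 u := by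
  refine (norm_sum_le _ _).trans ?_
  refine (Finset.sum_le_sum fun i _ => norm_weakD_le_sobolevNorm (m := 3)
    (by simp : ∑ j, (Pi.single i 2 : Fin 3 → ℕ) j ≤ 3) u).trans ?_
  simp

theorem c1Norm_le [Nonempty Ω] {f : E3 → ℂ} {R : ℝ} (hf : ∀ p ∈ Ω, ‖f p‖ ≤ R)
    (hd : ∀ i, ∀ p ∈ Ω, ‖partialD i f p‖ ≤ R) : c1Norm Ω f ≤ 4 * R := by
  have h1 : (⨆ p : Ω, ‖f p‖) ≤ R := ciSup_le fun p => hf p p.2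
  have h2 : ∑ i : Fin 3, (⨆ p : Ω, ‖partialD i f p‖) ≤ ∑ _i : Fin 3, R :=
    Finset.sum_le_sum fun i _ => ciSup_le fun p => hd i p p.2
  rw [Finset.sum_const, Finset.card_univ, Fintype.card_fin] at h2
  rw [c1Norm]
  simp only [nsmul_eq_mul, Nat.cast_ofNat] at h2
  linarith

end Norms

/-! ### Two-sided bounds on the functional and the choice of parameters -/

section Functional

variable {b d ξ s μ ν α : ℝ}

theorem integrable_norm_sq {Ω : Set E3} (u : L2 Ω) :
    Integrable (fun p => ‖u p‖ ^ 2) (volume.restrict Ω) := by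
  simpa using (Lp.memLp u).integrable_norm_pow two_ne_zero

theorem integrable_norm_sq_mul_carlemanWeight (hs : ξ < s) (hν : 0 ≤ ν) (hμ : 0 ≤ μ)
    (u : L2 (domain b d ξ)) :
    Integrable (fun p => ‖u p‖ ^ 2 * carlemanWeight s ν μ (p 2))
      (volume.restrict (domain b d ξ)) := by
  refine (integrable_norm_sq u).mul_bdd (c := Real.exp (2 * μ * (s - ξ) ^ (-ν)))
    ((measurable_carlemanWeight s ν μ).comp
      (by fun_prop : Measurable fun p : E3 => p 2)).aestronglyMeasurable ?_
  rw [ae_restrict_iff' isOpen_domain.measurableSet]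
  refine Eventually.of_forall fun p hp => ?_
  rw [carlemanWeight, Real.norm_of_nonneg (Real.exp_pos _).le]
  exact carlemanWeight_le hs hν hμ hp.2.2.1

/-- The weight decreases in `z`, so its value at the top face `z = d` is the minimum and normalising
by it leaves a weight at least 1. -/
theorem le_tailFunctional (hs : ξ < s) (hν : 0 ≤ ν) (hμ : 0 ≤ μ)
    (V : sobolev (domain b d ξ) 3) :
    ‖weakLaplacian (V : L2 (domain b d ξ))‖ ^ 2 + α * sobolevNorm 3 (V : L2 (domain b d ξ)) ^ 2 ≤
      tailFunctional b d ξ s μ ν α V := by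
  rw [tailFunctional, L2_norm_sq, ← integral_const_mul]
  refine add_le_add_left (setIntegral_mono_on (integrable_norm_sq _)
    ((integrable_norm_sq_mul_carlemanWeight hs hν hμ _).const_mul _)
    isOpen_domain.measurableSet fun p hp => ?_) _
  have h1 := mul_le_mul_of_nonneg_left (le_carlemanWeight hs hν hμ hp.2.2.1 hp.2.2.2)
    (Real.exp_pos (-2 * μ * (s + d) ^ (-ν))).le
  rw [← Real.exp_add, show -2 * μ * (s + d) ^ (-ν) + 2 * μ * (s + d) ^ (-ν) = 0 by ring,
    Real.exp_zero] at h1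
  refine (le_mul_of_one_le_right
    (sq_nonneg ‖(weakLaplacian (V : L2 (domain b d ξ)) : L2 (domain b d ξ)) p‖) h1).trans
    (le_of_eq ?_)
  ring

/-- The weight is largest at the bottom face `z = -ξ`, where its normalised value is `exp(2μ t_ν)`.
-/
theorem tailFunctional_le (hs : ξ < s) (hν : 0 ≤ ν) (hμ : 0 ≤ μ)
    (V : sobolev (domain b d ξ) 3) :
    tailFunctional b d ξ s μ ν α V ≤ Real.exp (2 * μ * tNu d ξ s ν) *
        ‖weakLaplacian (V : L2 (domain b d ξ))‖ ^ 2 +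
      α * sobolevNorm 3 (V : L2 (domain b d ξ)) ^ 2 := by
  rw [tailFunctional, L2_norm_sq, ← integral_const_mul, ← integral_const_mul]
  refine add_le_add_left (setIntegral_mono_on
    ((integrable_norm_sq_mul_carlemanWeight hs hν hμ _).const_mul _)
    ((integrable_norm_sq _).const_mul _) isOpen_domain.measurableSet fun p hp => ?_) _
  have h1 := mul_le_mul_of_nonneg_left (carlemanWeight_le hs hν hμ hp.2.2.1)
    (Real.exp_pos (-2 * μ * (s + d) ^ (-ν))).le
  rw [← Real.exp_add, show -2 * μ * (s + d) ^ (-ν) + 2 * μ * (s - ξ) ^ (-ν) =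
    2 * μ * tNu d ξ s ν by rw [tNu]; ring] at h1
  refine le_trans (le_of_eq ?_) (mul_le_mul_of_nonneg_right h1
    (sq_nonneg ‖(weakLaplacian (V : L2 (domain b d ξ)) : L2 (domain b d ξ)) p‖))
  ring

theorem tNu_pos (hd : 0 < d) (hξ : 0 < ξ) (hs : ξ < s) (hν : 0 < ν) : 0 < tNu d ξ s ν :=
  sub_pos.2 (Real.rpow_lt_rpow_of_neg (by linarith) (by linarith) (by linarith))

/-- This is the purpose of the choice of μ(δ): the maximal amplification by the weight becomes
exactly 1/δ. -/
theorem muOf_mul_tNu {δ : ℝ} (hδ : 0 < δ) (ht : tNu d ξ s ν ≠ 0) :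
    2 * muOf d ξ s ν δ * tNu d ξ s ν = -Real.log δ := by
  rw [muOf, Real.log_rpow hδ]
  field_simp

theorem lt_muOf {δ l : ℝ} (hδ : 0 < δ) (ht : 0 < tNu d ξ s ν)
    (h : δ < Real.exp (-2 * l * tNu d ξ s ν)) : l < muOf d ξ s ν δ := by
  have h1 := (Real.log_lt_iff_lt_exp hδ).2 h
  have h2 := muOf_mul_tNu hδ ht.ne'
  by_contra hc
  have := mul_le_mul_of_nonneg_right (not_lt.1 hc) ht.le
  linarith

/-- The Dirichlet data cancel on Γ and on the rest of the boundary separately; the two parts are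
glued by `HasBoundaryValues.union`. -/
theorem BoundaryConditions.sub_mem_H30 (hd : 0 < d) (hξ : 0 < ξ) {ψ₀ ψ₁ : E3 → ℂ}
    {u v : sobolev (domain b d ξ) 3}
    (hu : BoundaryConditions b d ξ ψ₀ ψ₁ (u : L2 (domain b d ξ)))
    (hv : BoundaryConditions b d ξ ψ₀ ψ₁ (v : L2 (domain b d ξ))) : u - v ∈ H30 b d ξ := by
  have hsub := backSide_subset_frontier (b := b) hd hξ
  constructor
  · have h := (hu.dirichlet.sub_eq_zero hv.dirichlet).union isOpen_domain
      (hsub.trans frontier_subset_closure) (hu.rest.sub_eq_zero hv.rest)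
    rwa [union_sdiff_cancel hsub] at h
  · have h := hu.neumann.sub_eq_zero hv.neumann
    have e : weakDz (u : L2 (domain b d ξ)) - weakDz (v : L2 (domain b d ξ)) =
        weakDz ((u - v : sobolev (domain b d ξ) 3) : L2 (domain b d ξ)) :=
      (weakD_sub isOpen_domain u.2 v.2 (by simp)).symm
    rwa [e] at h

theorem exists_c1Norm_le (hb : 0 < b) (hd : 0 < d) (hξ : 0 < ξ) :
    ∃ c : ℝ, 0 < c ∧ ∀ V : sobolev (domain b d ξ) 3,
      ∃ f : E3 → ℂ, f =ᵐ[volume.restrict (domain b d ξ)] (V : L2 (domain b d ξ)) ∧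
        IsC1Closure (domain b d ξ) f ∧
        c * c1Norm (domain b d ξ) f ≤ sobolevNorm 3 (V : L2 (domain b d ξ)) := by
  obtain ⟨C, hC, hE⟩ := exists_c1_representative (domain_eq_box (b := b) (d := d) (ξ := ξ))
    (lowerCorner_neg hb hξ) (upperCorner_pos hb hd)
  have : Nonempty (domain b d ξ) := ⟨⟨0, by simp [domain, hb, hd, hξ]⟩⟩
  refine ⟨1 / (4 * C), by positivity, fun V => ?_⟩
  obtain ⟨f, g, f1, f2, f3, g1, -, g3, f4, f5⟩ := hE V V.2
  refine ⟨f, f2, ⟨f4, f1, fun i => ⟨g i, g1 i, fun p hp => (f5 i p hp).symm⟩⟩, ?_⟩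
  have h := c1Norm_le (fun p hp => f3 p (subset_closure hp)) fun i p hp => by
    rw [f5 i p hp]; exact g3 i p (subset_closure hp)
  rw [one_div, inv_mul_le_iff₀ (by positivity)]
  linarith

/-- Comparing the minimal value of the functional with its value at `Vex + E`. -/
theorem minimizer_bounds {μ δ x y N e l : ℝ} (hδ : 0 < δ) (hδ1 : δ < 1) (hN : 0 ≤ N)
    (he0 : 0 ≤ e) (he : e ≤ δ) (hl0 : 0 ≤ l) (hl : l ≤ 3 * e)
    (h : y ^ 2 + δ * x ^ 2 ≤ δ⁻¹ * l ^ 2 + δ * μ ^ 2) (hμ0 : 0 ≤ μ) (hμ : μ ≤ N + e) :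
    x ≤ 4 * (1 + N) ∧ y ≤ 4 * (1 + N) * Real.sqrt δ := by
  have h1 : δ⁻¹ * l ^ 2 ≤ 9 * δ := by
    rw [inv_mul_le_iff₀ hδ]
    nlinarith
  have h2 : μ ^ 2 ≤ (1 + N) ^ 2 := pow_le_pow_left₀ hμ0 (by linarith) 2
  -- The contributions 9 and 1 add to 10, which is below 16 = 4². Here `μ` is the H³ norm of the
  -- competitor, not the weight parameter.
  have h3 : y ^ 2 + δ * x ^ 2 ≤ δ * (4 * (1 + N)) ^ 2 := by
    have h4 := mul_le_mul_of_nonneg_left h2 hδ.le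
    have h5 : δ * 1 ≤ δ * (1 + N) ^ 2 := by gcongr; nlinarith
    nlinarith
  constructor
  · have h4 : δ * x ^ 2 ≤ δ * (4 * (1 + N)) ^ 2 := by nlinarith [sq_nonneg y]
    exact abs_le_of_sq_le_sq' (le_of_mul_le_mul_left h4 hδ) (by linarith) |>.2
  · have h4 : y ^ 2 ≤ (4 * (1 + N) * Real.sqrt δ) ^ 2 := by
      rw [mul_pow, Real.sq_sqrt hδ.le]
      nlinarith [mul_nonneg hδ.le (sq_nonneg x)]
    exact abs_le_of_sq_le_sq' h4 (by positivity) |>.2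

end Functional

end QuasiReversibility
end

/-! ### The theorem -/

theorem theorem4p2 (b d ξ : ℝ) (hb : 0 < b) (hd : 0 < d) (hξ : 0 < ξ) :
    -- existence and uniqueness of the minimizer
    (∀ s : ℝ, ξ < s →
      ∀ (ψ₀ ψ₁ : E3 → ℂ) (Q : sobolev (domain b d ξ) 3),
        BoundaryConditions b d ξ ψ₀ ψ₁ (Q : L2 (domain b d ξ)) →
        ∀ μ ν α : ℝ, 0 < μ → 0 < ν → 0 < α →
          ∃! W : sobolev (domain b d ξ) 3, IsTailMinimizer b d ξ s μ ν α Q W) ∧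
    -- convergence rate and stability, with constants depending only on the domain
    (∃ c C : ℝ, 0 < c ∧ 0 < C ∧
      ∀ s : ℝ, ξ < s →
      ∀ ν₀ l₀ : ℝ, 1 ≤ ν₀ → 1 ≤ l₀ →
      ∀ ν : ℝ, ν₀ ≤ ν →
      ∀ δ₀ : ℝ, 0 < δ₀ → δ₀ < Real.exp (-2 * l₀ * tNu d ξ s ν) →
      ∀ δ : ℝ, 0 < δ → δ < δ₀ →
      -- the noiseless data, the exact tail, and the extension of the noiseless data
      ∀ (ψ₀' ψ₁' : E3 → ℂ) (Vex Qex : sobolev (domain b d ξ) 3),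
        weakLaplacian (Vex : L2 (domain b d ξ)) = 0 →
        BoundaryConditions b d ξ ψ₀' ψ₁' (Vex : L2 (domain b d ξ)) →
        BoundaryConditions b d ξ ψ₀' ψ₁' (Qex : L2 (domain b d ξ)) →
        (∃ K : ℝ, 0 < K ∧ sobolevNorm 3 (Qex : L2 (domain b d ξ)) ≤
          K * sobolevNorm 3 (Vex : L2 (domain b d ξ))) →
      -- the noisy data and their extension
      ∀ (ψ₀ ψ₁ : E3 → ℂ) (Q : sobolev (domain b d ξ) 3),
        BoundaryConditions b d ξ ψ₀ ψ₁ (Q : L2 (domain b d ξ)) →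
        sobolevNorm 3 ((Q - Qex : sobolev (domain b d ξ) 3) : L2 (domain b d ξ)) < δ →
      -- the regularized tail `V = W + Q` for `μ = μ(δ)`, `α = δ`
      ∀ W V : sobolev (domain b d ξ) 3,
        IsTailMinimizer b d ξ s (muOf d ξ s ν δ) ν δ Q W → V = W + Q →
        sobolevNorm 2 ((V - Vex : sobolev (domain b d ξ) 3) : L2 (domain b d ξ)) ≤
            C * (1 + sobolevNorm 3 (Vex : L2 (domain b d ξ))) *
              Real.sqrt δ * Real.sqrt (muOf d ξ s ν δ) ∧
        (∃ f : E3 → ℂ, f =ᵐ[volume.restrict (domain b d ξ)] (V : L2 (domain b d ξ)) ∧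
          IsC1Closure (domain b d ξ) f ∧
          c * c1Norm (domain b d ξ) f ≤ sobolevNorm 3 (V : L2 (domain b d ξ))) ∧
        sobolevNorm 3 (V : L2 (domain b d ξ)) ≤
            C * (1 + sobolevNorm 3 (Vex : L2 (domain b d ξ)))) := by
  refine ⟨fun s hs _ _ Q _ μ ν α hμ hν hα => existsUnique_tailMinimizer hb hd hξ hs hμ hν hα Q, ?_⟩
  obtain ⟨c, hc, hc1⟩ := exists_c1Norm_le hb hd hξ
  obtain ⟨K, hK, hap⟩ := exists_sobolevNorm_two_le (domain_eq_box (b := b) (d := d) (ξ := ξ))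
    (lowerCorner_neg hb hξ) (upperCorner_pos hb hd)
  -- The H² estimate needs `7K + 1`: ‖Δh‖ contributes 4 from ΔV and 3 from ΔE, and E itself
  -- contributes 1. The H³ bound needs 4.
  refine ⟨c, 7 * K + 4, hc, by linarith, ?_⟩
  intro s hs ν₀ l₀ hν₀ hl₀ ν hν δ₀ _ hδ₀ δ hδ hδδ₀ _ _ Vex Qex hVex bcV bcQ _ _ _ Q _ hQ W V hW hVW
  have ho : IsOpen (domain b d ξ) := isOpen_domain
  have ht : 0 < tNu d ξ s ν := tNu_pos hd hξ hs (by linarith)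
  have hμ : l₀ < muOf d ξ s ν δ := lt_muOf hδ ht (hδδ₀.trans hδ₀)
  have hexp : Real.exp (2 * muOf d ξ s ν δ * tNu d ξ s ν) = δ⁻¹ := by
    rw [muOf_mul_tNu hδ ht.ne', Real.exp_neg, Real.exp_log hδ]
  have hδ1 : δ < 1 := (hδδ₀.trans hδ₀).trans_le (Real.exp_le_one_iff.2 (by nlinarith))
  set E : sobolev (domain b d ξ) 3 := Q - Qex with hE
  set N := sobolevNorm 3 (Vex : L2 (domain b d ξ)) with hN
  have hN0 : 0 ≤ N := sobolevNorm_nonneg _ _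
  have hlE := norm_weakLaplacian_le (E : L2 (domain b d ξ))
  -- The competitor: `Vex - Qex` has zero data, and adding `Q` turns it into `Vex + E`.
  have hcomp := bcV.sub_mem_H30 hd hξ bcQ
  have hsum : Vex - Qex + Q = Vex + E := by rw [hE]; abel
  have hlap : weakLaplacian ((Vex + E : sobolev (domain b d ξ) 3) : L2 (domain b d ξ)) =
      weakLaplacian (E : L2 (domain b d ξ)) := by
    have h := weakLaplacian_add ho Vex.2 E.2
    rwa [hVex, zero_add] at h
  have hmin := (le_tailFunctional hs (by linarith) (by linarith) (W + Q)).trans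
    ((hW.2 _ hcomp).trans (tailFunctional_le hs (by linarith) (by linarith) _))
  rw [hexp, hsum, hlap, ← hVW] at hmin
  obtain ⟨hx, hy⟩ := minimizer_bounds hδ hδ1 hN0 (sobolevNorm_nonneg _ _) hQ.le (norm_nonneg _)
    hlE hmin (sobolevNorm_nonneg _ _) (sobolevNorm_add_le ho Vex.2 E.2)
  refine ⟨?_, hc1 V, hx.trans ?_⟩
  -- `V - Vex` itself does not satisfy homogeneous boundary conditions because the data are noisy;
  -- subtracting `E` repairs this at a cost of order δ.
  · have hh : W - (Vex - Qex) ∈ H30 b d ξ := (H30Submodule b d ξ).sub_mem hW.1 hcomp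
    set h : sobolev (domain b d ξ) 3 := W - (Vex - Qex) with hhdef
    have hVh : V = h + (Vex + E) := by rw [hVW, hhdef, hE]; abel
    have e1 : V - Vex = h + E := by rw [hVh]; abel
    have e2 : weakLaplacian (V : L2 (domain b d ξ)) =
        weakLaplacian (h : L2 (domain b d ξ)) + weakLaplacian (E : L2 (domain b d ξ)) := by
      rw [hVh, ← hlap]
      exact weakLaplacian_add ho h.2 (Vex + E).2
    have h1 := hap h h.2 hh.1
    have h2 : ‖weakLaplacian (h : L2 (domain b d ξ))‖ ≤
        ‖weakLaplacian (V : L2 (domain b d ξ))‖ + ‖weakLaplacian (E : L2 (domain b d ξ))‖ := by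
      rw [eq_sub_of_add_eq e2.symm]
      exact norm_sub_le _ _
    have h3 : sobolevNorm 2 ((V - Vex : sobolev (domain b d ξ) 3) : L2 (domain b d ξ)) ≤
        sobolevNorm 2 (h : L2 (domain b d ξ)) + sobolevNorm 2 (E : L2 (domain b d ξ)) := by
      rw [e1]
      exact sobolevNorm_add_le ho (fun β hβ => h.2 β (by omega)) (fun β hβ => E.2 β (by omega))
    have h4 := sobolevNorm_mono (show 2 ≤ 3 by norm_num) (E : L2 (domain b d ξ))
    have hδs : δ ≤ Real.sqrt δ := Real.le_sqrt_of_sq_le (by nlinarith)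
    -- The threshold on δ gives `μ(δ) > l₀ ≥ 1`, so the factor in the stated rate can be inserted
    -- for free.
    have hμ1 : 1 ≤ Real.sqrt (muOf d ξ s ν δ) := Real.one_le_sqrt.2 (by linarith)
    have hδN : δ ≤ (1 + N) * Real.sqrt δ := by nlinarith [Real.sqrt_nonneg δ]
    have h5 : ‖weakLaplacian (h : L2 (domain b d ξ))‖ ≤ 7 * ((1 + N) * Real.sqrt δ) := by
      linarith
    have h6 := mul_le_mul_of_nonneg_left h5 hK
    have h7 : 0 ≤ (1 + N) * Real.sqrt δ := by positivity
    calc sobolevNorm 2 ((V - Vex : sobolev (domain b d ξ) 3) : L2 (domain b d ξ))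
        ≤ (7 * K + 4) * (1 + N) * Real.sqrt δ := by linarith
      _ ≤ (7 * K + 4) * (1 + N) * Real.sqrt δ * Real.sqrt (muOf d ξ s ν δ) :=
        le_mul_of_one_le_right (by positivity) hμ1
  · have := mul_nonneg hK (by linarith : 0 ≤ 1 + N)
    linarith
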